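/- **Notation.** For $z=\xi+i\eta\in\mathbb C^n$ and $t\in\mathbb R^n$ let $z\cdot t=\sum_j z_jt_j$, and $\widehat\varphi(\xi)=\int e^{-2\pi i x\cdot\xi}\varphi(x)\,dx$. Let $\mathcal K_1(\mathbb R^n)$ be the space of all $\varphi\in C^\infty(\mathbb R^n)$ with $\sup_{t}e^{k|t|}|\varphi^{(\alpha)}(t)|<\infty$ for all $k\in\mathbb N_0$ and all multi-indices $\alpha$, with the topology given by these seminorms, and $\mathcal K_1'(\mathbb R^n)$ its dual. Let $\Sigma_1^1(\mathbb R^n)\subset\mathcal K_1(\mathbb R^n)$ be the space of all entire functions $\varphi$ with $\sup_{x\in\mathbb R^n}e^{\lambda|x|}|\varphi(x)|<\infty$ and $\sup_{\xi\in\mathbb R^n}e^{\lambda|\xi|}|\widehat\varphi(\xi)|<\infty$ for all $\lambda>0$, with the topology given by these seminorms, and $(\Sigma_1^1)'(\mathbb R^n)$ its dual. Whenever the (bilinear) dual pairing is defined, the short-time Fourier transform is $$V_\psi f(x,z)=\big\langle f(t),\,e^{-2\pi i z\cdot t}\,\overline{\psi(t-x)}\big\rangle ,$$ namely for $x,z=\xi\in\mathbb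 R^n$ if $f\in(\Sigma_1^1)'(\mathbb R^n)$, $\psi\in\Sigma_1^1(\mathbb R^n)$, and for $x\in\mathbb R^n$, $z\in\mathbb C^n$ if $f\in\mathcal K_1'(\mathbb R^n)$, $\psi\in\mathcal K_1(\mathbb R^n)$. Let $\mathfrak M_1$ be the class of all measurable, locally bounded $m:\mathbb R^{2n}\to(0,\infty)$ for which there are $A>0$ and $a,s\ge 0$ with $$\frac{m(x_1+x_2,\xi_1+\xi_2)}{m(x_1,\xi_1)}\le A\,e^{a|x_2|}(1+|\xi_2|)^s\qquad\text{for all }(x_1,\xi_1),(x_2,\xi_2)\in\mathbb R^{2n}.$$ For $p,q\in[1,\infty]$ let $\|F\|_{L^{p,q}_m}=\Big(\int_{\mathbb R^n}\Big(\int_{\mathbb R^n}|F(x,\xi)m(x,\xi)|^p\,dx\Big)^{q/p}d\xi\Big)^{1/q}$, with the usual changes if $p=\infty$ or $q=\infty$. Fix $\varphi\in\Sigma_1^1(\mathbb R^n)\setminus\{0\}$ and let $$M^{p,q}_m(\mathbb R^n)=\{f\in(\Sigma_1^1)'(\mathbb R^n):\ \|f\|_{M^{p,q}_m}:=\|V_\varphi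 f\|_{L^{p,q}_m}<\infty\}.$$ **Proposition.** Let $m\in\mathfrak M_1$, $p,q\in[1,\infty]$ and $\psi\in\mathcal K_1(\mathbb R^n)\setminus\{0\}$. Every $f\in M^{p,q}_m(\mathbb R^n)$ has a unique extension to an element of $\mathcal K_1'(\mathbb R^n)$, again denoted by $f$, so that $V_\psi f(x,z)$ is defined for $x\in\mathbb R^n$, $z\in\mathbb C^n$; for each $x$ it is an entire function of $z$. For every $\lambda\ge 0$ there is a constant $C_\lambda>0$, independent of $f$, such that for all $f\in M^{p,q}_m(\mathbb R^n)$ $$\sup_{|\eta|\le\lambda}\left(\int_{\mathbb R^n}\left(\int_{\mathbb R^n}\big|e^{-2\pi x\cdot\eta}\,V_\psi f(x,\xi+i\eta)\,m(x,\xi)\big|^p\,dx\right)^{q/p}d\xi\right)^{1/q}\le C_\lambda\,\|f\|_{M^{p,q}_m}$$ (with the usual changes if $p=\infty$ or $q=\infty$). The same holds, with a constant that also depends on $\gamma$, if the norm on the right-hand side is computed with a window $\gamma\in\mathcal K_1(\mathbb R^n)\setminus\{0\}$ instead of $\varphi$, that is, with $\|V_\gamma f\|_{L^{p,q}_m}$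 in place of $\|f\|_{M^{p,q}_m}$. -/

import Mathlib

open MeasureTheory
open scoped FourierTransform ENNReal ContDiff ComplexConjugate

noncomputable section

/-- The Euclidean space `ℝⁿ`. -/
abbrev RSpace (n : ℕ) : Type := EuclideanSpace ℝ (Fin n)

/-- The bilinear expression `z · t = ∑ⱼ zⱼ tⱼ` for `z ∈ ℂⁿ`, `t ∈ ℝⁿ`. -/
def cdot {n : ℕ} (z : Fin n → ℂ) (t : RSpace n) : ℂ := ∑ j, z j * (t j : ℂ)

/-- The point `ξ + i η` of `ℂⁿ`. -/
def complexPoint {n : ℕ} (ξ η : RSpace n) : Fin n → ℂ :=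
  fun j => (ξ j : ℂ) + (η j : ℂ) * Complex.I

/-- The function `t ↦ conj (M_z T_x ψ (t))` for real `z`, continued holomorphically to `z ∈ ℂⁿ`:
`t ↦ e^{-2π i z·t} conj (ψ (t - x))`. -/
def timeFreqFun {n : ℕ} (ψ : RSpace n → ℂ) (x : RSpace n) (z : Fin n → ℂ) : RSpace n → ℂ :=
  fun t => Complex.exp (-2 * Real.pi * Complex.I * cdot z t) * conj (ψ (t - x))

/-- The seminorm `v ↦ sup_x w(x) ‖T v x‖`. -/
def supSeminorm {V X G : Type*} [AddCommGroup V] [Module ℂ V] [Nonempty X]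
    [NormedAddCommGroup G] [NormedSpace ℂ G] (w : X → ℝ) (hw : ∀ x, 0 ≤ w x)
    (T : V →ₗ[ℂ] (X → G)) (h : ∀ v, BddAbove (Set.range fun x => w x * ‖T v x‖)) :
    Seminorm ℂ V :=
  Seminorm.of (fun v => ⨆ x, w x * ‖T v x‖)
    (by
      intro u v
      refine ciSup_le fun x => ?_
      have h1 := le_ciSup (h u) x
      have h2 := le_ciSup (h v) x
      have h3 : ‖T (u + v) x‖ ≤ ‖T u x‖ + ‖T v x‖ := by
        rw [map_add]; exact norm_add_le _ _
      have h4 := mul_le_mul_of_nonneg_left h3 (hw x)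
      linarith)
    (by
      intro a v
      have : ∀ x, w x * ‖T (a • v) x‖ = ‖a‖ * (w x * ‖T v x‖) := by
        intro x
        rw [map_smul, Pi.smul_apply, norm_smul]; ring
      simp only [this]
      exact (Real.mul_iSup_of_nonneg (norm_nonneg a) _).symm)

/-! ### The Hasumi-Silva space of exponentially rapidly decreasing smooth functions -/

/-- The `ℂ`-vector space of all `φ ∈ C^∞(ℝⁿ)` all of whose derivatives decay faster than
`e^{-k|t|}` for every `k`. -/
def k1Submodule (n : ℕ) : Submodule ℂ (RSpace n → ℂ) where
  carrier := {φ | ContDiff ℝ ∞ φ ∧ ∀ k j : ℕ, ∃ C : ℝ, ∀ t,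
    Real.exp (k * ‖t‖) * ‖iteratedFDeriv ℝ j φ t‖ ≤ C}
  add_mem' := by
    rintro f g ⟨hf, hf'⟩ ⟨hg, hg'⟩
    refine ⟨hf.add hg, fun k j => ?_⟩
    obtain ⟨C, hC⟩ := hf' k j
    obtain ⟨D, hD⟩ := hg' k j
    refine ⟨C + D, fun t => ?_⟩
    rw [iteratedFDeriv_add_apply (hf.contDiffAt.of_le (by exact_mod_cast le_top))
      (hg.contDiffAt.of_le (by exact_mod_cast le_top))]
    have := mul_le_mul_of_nonneg_left
      (norm_add_le (iteratedFDeriv ℝ j f t) (iteratedFDeriv ℝ j g t))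
      (Real.exp_pos (k * ‖t‖)).le
    linarith [hC t, hD t]
  zero_mem' := by
    refine ⟨contDiff_const, fun k j => ⟨0, fun t => ?_⟩⟩
    have h0 : (0 : RSpace n → ℂ) = fun _ => 0 := rfl
    rw [h0, iteratedFDeriv_fun_zero]
    simp
  smul_mem' := by
    rintro c f ⟨hf, hf'⟩
    refine ⟨contDiff_const.smul hf, fun k j => ?_⟩
    obtain ⟨C, hC⟩ := hf' k j
    refine ⟨‖c‖ * C, fun t => ?_⟩
    rw [iteratedFDeriv_const_smul_apply (hf.contDiffAt.of_le (by exact_mod_cast le_top)),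
      norm_smul]
    have := mul_le_mul_of_nonneg_left (hC t) (norm_nonneg c)
    linarith

/-- The Hasumi-Silva test function space `𝒦₁(ℝⁿ)`. -/
def K1 (n : ℕ) : Type := k1Submodule n

instance (n : ℕ) : AddCommGroup (K1 n) := inferInstanceAs (AddCommGroup (k1Submodule n))

instance (n : ℕ) : Module ℂ (K1 n) := inferInstanceAs (Module ℂ (k1Submodule n))

instance (n : ℕ) : CoeFun (K1 n) (fun _ => RSpace n → ℂ) := ⟨fun φ => φ.1⟩

/-- The linear map `φ ↦ D^j φ` on `𝒦₁(ℝⁿ)`. -/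
def K1.iteratedDerivₗ (n j : ℕ) :
    K1 n →ₗ[ℂ] (RSpace n → ContinuousMultilinearMap ℝ (fun _ : Fin j => RSpace n) ℂ) where
  toFun φ := iteratedFDeriv ℝ j φ
  map_add' φ χ := by
    funext t
    exact iteratedFDeriv_add_apply (φ.2.1.contDiffAt.of_le (by exact_mod_cast le_top))
      (χ.2.1.contDiffAt.of_le (by exact_mod_cast le_top))
  map_smul' c φ := by
    funext t
    exact iteratedFDeriv_const_smul_apply (φ.2.1.contDiffAt.of_le (by exact_mod_cast le_top))

/-- The seminorms `φ ↦ sup_t e^{k|t|} ‖D^j φ(t)‖` of `𝒦₁(ℝⁿ)`, indexed by `(k, j)`. -/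
def K1.seminormFamily (n : ℕ) : SeminormFamily ℂ (K1 n) (ℕ × ℕ) := fun kj =>
  supSeminorm (fun t => Real.exp (kj.1 * ‖t‖)) (fun _ => (Real.exp_pos _).le)
    (K1.iteratedDerivₗ n kj.2) (by
      intro φ
      obtain ⟨C, hC⟩ := φ.2.2 kj.1 kj.2
      exact ⟨C, by rintro _ ⟨t, rfl⟩; exact hC t⟩)

instance (n : ℕ) : TopologicalSpace (K1 n) := (K1.seminormFamily n).moduleFilterBasis.topology

theorem K1.withSeminorms (n : ℕ) : WithSeminorms (K1.seminormFamily n) := ⟨rfl⟩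

/-- The space `𝒦₁'(ℝⁿ)` of distributions of exponential type. -/
abbrev K1Dual (n : ℕ) : Type := K1 n →L[ℂ] ℂ

/-! ### The Gelfand-Shilov space of Beurling type -/

theorem integrable_of_exp_decay {n : ℕ} {φ : RSpace n → ℂ} (hc : Continuous φ)
    (hd : ∀ k : ℕ, ∃ C : ℝ, ∀ t, Real.exp (k * ‖t‖) * ‖φ t‖ ≤ C) : Integrable φ := by
  obtain ⟨C, hC⟩ := hd (n + 1)
  have h1 : Integrable (fun t : RSpace n => C * (1 + ‖t‖) ^ (-((n + 1 : ℕ) : ℝ))) := by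
    refine (integrable_one_add_norm ?_).const_mul C
    simp
  refine h1.mono' hc.aestronglyMeasurable (Filter.Eventually.of_forall fun t => ?_)
  have hp : (0 : ℝ) < 1 + ‖t‖ := by positivity
  have h2 : (1 + ‖t‖) ^ (n + 1) ≤ Real.exp ((n + 1 : ℕ) * ‖t‖) := by
    rw [Real.exp_nat_mul]
    gcongr
    linarith [Real.add_one_le_exp ‖t‖]
  rw [Real.rpow_neg hp.le, Real.rpow_natCast, ← div_eq_mul_inv, le_div_iff₀ (by positivity),
    mul_comm]
  exact (mul_le_mul_of_nonneg_right h2 (norm_nonneg _)).trans (hC t)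

theorem continuous_of_entire_ext {n : ℕ} {φ : RSpace n → ℂ} {Φ : (Fin n → ℂ) → ℂ}
    (h : Differentiable ℂ Φ) (h' : ∀ t : RSpace n, Φ (fun j => (t j : ℂ)) = φ t) :
    Continuous φ := by
  have h1 : φ = fun t : RSpace n => Φ (fun j => (t j : ℂ)) := funext fun t => (h' t).symm
  rw [h1]
  exact h.continuous.comp (by fun_prop)

theorem integrable_of_entire_ext {n : ℕ} {φ : RSpace n → ℂ}
    (he : ∃ Φ : (Fin n → ℂ) → ℂ, Differentiable ℂ Φ ∧
      ∀ t : RSpace n, Φ (fun j => (t j : ℂ)) = φ t)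
    (hd : ∀ k : ℕ, ∃ C : ℝ, ∀ t, Real.exp (k * ‖t‖) * ‖φ t‖ ≤ C) : Integrable φ := by
  obtain ⟨Φ, h, h'⟩ := he
  exact integrable_of_exp_decay (continuous_of_entire_ext h h') hd

/-- The `ℂ`-vector space of all (restrictions to `ℝⁿ` of) entire functions `φ` on `ℂⁿ` such that
`φ` and its Fourier transform decay faster than every exponential on `ℝⁿ`. -/
def gelfandShilovSubmodule (n : ℕ) : Submodule ℂ (RSpace n → ℂ) where
  carrier := {φ | (∃ Φ : (Fin n → ℂ) → ℂ, Differentiable ℂ Φ ∧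
      ∀ t : RSpace n, Φ (fun j => (t j : ℂ)) = φ t) ∧
    (∀ k : ℕ, ∃ C : ℝ, ∀ t, Real.exp (k * ‖t‖) * ‖φ t‖ ≤ C) ∧
    (∀ k : ℕ, ∃ C : ℝ, ∀ ξ, Real.exp (k * ‖ξ‖) * ‖𝓕 φ ξ‖ ≤ C)}
  add_mem' := by
    rintro f g ⟨hf, hf1, hf2⟩ ⟨hg, hg1, hg2⟩
    have hfi := integrable_of_entire_ext hf hf1
    have hgi := integrable_of_entire_ext hg hg1
    obtain ⟨Φ, hΦ, hΦ'⟩ := hf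
    obtain ⟨Γ, hΓ, hΓ'⟩ := hg
    refine ⟨⟨Φ + Γ, hΦ.add hΓ, fun t => by simp [hΦ', hΓ']⟩, fun k => ?_, fun k => ?_⟩
    · obtain ⟨C, hC⟩ := hf1 k
      obtain ⟨D, hD⟩ := hg1 k
      refine ⟨C + D, fun t => ?_⟩
      have := mul_le_mul_of_nonneg_left (norm_add_le (f t) (g t)) (Real.exp_pos (k * ‖t‖)).le
      rw [Pi.add_apply]
      linarith [hC t, hD t]
    · obtain ⟨C, hC⟩ := hf2 k
      obtain ⟨D, hD⟩ := hg2 k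
      refine ⟨C + D, fun t => ?_⟩
      have := mul_le_mul_of_nonneg_left (norm_add_le (𝓕 f t) (𝓕 g t)) (Real.exp_pos (k * ‖t‖)).le
      rw [show 𝓕 (f + g) = 𝓕 f + 𝓕 g from
        VectorFourier.fourierIntegral_add Real.continuous_fourierChar
          continuous_inner hfi hgi, Pi.add_apply]
      linarith [hC t, hD t]
  zero_mem' := by
    refine ⟨⟨0, differentiable_const 0, fun t => rfl⟩, fun k => ⟨0, fun t => by simp⟩,
      fun k => ⟨0, fun t => by simp [Real.fourier_eq]⟩⟩
  smul_mem' := by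
    rintro c f ⟨⟨Φ, hΦ, hΦ'⟩, hf1, hf2⟩
    refine ⟨⟨c • Φ, hΦ.const_smul c, fun t => by simp [hΦ']⟩, fun k => ?_, fun k => ?_⟩
    · obtain ⟨C, hC⟩ := hf1 k
      refine ⟨‖c‖ * C, fun t => ?_⟩
      have := mul_le_mul_of_nonneg_left (hC t) (norm_nonneg c)
      rw [Pi.smul_apply, norm_smul]
      linarith
    · obtain ⟨C, hC⟩ := hf2 k
      refine ⟨‖c‖ * C, fun t => ?_⟩
      have := mul_le_mul_of_nonneg_left (hC t) (norm_nonneg c)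
      rw [show 𝓕 (c • f) = c • 𝓕 f from VectorFourier.fourierIntegral_const_smul _ _ _ _ _,
        Pi.smul_apply, norm_smul]
      linarith

/-- The Gelfand-Shilov space `Σ₁¹(ℝⁿ)`. -/
def GelfandShilov (n : ℕ) : Type := gelfandShilovSubmodule n

instance (n : ℕ) : AddCommGroup (GelfandShilov n) :=
  inferInstanceAs (AddCommGroup (gelfandShilovSubmodule n))

instance (n : ℕ) : Module ℂ (GelfandShilov n) :=
  inferInstanceAs (Module ℂ (gelfandShilovSubmodule n))

instance (n : ℕ) : CoeFun (GelfandShilov n) (fun _ => RSpace n → ℂ) := ⟨fun φ => φ.1⟩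

/-- The inclusion of `Σ₁¹(ℝⁿ)` in the space of all functions. -/
def GelfandShilov.coeₗ (n : ℕ) : GelfandShilov n →ₗ[ℂ] (RSpace n → ℂ) :=
  (gelfandShilovSubmodule n).subtype

theorem GelfandShilov.integrable {n : ℕ} (φ : GelfandShilov n) : Integrable φ :=
  integrable_of_entire_ext φ.2.1 φ.2.2.1

/-- The Fourier transform on `Σ₁¹(ℝⁿ)`. -/
def GelfandShilov.fourierₗ (n : ℕ) : GelfandShilov n →ₗ[ℂ] (RSpace n → ℂ) where
  toFun φ := 𝓕 (φ : RSpace n → ℂ)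
  map_add' φ χ := VectorFourier.fourierIntegral_add Real.continuous_fourierChar
    continuous_inner φ.integrable χ.integrable
  map_smul' _ _ := VectorFourier.fourierIntegral_const_smul _ _ _ _ _

/-- The seminorms `φ ↦ sup_t e^{k|t|} |φ(t)| + sup_ξ e^{k|ξ|} |φ̂(ξ)|` of `Σ₁¹(ℝⁿ)`. -/
def GelfandShilov.seminormFamily (n : ℕ) : SeminormFamily ℂ (GelfandShilov n) ℕ := fun k =>
  supSeminorm (fun t => Real.exp (k * ‖t‖)) (fun _ => (Real.exp_pos _).le)
    (GelfandShilov.coeₗ n) (by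
      intro φ
      obtain ⟨C, hC⟩ := φ.2.2.1 k
      exact ⟨C, by rintro _ ⟨t, rfl⟩; exact hC t⟩) +
  supSeminorm (fun ξ => Real.exp (k * ‖ξ‖)) (fun _ => (Real.exp_pos _).le)
    (GelfandShilov.fourierₗ n) (by
      intro φ
      obtain ⟨C, hC⟩ := φ.2.2.2 k
      exact ⟨C, by rintro _ ⟨t, rfl⟩; exact hC t⟩)

instance (n : ℕ) : TopologicalSpace (GelfandShilov n) :=
  (GelfandShilov.seminormFamily n).moduleFilterBasis.topology

theorem GelfandShilov.withSeminorms (n : ℕ) :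
    WithSeminorms (GelfandShilov.seminormFamily n) := ⟨rfl⟩

/-- The dual `(Σ₁¹)'(ℝⁿ)`. -/
abbrev GelfandShilovDual (n : ℕ) : Type := GelfandShilov n →L[ℂ] ℂ

/-! ### The short-time Fourier transform -/

/-- The real-linear form `t ↦ -2π i z·t`. -/
def expForm {n : ℕ} (z : Fin n → ℂ) : RSpace n →L[ℝ] ℂ :=
  LinearMap.toContinuousLinearMap
    { toFun := fun t => -2 * Real.pi * Complex.I * cdot z t
      map_add' := by
        intro s t
        simp only [cdot, PiLp.add_apply, Complex.ofReal_add, mul_add, Finset.sum_add_distrib]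
      map_smul' := by
        intro c t
        simp only [cdot, PiLp.smul_apply, smul_eq_mul, Complex.ofReal_mul, RingHom.id_apply,
          Complex.real_smul, Finset.mul_sum]
        refine Finset.sum_congr rfl fun j _ => ?_
        ring }

theorem norm_iteratedFDeriv_exp_le {n : ℕ} (L : RSpace n →L[ℝ] ℂ) (j : ℕ) :
    ∃ C : ℝ, 0 ≤ C ∧ ∀ t, ‖iteratedFDeriv ℝ j (fun t => Complex.exp (L t)) t‖ ≤
      C * Real.exp (‖L‖ * ‖t‖) := by
  induction j with
  | zero =>
    refine ⟨1, zero_le_one, fun t => ?_⟩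
    rw [norm_iteratedFDeriv_zero, Complex.norm_exp, one_mul, Real.exp_le_exp]
    exact (Complex.re_le_norm _).trans (L.le_opNorm t)
  | succ j ih =>
    obtain ⟨C, hC0, hC⟩ := ih
    let A : ℂ →L[ℝ] (RSpace n →L[ℝ] ℂ) :=
      ContinuousLinearMap.flip (ContinuousLinearMap.compL ℝ (RSpace n) ℂ ℂ) L ∘L
        ContinuousLinearMap.mul ℝ ℂ
    have hs : ContDiff ℝ ∞ (fun t => Complex.exp (L t)) :=
      Complex.contDiff_exp.comp L.contDiff
    have hA : fderiv ℝ (fun t => Complex.exp (L t)) = A ∘ fun t => Complex.exp (L t) := by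
      funext t
      have h1 : HasFDerivAt (fun t => Complex.exp (L t)) (Complex.exp (L t) • L) t :=
        L.hasFDerivAt.cexp
      rw [h1.fderiv]
      ext v
      simp [A]
    refine ⟨‖A‖ * C, by positivity, fun t => ?_⟩
    rw [← norm_iteratedFDeriv_fderiv, hA]
    refine (A.norm_iteratedFDeriv_comp_left (N := ∞) hs.contDiffAt
      (by exact_mod_cast le_top)).trans ?_
    rw [mul_assoc]
    exact mul_le_mul_of_nonneg_left (hC t) (norm_nonneg _)

theorem timeFreqFun_mem_k1 {n : ℕ} {ψ : RSpace n → ℂ} (hψ : ψ ∈ k1Submodule n) (x : RSpace n)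
    (z : Fin n → ℂ) : timeFreqFun ψ x z ∈ k1Submodule n := by
  obtain ⟨hs, hd⟩ := hψ
  have he : ContDiff ℝ ∞ (fun t : RSpace n => Complex.exp (expForm z t)) :=
    Complex.contDiff_exp.comp (expForm z).contDiff
  have hs1 : ContDiff ℝ ∞ (fun t : RSpace n => ψ (t - x)) := by fun_prop
  have hs2 : ContDiff ℝ ∞ (fun t : RSpace n => conj (ψ (t - x))) :=
    Complex.conjCLE.contDiff.comp hs1
  have hj : ∀ (i : ℕ) (t : RSpace n), ‖iteratedFDeriv ℝ i (fun t => conj (ψ (t - x))) t‖ =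
      ‖iteratedFDeriv ℝ i ψ (t - x)‖ := by
    intro i t
    have h1 := Complex.conjLIE.norm_iteratedFDeriv_comp_left (fun t : RSpace n => ψ (t - x)) t i
    rw [iteratedFDeriv_comp_sub] at h1
    exact h1
  refine ⟨he.mul hs2, fun k j => ?_⟩
  choose C hC0 hC using norm_iteratedFDeriv_exp_le (expForm z)
  obtain ⟨N, hN⟩ := exists_nat_ge (k + ‖expForm z‖)
  choose D hD using hd N
  refine ⟨∑ i ∈ Finset.range (j + 1),
    (j.choose i : ℝ) * C i * (Real.exp (N * ‖x‖) * D (j - i)), fun t => ?_⟩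
  have h1 := norm_iteratedFDeriv_mul_le he hs2 t (n := j) (by exact_mod_cast le_top)
  refine (mul_le_mul_of_nonneg_left h1 (Real.exp_pos _).le).trans ?_
  rw [Finset.mul_sum]
  refine Finset.sum_le_sum fun i _ => ?_
  rw [hj]
  have h2 : Real.exp (k * ‖t‖) * Real.exp (‖expForm z‖ * ‖t‖) ≤
      Real.exp (N * ‖x‖) * Real.exp (N * ‖t - x‖) := by
    rw [← Real.exp_add, ← Real.exp_add, Real.exp_le_exp]
    have h3 : ‖t‖ ≤ ‖x‖ + ‖t - x‖ := by
      simpa using norm_add_le x (t - x)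
    have h4 : (0 : ℝ) ≤ N := Nat.cast_nonneg N
    nlinarith [norm_nonneg t]
  have h5 := hC i t
  have h6 := hD (j - i) (t - x)
  set a := ‖iteratedFDeriv ℝ i (fun t : RSpace n => Complex.exp (expForm z t)) t‖ with ha
  set b := ‖iteratedFDeriv ℝ (j - i) ψ (t - x)‖ with hb
  have hb0 : 0 ≤ b := norm_nonneg _
  have hCi := hC0 i
  calc Real.exp (k * ‖t‖) * ((j.choose i : ℝ) * a * b)
      ≤ Real.exp (k * ‖t‖) *
          ((j.choose i : ℝ) * (C i * Real.exp (‖expForm z‖ * ‖t‖)) * b) := by gcongr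
    _ = (j.choose i : ℝ) * C i *
          (Real.exp (k * ‖t‖) * Real.exp (‖expForm z‖ * ‖t‖)) * b := by ring
    _ ≤ (j.choose i : ℝ) * C i * (Real.exp (N * ‖x‖) * Real.exp (N * ‖t - x‖)) * b := by gcongr
    _ = (j.choose i : ℝ) * C i * (Real.exp (N * ‖x‖) * (Real.exp (N * ‖t - x‖) * b)) := by ring
    _ ≤ _ := by gcongr

theorem norm_exp_real_cdot {n : ℕ} (ξ t : RSpace n) :
    ‖Complex.exp (-2 * Real.pi * Complex.I * cdot (fun j => (ξ j : ℂ)) t)‖ = 1 := by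
  have h : -2 * Real.pi * Complex.I * cdot (fun j => (ξ j : ℂ)) t =
      ((-2 * Real.pi * ∑ j, ξ j * t j : ℝ) : ℂ) * Complex.I := by
    simp only [cdot]; push_cast; ring
  rw [h, Complex.norm_exp_ofReal_mul_I]

theorem norm_fourier_timeFreqFun {n : ℕ} (φ : RSpace n → ℂ) (x ξ τ : RSpace n) :
    ‖𝓕 (timeFreqFun φ x (fun j => (ξ j : ℂ))) τ‖ = ‖𝓕 φ (-(τ + ξ))‖ := by
  have hc : ∀ t : RSpace n, cdot (fun j => (ξ j : ℂ)) t = ((inner ℝ t ξ : ℝ) : ℂ) := by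
    intro t
    simp [cdot, PiLp.inner_apply]
  rw [Real.fourier_eq', Real.fourier_eq']
  have h1 := integral_add_right_eq_self (μ := (volume : Measure (RSpace n)))
    (fun t : RSpace n => Complex.exp (((-2 * Real.pi * inner ℝ t τ : ℝ) : ℂ) * Complex.I) •
      timeFreqFun φ x (fun j => (ξ j : ℂ)) t) x
  rw [← h1]
  have h2 : ∀ t : RSpace n,
      Complex.exp (((-2 * Real.pi * inner ℝ (t + x) τ : ℝ) : ℂ) * Complex.I) •
        timeFreqFun φ x (fun j => (ξ j : ℂ)) (t + x) =
      Complex.exp (((-2 * Real.pi * inner ℝ x (τ + ξ) : ℝ) : ℂ) * Complex.I) *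
        conj (Complex.exp (((-2 * Real.pi * inner ℝ t (-(τ + ξ)) : ℝ) : ℂ) * Complex.I) • φ t) := by
    intro t
    simp only [timeFreqFun, hc, smul_eq_mul, map_mul, ← Complex.exp_conj, Complex.conj_ofReal,
      Complex.conj_I, add_sub_cancel_right, ← mul_assoc, ← Complex.exp_add]
    congr 2
    simp only [inner_add_left, inner_add_right, inner_neg_right]
    push_cast
    ring
  simp only [h2]
  rw [integral_const_mul, integral_conj, norm_mul, Complex.norm_exp_ofReal_mul_I, one_mul,
    RCLike.norm_conj]

theorem timeFreqFun_mem_gelfandShilov {n : ℕ} {φ : RSpace n → ℂ}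
    (hφ : φ ∈ gelfandShilovSubmodule n) (x ξ : RSpace n) :
    timeFreqFun φ x (fun j => (ξ j : ℂ)) ∈ gelfandShilovSubmodule n := by
  obtain ⟨⟨Φ, hΦ, hΦ'⟩, h1, h2⟩ := hφ
  refine ⟨⟨fun w => Complex.exp (-2 * Real.pi * Complex.I * ∑ j, (ξ j : ℂ) * w j) *
      star (Φ (star w - fun j => (x j : ℂ))), ?_, ?_⟩, fun k => ?_, fun k => ?_⟩
  · have h3 : Differentiable ℂ (fun w : Fin n → ℂ => Φ (w - fun j => (x j : ℂ))) :=
      hΦ.comp (differentiable_id.sub_const _)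
    have h4 : Differentiable ℂ
        (fun w : Fin n → ℂ => star (Φ (star w - fun j => (x j : ℂ)))) := by
      intro w
      have h5 := (h3 (star w)).star_star
      rw [star_star] at h5
      exact h5
    exact Differentiable.mul (by fun_prop) h4
  · intro t
    simp only [timeFreqFun, cdot]
    congr 2
    rw [← hΦ']
    congr 1
    funext j
    simp
  · obtain ⟨C, hC⟩ := h1 k
    refine ⟨Real.exp (k * ‖x‖) * C, fun t => ?_⟩
    have h3 : ‖timeFreqFun φ x (fun j => (ξ j : ℂ)) t‖ = ‖φ (t - x)‖ := by
      rw [timeFreqFun, norm_mul, norm_exp_real_cdot, one_mul, RCLike.norm_conj]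
    have h4 : Real.exp (k * ‖t‖) ≤ Real.exp (k * ‖x‖) * Real.exp (k * ‖t - x‖) := by
      rw [← Real.exp_add, ← mul_add]
      have : ‖t‖ ≤ ‖x‖ + ‖t - x‖ := by simpa using norm_add_le x (t - x)
      gcongr
    rw [h3]
    calc _ ≤ Real.exp (k * ‖x‖) * Real.exp (k * ‖t - x‖) * ‖φ (t - x)‖ := by gcongr
      _ = Real.exp (k * ‖x‖) * (Real.exp (k * ‖t - x‖) * ‖φ (t - x)‖) := by ring
      _ ≤ _ := by gcongr; exact hC _
  · obtain ⟨C, hC⟩ := h2 k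
    refine ⟨Real.exp (k * ‖ξ‖) * C, fun τ => ?_⟩
    have h4 : Real.exp (k * ‖τ‖) ≤ Real.exp (k * ‖ξ‖) * Real.exp (k * ‖-(τ + ξ)‖) := by
      rw [← Real.exp_add, ← mul_add, norm_neg]
      have : ‖τ‖ ≤ ‖ξ‖ + ‖τ + ξ‖ := by
        have := norm_sub_le (τ + ξ) ξ
        rw [add_sub_cancel_right] at this
        linarith
      gcongr
    rw [norm_fourier_timeFreqFun]
    calc _ ≤ Real.exp (k * ‖ξ‖) * Real.exp (k * ‖-(τ + ξ)‖) * ‖𝓕 φ (-(τ + ξ))‖ := by gcongr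
      _ = Real.exp (k * ‖ξ‖) * (Real.exp (k * ‖-(τ + ξ)‖) * ‖𝓕 φ (-(τ + ξ))‖) := by ring
      _ ≤ _ := by gcongr; exact hC _

/-- For `F ∈ 𝒦₁'(ℝⁿ)`, `ψ ∈ 𝒦₁(ℝⁿ)`, `x ∈ ℝⁿ` and `z ∈ ℂⁿ`, the short-time Fourier transform
`V_ψ F(x, z) = ⟨F(t), e^{-2π i z·t} conj (ψ (t - x))⟩`. -/
def stft {n : ℕ} (ψ : K1 n) (F : K1Dual n) (x : RSpace n) (z : Fin n → ℂ) : ℂ :=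
  F ⟨timeFreqFun ψ x z, timeFreqFun_mem_k1 ψ.2 x z⟩

/-- For `f ∈ (Σ₁¹)'(ℝⁿ)`, `φ ∈ Σ₁¹(ℝⁿ)` and `x, ξ ∈ ℝⁿ`, the short-time Fourier transform
`V_φ f(x, ξ) = ⟨f(t), e^{-2π i ξ·t} conj (φ (t - x))⟩`. -/
def stftGS {n : ℕ} (φ : GelfandShilov n) (f : GelfandShilovDual n) (x ξ : RSpace n) : ℂ :=
  f ⟨timeFreqFun φ x (fun j => (ξ j : ℂ)), timeFreqFun_mem_gelfandShilov φ.2 x ξ⟩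

/-! ### Weights, mixed norms and modulation spaces -/

/-- The weight class `𝔐₁`: positive, measurable, locally bounded functions `m` on `ℝ²ⁿ` with
`m(x₁ + x₂, ξ₁ + ξ₂) / m(x₁, ξ₁) ≤ A e^{a|x₂|} (1 + |ξ₂|)^s` for some `A > 0` and `a, s ≥ 0`. -/
structure IsWeightM1 {n : ℕ} (m : RSpace n × RSpace n → ℝ) : Prop where
  pos : ∀ y, 0 < m y
  measurable : Measurable m
  locally_bounded : ∀ K : Set (RSpace n × RSpace n), IsCompact K → BddAbove (m '' K)
  moderate : ∃ A a s : ℝ, 0 < A ∧ 0 ≤ a ∧ 0 ≤ s ∧ ∀ x₁ ξ₁ x₂ ξ₂ : RSpace n,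
    m (x₁ + x₂, ξ₁ + ξ₂) / m (x₁, ξ₁) ≤ A * Real.exp (a * ‖x₂‖) * (1 + ‖ξ₂‖) ^ s

/-- The norm of `L^{p,q}_m(ℝ²ⁿ)`: the `L^q` norm in `ξ` of the `L^p` norm in `x` of
`F(x, ξ) m(x, ξ)`, with value `∞` allowed. -/
def mixedNorm {n : ℕ} (p q : ℝ≥0∞) (m : RSpace n × RSpace n → ℝ)
    (F : RSpace n → RSpace n → ℂ) : ℝ≥0∞ :=
  eLpNorm (fun ξ => eLpNorm (fun x => F x ξ * (m (x, ξ) : ℂ)) p volume) q volume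

/-- The norm `‖f‖_{M^{p,q}_m} = ‖V_φ f‖_{L^{p,q}_m}` of `f ∈ (Σ₁¹)'(ℝⁿ)` with respect to the
window `φ ∈ Σ₁¹(ℝⁿ)`. -/
def modulationNorm {n : ℕ} (φ : GelfandShilov n) (p q : ℝ≥0∞) (m : RSpace n × RSpace n → ℝ)
    (f : GelfandShilovDual n) : ℝ≥0∞ :=
  mixedNorm p q m (stftGS φ f)

/-- The modulation space `M^{p,q}_m(ℝⁿ)`, described through the window `φ ∈ Σ₁¹(ℝⁿ)`. -/
def modulationSpace {n : ℕ} (φ : GelfandShilov n) (p q : ℝ≥0∞) (m : RSpace n × RSpace n → ℝ) :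
    Set (GelfandShilovDual n) :=
  {f | modulationNorm φ p q m f < ⊤}

/-- The same norm for `F ∈ 𝒦₁'(ℝⁿ)` with respect to a window `γ ∈ 𝒦₁(ℝⁿ)`. -/
def modulationNormK1 {n : ℕ} (γ : K1 n) (p q : ℝ≥0∞) (m : RSpace n × RSpace n → ℝ)
    (F : K1Dual n) : ℝ≥0∞ :=
  mixedNorm p q m (fun x ξ => stft γ F x (fun j => (ξ j : ℂ)))

/-- `F ∈ 𝒦₁'(ℝⁿ)` and `f ∈ (Σ₁¹)'(ℝⁿ)` agree on `Σ₁¹(ℝⁿ) ⊆ 𝒦₁(ℝⁿ)`. -/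
def Extends {n : ℕ} (F : K1Dual n) (f : GelfandShilovDual n) : Prop :=
  ∀ (χ : K1 n) (φ : GelfandShilov n), (∀ t, χ t = φ t) → F χ = f φ

end

/-! ### Weights, rapid decay and bounds for Gabor coefficients. -/

noncomputable section

/-! Everything rests on the reproducing formula. With `G_χ(y, w) = ∫ χ(s) e^{2πi s·w} φ(s - y) ds`
(`gaborCoeff`), a test function is recovered as `χ(t) = ‖φ‖₂⁻² ∫∫ G_χ(y, w) e^{-2πi w·t} conj (φ(t -
y)) dy dw`. A functional `F` passes under this integral, giving `F χ = ‖φ‖₂⁻² ∫∫ G_χ · V_φ F`, as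
soon as it is bounded by weighted suprema of `χ` and `𝓕 χ` (`weak_reproducing`). Elements of both
duals are of this kind: with exponential weights on both sides for `Σ₁¹`, with an exponential weight
in time and a polynomial one in frequency for `𝒦₁`. The abstract weights `ρ`, `σ` treat the two
cases at once. For `𝒦₁` the derivative seminorms must be recovered from the decay of `χ` and `𝓕 χ`,
which is an interpolation argument (`exists_exp_mul_norm_iteratedFDeriv_le`).

For `χ ∈ 𝒦₁` the coefficient `G_χ(y, w)` decays faster than every `e^{-k|y|} (1 + |w|)^{-k}`, which
is what a weight in `𝔐₁` can cost. So the right-hand side of the formula with `V_φ f` in place of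
`V_φ F` converges for `f ∈ M^{p,q}_m` and defines the extension (`exists_extends`). It is unique,
since two extensions have the same `V_φ` (`eq_of_extends`).

For the estimate the formula is applied to the test function defining `V_ψ F(x, ξ + iη)`. By
covariance (`norm_gaborCoeff_timeFreqFun`) its coefficient is, in absolute value, `e^{2π x·η}` times
a translate by `(x, ξ)` of a coefficient that is controlled uniformly for `|η| ≤ λ`. The factor
`e^{-2π x·η}` cancels the exponential, and `|V_ψ F| m` is dominated by the convolution of `|V_g F|
m` with an integrable product kernel. Young's inequality for mixed norms concludes
(`exists_mixedNorm_stft_le`). Any window `g` of `𝒦₁` is allowed, so both right-hand sides of the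
theorem are covered. Holomorphy follows because `e^{-2πi h·t} - 1 + 2πi h·t` acts on `𝒦₁` with size
`O(|h|²)`. -/

/-- Even, continuous, submultiplicative weights on `ℝⁿ` that dominate `1 + |t|`. -/
structure IsBaseWeight {n : ℕ} (ρ : RSpace n → ℝ) : Prop where
  continuous : Continuous ρ
  one_add_norm_le : ∀ t, 1 + ‖t‖ ≤ ρ t
  neg : ∀ t, ρ (-t) = ρ t
  add : ∀ s t, ρ (s + t) ≤ ρ s * ρ t

theorem isBaseWeight_exp (n : ℕ) : IsBaseWeight (fun t : RSpace n => Real.exp ‖t‖) where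
  continuous := by fun_prop
  one_add_norm_le t := by linarith [Real.add_one_le_exp ‖t‖]
  neg t := by simp
  add s t := by
    rw [← Real.exp_add]
    exact Real.exp_le_exp.2 (norm_add_le s t)

theorem isBaseWeight_one_add (n : ℕ) : IsBaseWeight (fun t : RSpace n => 1 + ‖t‖) where
  continuous := by fun_prop
  one_add_norm_le t := le_rfl
  neg t := by simp
  add s t := by nlinarith [norm_add_le s t, norm_nonneg s, norm_nonneg t]

namespace IsBaseWeight

variable {n : ℕ} {ρ : RSpace n → ℝ}

theorem one_le (h : IsBaseWeight ρ) (t : RSpace n) : 1 ≤ ρ t := by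
  linarith [h.one_add_norm_le t, norm_nonneg t]

theorem pos (h : IsBaseWeight ρ) (t : RSpace n) : 0 < ρ t := zero_lt_one.trans_le (h.one_le t)

theorem pow_add_le (h : IsBaseWeight ρ) (k : ℕ) (s t : RSpace n) :
    ρ (s + t) ^ k ≤ ρ s ^ k * ρ t ^ k := by
  rw [← mul_pow]
  exact pow_le_pow_left₀ (h.pos _).le (h.add s t) k

theorem pow_le_mul_sub (h : IsBaseWeight ρ) (k : ℕ) (x t : RSpace n) :
    ρ t ^ k ≤ ρ x ^ k * ρ (t - x) ^ k := by
  simpa using h.pow_add_le k x (t - x)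

theorem integrable_inv_pow (h : IsBaseWeight ρ) :
    Integrable (fun t : RSpace n => (ρ t ^ (n + 1))⁻¹) := by
  have h1 : Integrable (fun t : RSpace n => (1 + ‖t‖) ^ (-((n + 1 : ℕ) : ℝ))) :=
    integrable_one_add_norm (by simp)
  refine h1.mono' ?_ (Filter.Eventually.of_forall fun t => ?_)
  · exact (Continuous.inv₀ (h.continuous.pow _)
      fun t => (pow_pos (h.pos t) _).ne').aestronglyMeasurable
  have hp : (0 : ℝ) < 1 + ‖t‖ := by positivity
  rw [Real.norm_of_nonneg (inv_nonneg.2 (pow_pos (h.pos t) _).le), Real.rpow_neg hp.le,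
    Real.rpow_natCast]
  gcongr
  exact h.one_add_norm_le t

end IsBaseWeight

/-- Continuous functions that decay faster than every power of the weight `ρ`. -/
structure Rapid {n : ℕ} (ρ : RSpace n → ℝ) (f : RSpace n → ℂ) : Prop where
  continuous : Continuous f
  decay : ∀ k : ℕ, ∃ C : ℝ, ∀ t, ρ t ^ k * ‖f t‖ ≤ C

/-- Functions that decay rapidly with respect to `ρ` and whose Fourier transform decays rapidly
with respect to `σ`. -/
structure BiRapid {n : ℕ} (ρ σ : RSpace n → ℝ) (f : RSpace n → ℂ) : Prop where
  fst : Rapid ρ f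
  snd : Rapid σ (𝓕 f)

variable {n : ℕ} {ρ σ : RSpace n → ℝ}

theorem Rapid.integrable_pow_mul {f : RSpace n → ℂ} (hf : Rapid ρ f) (h : IsBaseWeight ρ)
    (k : ℕ) : Integrable (fun t => ρ t ^ k * ‖f t‖) := by
  obtain ⟨C, hC⟩ := hf.decay (n + 1 + k)
  refine (h.integrable_inv_pow.const_mul C).mono' ?_ (Filter.Eventually.of_forall fun t => ?_)
  · exact ((h.continuous.pow k).mul hf.continuous.norm).aestronglyMeasurable
  have hp := pow_pos (h.pos t) (n + 1)
  rw [Real.norm_of_nonneg (mul_nonneg (pow_pos (h.pos t) _).le (norm_nonneg _)),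
    ← div_eq_mul_inv, le_div_iff₀ hp]
  calc _ = ρ t ^ (n + 1 + k) * ‖f t‖ := by ring
    _ ≤ C := hC t

theorem Rapid.integrable {f : RSpace n → ℂ} (hf : Rapid ρ f) (h : IsBaseWeight ρ) :
    Integrable f := by
  have := hf.integrable_pow_mul h 0
  simp only [pow_zero, one_mul] at this
  exact (integrable_norm_iff hf.continuous.aestronglyMeasurable).1 this

theorem continuous_fourier {f : RSpace n → ℂ} (hf : Integrable f) : Continuous (𝓕 f) :=
  VectorFourier.fourierIntegral_continuous Real.continuous_fourierChar continuous_inner hf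

theorem cdot_ofReal (ξ t : RSpace n) :
    cdot (fun j => (ξ j : ℂ)) t = ((inner ℝ t ξ : ℝ) : ℂ) := by
  simp [cdot, PiLp.inner_apply]

theorem timeFreqFun_ofReal (φ : RSpace n → ℂ) (y w t : RSpace n) :
    timeFreqFun φ y (fun j => (w j : ℂ)) t =
      Complex.exp (((-2 * Real.pi * inner ℝ t w : ℝ) : ℂ) * Complex.I) * conj (φ (t - y)) := by
  rw [timeFreqFun, cdot_ofReal]
  congr 2
  push_cast
  ring

theorem norm_timeFreqFun_ofReal (φ : RSpace n → ℂ) (y w t : RSpace n) :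
    ‖timeFreqFun φ y (fun j => (w j : ℂ)) t‖ = ‖φ (t - y)‖ := by
  rw [timeFreqFun, norm_mul, norm_exp_real_cdot, one_mul, RCLike.norm_conj]

theorem continuous_timeFreqFun_uncurry {φ : RSpace n → ℂ} (hφ : Continuous φ) :
    Continuous fun p : (RSpace n × RSpace n) × RSpace n =>
      timeFreqFun φ p.1.1 (fun j => (p.1.2 j : ℂ)) p.2 := by
  simp only [timeFreqFun_ofReal]
  exact Continuous.mul (by fun_prop)
    (Complex.continuous_conj.comp (hφ.comp (by fun_prop)))

theorem continuous_timeFreqFun_right {φ : RSpace n → ℂ} (hφ : Continuous φ) (y w : RSpace n) :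
    Continuous (timeFreqFun φ y (fun j => (w j : ℂ))) := by
  have h : timeFreqFun φ y (fun j => (w j : ℂ)) = fun t => _ :=
    funext fun t => timeFreqFun_ofReal φ y w t
  rw [h]
  exact Continuous.mul (by fun_prop)
    (Complex.continuous_conj.comp (hφ.comp (by fun_prop)))

theorem continuous_timeFreqFun_left {φ : RSpace n → ℂ} (hφ : Continuous φ) (t : RSpace n) :
    Continuous fun p : RSpace n × RSpace n =>
      timeFreqFun φ p.1 (fun j => (p.2 j : ℂ)) t := by
  simp only [timeFreqFun_ofReal]
  exact Continuous.mul (by fun_prop)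
    (Complex.continuous_conj.comp (hφ.comp (by fun_prop)))

theorem BiRapid.timeFreqFun {φ : RSpace n → ℂ} (hφ : BiRapid ρ σ φ) (hρ : IsBaseWeight ρ)
    (hσ : IsBaseWeight σ) (y w : RSpace n) :
    BiRapid ρ σ (timeFreqFun φ y (fun j => (w j : ℂ))) := by
  have h1 : Rapid ρ (_root_.timeFreqFun φ y (fun j => (w j : ℂ))) := by
    refine ⟨?_, fun k => ?_⟩
    · exact continuous_timeFreqFun_right hφ.fst.continuous y w
    · obtain ⟨C, hC⟩ := hφ.fst.decay k
      refine ⟨ρ y ^ k * C, fun t => ?_⟩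
      rw [norm_timeFreqFun_ofReal]
      have hp := pow_pos (hρ.pos y) k
      calc _ ≤ ρ y ^ k * ρ (t - y) ^ k * ‖φ (t - y)‖ := by
            gcongr
            exact hρ.pow_le_mul_sub k y t
        _ = ρ y ^ k * (ρ (t - y) ^ k * ‖φ (t - y)‖) := by ring
        _ ≤ _ := by gcongr; exact hC _
  refine ⟨h1, continuous_fourier (h1.integrable hρ), fun k => ?_⟩
  obtain ⟨C, hC⟩ := hφ.snd.decay k
  refine ⟨σ w ^ k * C, fun τ => ?_⟩
  rw [norm_fourier_timeFreqFun]
  have hp := pow_pos (hσ.pos w) k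
  have h2 : σ τ ^ k ≤ σ w ^ k * σ (-(τ + w)) ^ k := by
    have := hσ.pow_add_le k (-w) (τ + w)
    rw [hσ.neg] at this ⊢
    simpa using this
  calc _ ≤ σ w ^ k * σ (-(τ + w)) ^ k * ‖𝓕 φ (-(τ + w))‖ := by gcongr
    _ = σ w ^ k * (σ (-(τ + w)) ^ k * ‖𝓕 φ (-(τ + w))‖) := by ring
    _ ≤ _ := by gcongr; exact hC _

/-- The coefficient `⟨χ, M_w T_y φ⟩` formed with the sesquilinear pairing. -/
def gaborCoeff (φ χ : RSpace n → ℂ) (p : RSpace n × RSpace n) : ℂ :=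
  ∫ s, χ s * conj (timeFreqFun φ p.1 (fun j => (p.2 j : ℂ)) s)

/-- Parseval in an asymmetric form: inversion is needed only for `g`, which is the window. It writes
`conj g` as the transform of `conj (𝓕 g)`, and the transform is then moved onto `f`. -/
theorem integral_mul_conj_fourier {f g : RSpace n → ℂ} (hf : Integrable f) (hg : Integrable g)
    (hgc : Continuous g) (hg' : Integrable (𝓕 g)) :
    ∫ s, f s * conj (g s) = ∫ τ, 𝓕 f τ * conj (𝓕 g τ) := by
  have h1 : 𝓕⁻ (𝓕 g) = g := hgc.fourierInv_fourier_eq hg hg'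
  have h2 : ∀ s, conj (g s) = 𝓕 (fun τ => conj (𝓕 g τ)) s := by
    intro s
    conv_lhs => rw [← h1]
    rw [Real.fourierInv_eq', Real.fourier_eq', ← integral_conj]
    congr 1
    ext v
    simp only [smul_eq_mul, map_mul, ← Complex.exp_conj, Complex.conj_ofReal, Complex.conj_I]
    rw [real_inner_comm]
    congr 2
    push_cast
    ring
  have h3 := VectorFourier.integral_fourierIntegral_smul_eq_flip (L := innerₗ (RSpace n))
    (μ := volume) (ν := volume) Real.continuous_fourierChar continuous_inner hf
    (g := fun τ => conj (𝓕 g τ)) (Complex.conjCLE.integrable_comp_iff.2 hg')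
  rw [flip_innerₗ] at h3
  simp only [smul_eq_mul] at h3
  simp only [h2]
  exact h3.symm

section bounds

variable {φ χ : RSpace n → ℂ} {k : ℕ} {A B : ℝ}

/-- Submultiplicativity splits the weight at `y` into one factor at `s`, absorbed by `χ`, and one at
`s - y`, absorbed by the window. -/
theorem pow_mul_norm_gaborCoeff_le_time (hρ : IsBaseWeight ρ) (hφ : Rapid ρ φ)
    (hA : ∀ t, ρ t ^ k * ‖χ t‖ ≤ A) (p : RSpace n × RSpace n) :
    ρ p.1 ^ k * ‖gaborCoeff φ χ p‖ ≤ A * ∫ s, ρ s ^ k * ‖φ s‖ := by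
  have hi := (hφ.integrable_pow_mul hρ k).const_mul A
  rw [← integral_const_mul, ← integral_sub_right_eq_self _ p.1]
  have hp := pow_pos (hρ.pos p.1) k
  rw [← abs_of_pos hp, ← Real.norm_eq_abs, ← Complex.norm_real, ← norm_mul, gaborCoeff,
    ← integral_const_mul]
  refine norm_integral_le_of_norm_le (hi.comp_sub_right p.1)
    (Filter.Eventually.of_forall fun s => ?_)
  rw [norm_mul, norm_mul, RCLike.norm_conj, norm_timeFreqFun_ofReal, Complex.norm_real,
    Real.norm_of_nonneg hp.le]
  have h1 : ρ p.1 ^ k ≤ ρ s ^ k * ρ (s - p.1) ^ k := by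
    have := hρ.pow_add_le k s (-(s - p.1))
    rw [hρ.neg] at this
    simpa using this
  have h2 := pow_pos (hρ.pos (s - p.1)) k
  calc _ ≤ (ρ s ^ k * ρ (s - p.1) ^ k) * (‖χ s‖ * ‖φ (s - p.1)‖) := by gcongr
    _ = (ρ s ^ k * ‖χ s‖) * (ρ (s - p.1) ^ k * ‖φ (s - p.1)‖) := by ring
    _ ≤ _ := by gcongr; exact hA s

/-- The same splitting on the Fourier side, after Parseval. -/
theorem pow_mul_norm_gaborCoeff_le_freq (hρ : IsBaseWeight ρ) (hσ : IsBaseWeight σ)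
    (hφ : BiRapid ρ σ φ) (hχ : Integrable χ)
    (hB : ∀ ξ, σ ξ ^ k * ‖𝓕 χ ξ‖ ≤ B) (p : RSpace n × RSpace n) :
    σ p.2 ^ k * ‖gaborCoeff φ χ p‖ ≤ B * ∫ s, σ s ^ k * ‖𝓕 φ s‖ := by
  have hi := (hφ.snd.integrable_pow_mul hσ k).const_mul B
  have hv := hφ.timeFreqFun hρ hσ p.1 p.2
  have hp := pow_pos (hσ.pos p.2) k
  -- Substituting `-(s + p.2)` on the right matches the reflected argument at which `𝓕 φ` occurs in
  -- the transform of the shifted window.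
  rw [← integral_const_mul, ← integral_neg_eq_self, ← integral_add_right_eq_self _ p.2]
  rw [← abs_of_pos hp, ← Real.norm_eq_abs, ← Complex.norm_real, ← norm_mul, gaborCoeff,
    integral_mul_conj_fourier hχ (hv.fst.integrable hρ) hv.fst.continuous (hv.snd.integrable hσ),
    ← integral_const_mul]
  refine norm_integral_le_of_norm_le (hi.comp_neg.comp_add_right p.2)
    (Filter.Eventually.of_forall fun s => ?_)
  rw [norm_mul, norm_mul, RCLike.norm_conj, norm_fourier_timeFreqFun, Complex.norm_real,
    Real.norm_of_nonneg hp.le]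
  have h1 : σ p.2 ^ k ≤ σ s ^ k * σ (-(s + p.2)) ^ k := by
    have := hσ.pow_add_le k (-s) (s + p.2)
    rw [hσ.neg] at this ⊢
    simpa using this
  have h2 := pow_pos (hσ.pos (-(s + p.2))) k
  calc _ ≤ (σ s ^ k * σ (-(s + p.2)) ^ k) * (‖𝓕 χ s‖ * ‖𝓕 φ (-(s + p.2))‖) := by gcongr
    _ = (σ s ^ k * ‖𝓕 χ s‖) * (σ (-(s + p.2)) ^ k * ‖𝓕 φ (-(s + p.2))‖) := by ring
    _ ≤ _ := by gcongr; exact hB s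

/-- Separate decay in time and in frequency gives joint decay through `ab ≤ a² + b²`, at the price
of doubling the exponent. -/
theorem pow_mul_norm_gaborCoeff_le (hρ : IsBaseWeight ρ) (hσ : IsBaseWeight σ)
    (hφ : BiRapid ρ σ φ) (hχ : Integrable χ) (hA : ∀ t, ρ t ^ (2 * k) * ‖χ t‖ ≤ A)
    (hB : ∀ ξ, σ ξ ^ (2 * k) * ‖𝓕 χ ξ‖ ≤ B) (p : RSpace n × RSpace n) :
    ρ p.1 ^ k * σ p.2 ^ k * ‖gaborCoeff φ χ p‖ ≤
      A * (∫ s, ρ s ^ (2 * k) * ‖φ s‖) + B * ∫ s, σ s ^ (2 * k) * ‖𝓕 φ s‖ := by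
  have h1 := pow_mul_norm_gaborCoeff_le_time hρ hφ.fst hA p
  have h2 := pow_mul_norm_gaborCoeff_le_freq hρ hσ hφ hχ hB p
  set g := ‖gaborCoeff φ χ p‖
  have hg : 0 ≤ g := norm_nonneg _
  have h3 : ρ p.1 ^ k * σ p.2 ^ k ≤ ρ p.1 ^ (2 * k) + σ p.2 ^ (2 * k) := by
    rw [mul_comm 2 k, pow_mul, pow_mul]
    nlinarith [sq_nonneg (ρ p.1 ^ k - σ p.2 ^ k), sq_nonneg (ρ p.1 ^ k), sq_nonneg (σ p.2 ^ k)]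
  calc _ ≤ (ρ p.1 ^ (2 * k) + σ p.2 ^ (2 * k)) * g := by gcongr
    _ = ρ p.1 ^ (2 * k) * g + σ p.2 ^ (2 * k) * g := by ring
    _ ≤ _ := add_le_add h1 h2

end bounds

theorem continuous_gaborCoeff {φ χ : RSpace n → ℂ} (hφ : Rapid ρ φ)
    (hχc : Continuous χ) (hχ : Integrable χ) : Continuous (gaborCoeff φ χ) := by
  obtain ⟨C, hC⟩ := hφ.decay 0
  simp only [pow_zero, one_mul] at hC
  refine continuous_of_dominated (bound := fun s => ‖χ s‖ * C) (fun p => ?_) (fun p => ?_) ?_ ?_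
  · exact (hχc.mul (Complex.continuous_conj.comp
      (continuous_timeFreqFun_right hφ.continuous p.1 p.2))).aestronglyMeasurable
  · refine Filter.Eventually.of_forall fun s => ?_
    rw [norm_mul, RCLike.norm_conj, norm_timeFreqFun_ofReal]
    gcongr
    exact hC _
  · exact hχ.norm.mul_const C
  · refine Filter.Eventually.of_forall fun s => continuous_const.mul ?_
    exact Complex.continuous_conj.comp (continuous_timeFreqFun_left hφ.continuous s)

/-- The joint bound is used with `n + 1` extra powers of each weight, whose inverses are integrable
on `ℝⁿ`. -/
theorem integrable_weight_mul_gaborCoeff {φ χ : RSpace n → ℂ} (hρ : IsBaseWeight ρ)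
    (hσ : IsBaseWeight σ) (hφ : BiRapid ρ σ φ) (hχ : BiRapid ρ σ χ) (k : ℕ) :
    Integrable (fun p : RSpace n × RSpace n =>
      ρ p.1 ^ k * σ p.2 ^ k * ‖gaborCoeff φ χ p‖) := by
  obtain ⟨A, hA⟩ := hχ.fst.decay (2 * (n + 1 + k))
  obtain ⟨B, hB⟩ := hχ.snd.decay (2 * (n + 1 + k))
  have hb := pow_mul_norm_gaborCoeff_le hρ hσ hφ (hχ.fst.integrable hρ) hA hB
  set D := A * (∫ s, ρ s ^ (2 * (n + 1 + k)) * ‖φ s‖) +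
    B * ∫ s, σ s ^ (2 * (n + 1 + k)) * ‖𝓕 φ s‖
  refine ((hρ.integrable_inv_pow.mul_prod hσ.integrable_inv_pow).const_mul D).mono' ?_
    (Filter.Eventually.of_forall fun p => ?_)
  · exact Continuous.aestronglyMeasurable (Continuous.mul (Continuous.mul
      ((hρ.continuous.comp continuous_fst).pow k) ((hσ.continuous.comp continuous_snd).pow k))
      (continuous_gaborCoeff hφ.fst hχ.fst.continuous (hχ.fst.integrable hρ)).norm)
  have h1 := pow_pos (hρ.pos p.1) (n + 1)
  have h2 := pow_pos (hσ.pos p.2) (n + 1)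
  have h3 := pow_pos (hρ.pos p.1) k
  have h4 := pow_pos (hσ.pos p.2) k
  rw [Real.norm_of_nonneg (by positivity), ← mul_inv, ← div_eq_mul_inv,
    le_div_iff₀ (by positivity)]
  calc _ = ρ p.1 ^ (n + 1 + k) * σ p.2 ^ (n + 1 + k) * ‖gaborCoeff φ χ p‖ := by ring
    _ ≤ D := hb p

end

noncomputable section

variable {n : ℕ} {ρ σ : RSpace n → ℝ}

/-! ### The reproducing formula -/

theorem fourier_timeFreqFun (φ : RSpace n → ℂ) (x ξ τ : RSpace n) :
    𝓕 (timeFreqFun φ x (fun j => (ξ j : ℂ))) τ =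
      Complex.exp (((-2 * Real.pi * inner ℝ x (τ + ξ) : ℝ) : ℂ) * Complex.I) *
        conj (𝓕 φ (-(τ + ξ))) := by
  rw [Real.fourier_eq', Real.fourier_eq', ← integral_conj, ← integral_const_mul,
    ← integral_add_right_eq_self _ x]
  congr 1
  ext t
  rw [timeFreqFun_ofReal]
  simp only [smul_eq_mul, map_mul, ← Complex.exp_conj, Complex.conj_ofReal,
    Complex.conj_I, add_sub_cancel_right, ← mul_assoc, ← Complex.exp_add]
  congr 2
  simp only [inner_add_left, inner_add_right, inner_neg_right]
  push_cast
  ring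

/-- The two conjugations cancel, so at a fixed position `y` the `w`-integral in the reproducing
formula becomes Fourier inversion. -/
theorem gaborCoeff_eq_fourierInv (φ χ : RSpace n → ℂ) (y w : RSpace n) :
    gaborCoeff φ χ (y, w) = 𝓕⁻ (fun s => χ s * φ (s - y)) w := by
  rw [gaborCoeff, Real.fourierInv_eq']
  congr 1
  ext s
  rw [timeFreqFun_ofReal]
  simp only [smul_eq_mul, map_mul, ← Complex.exp_conj, Complex.conj_ofReal, Complex.conj_I,
    Complex.conj_conj]
  rw [mul_left_comm]
  congr 2
  push_cast
  ring

section pointwise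

variable {φ χ : RSpace n → ℂ}

theorem integrable_gaborCoeff (hρ : IsBaseWeight ρ) (hσ : IsBaseWeight σ)
    (hφ : BiRapid ρ σ φ) (hχ : BiRapid ρ σ χ) : Integrable (gaborCoeff φ χ) := by
  have h := integrable_weight_mul_gaborCoeff hρ hσ hφ hχ 0
  simp only [pow_zero, one_mul] at h
  exact (integrable_norm_iff (continuous_gaborCoeff hφ.fst hχ.fst.continuous
    (hχ.fst.integrable hρ)).aestronglyMeasurable).1 h

theorem integrable_gaborCoeff_right (hρ : IsBaseWeight ρ) (hσ : IsBaseWeight σ)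
    (hφ : BiRapid ρ σ φ) (hχ : BiRapid ρ σ χ) (y : RSpace n) :
    Integrable fun w => gaborCoeff φ χ (y, w) := by
  obtain ⟨B, hB⟩ := hχ.snd.decay (n + 1)
  have hb := pow_mul_norm_gaborCoeff_le_freq hρ hσ hφ (hχ.fst.integrable hρ) hB
  set D := B * ∫ s, σ s ^ (n + 1) * ‖𝓕 φ s‖
  refine (hσ.integrable_inv_pow.const_mul D).mono' ?_ (Filter.Eventually.of_forall fun w => ?_)
  · exact ((continuous_gaborCoeff hφ.fst hχ.fst.continuous (hχ.fst.integrable hρ)).comp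
      (Continuous.prodMk_right y)).aestronglyMeasurable
  · rw [← div_eq_mul_inv, le_div_iff₀ (pow_pos (hσ.pos w) _), mul_comm]
    exact hb (y, w)

theorem integrable_gaborCoeff_mul_timeFreqFun (hρ : IsBaseWeight ρ) (hσ : IsBaseWeight σ)
    (hφ : BiRapid ρ σ φ) (hχ : BiRapid ρ σ χ) (t : RSpace n) :
    Integrable fun p => gaborCoeff φ χ p * timeFreqFun φ p.1 (fun j => (p.2 j : ℂ)) t := by
  obtain ⟨C, hC⟩ := hφ.fst.decay 0
  refine (integrable_gaborCoeff hρ hσ hφ hχ).mul_bdd (c := C) ?_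
    (Filter.Eventually.of_forall fun p => ?_)
  · exact (continuous_timeFreqFun_left hφ.fst.continuous t).aestronglyMeasurable
  · rw [norm_timeFreqFun_ofReal]
    simpa using hC (t - p.1)

/-- Fourier inversion in `w` at fixed `y` yields `χ(t) |φ(t - y)|²`; integrating over `y` leaves the
squared `L²` norm of the window. -/
theorem integral_gaborCoeff_mul_timeFreqFun (hρ : IsBaseWeight ρ) (hσ : IsBaseWeight σ)
    (hφ : BiRapid ρ σ φ) (hχ : BiRapid ρ σ χ) (t : RSpace n) :
    ∫ p, gaborCoeff φ χ p * timeFreqFun φ p.1 (fun j => (p.2 j : ℂ)) t =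
      (∫ s, φ s * conj (φ s)) * χ t := by
  rw [Measure.volume_eq_prod, integral_prod _
    (integrable_gaborCoeff_mul_timeFreqFun hρ hσ hφ hχ t)]
  have h1 : ∀ y, ∫ w, gaborCoeff φ χ (y, w) * timeFreqFun φ y (fun j => (w j : ℂ)) t =
      χ t * (φ (t - y) * conj (φ (t - y))) := by
    intro y
    obtain ⟨C, hC⟩ := hφ.fst.decay 0
    have hc : Continuous fun s => φ (s - y) := hφ.fst.continuous.comp (by fun_prop)
    have hi : Integrable fun s => χ s * φ (s - y) :=
      (hχ.fst.integrable hρ).mul_bdd (c := C) hc.aestronglyMeasurable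
        (Filter.Eventually.of_forall fun s => by simpa using hC (s - y))
    have hF : Integrable (𝓕 fun s => χ s * φ (s - y)) := by
      have := (integrable_gaborCoeff_right hρ hσ hφ hχ y).comp_neg
      simpa only [gaborCoeff_eq_fourierInv, Real.fourierInv_eq_fourier_neg, neg_neg] using this
    have h2 : 𝓕 (𝓕⁻ fun s => χ s * φ (s - y)) t = χ t * φ (t - y) :=
      congrFun ((hχ.fst.continuous.mul hc).fourier_fourierInv_eq hi hF) t
    rw [← mul_assoc, ← h2, Real.fourier_eq', ← integral_mul_const]
    congr 1
    ext w
    rw [gaborCoeff_eq_fourierInv, timeFreqFun_ofReal, real_inner_comm, smul_eq_mul]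
    ring
  simp only [h1]
  rw [integral_const_mul, integral_sub_left_eq_self (fun y => φ y * conj (φ y)), mul_comm]

/-- The Fourier transform of the pointwise formula. Fubini applies because the coefficients are
integrable and all shifted windows have the same `L¹` norm. -/
theorem integral_gaborCoeff_mul_fourier_timeFreqFun (hρ : IsBaseWeight ρ) (hσ : IsBaseWeight σ)
    (hφ : BiRapid ρ σ φ) (hχ : BiRapid ρ σ χ) (τ : RSpace n) :
    ∫ p, gaborCoeff φ χ p * 𝓕 (timeFreqFun φ p.1 (fun j => (p.2 j : ℂ))) τ =
      (∫ s, φ s * conj (φ s)) * 𝓕 χ τ := by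
  have hφi := hφ.fst.integrable hρ
  let e : RSpace n → ℂ := fun t =>
    Complex.exp (((-2 * Real.pi * inner ℝ t τ : ℝ) : ℂ) * Complex.I)
  have hec : Continuous e := by fun_prop
  have he : ∀ t, ‖e t‖ = 1 := fun t => Complex.norm_exp_ofReal_mul_I _
  have hI : Integrable (Function.uncurry fun (p : RSpace n × RSpace n) (t : RSpace n) =>
      gaborCoeff φ χ p * (e t * timeFreqFun φ p.1 (fun j => (p.2 j : ℂ)) t))
      (volume.prod volume) := by
    have hGc := continuous_gaborCoeff hφ.fst hχ.fst.continuous (hχ.fst.integrable hρ)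
    rw [integrable_prod_iff]
    · simp only [Function.uncurry_apply_pair, norm_mul, he, one_mul, norm_timeFreqFun_ofReal]
      refine ⟨Filter.Eventually.of_forall fun p => ?_, ?_⟩
      · refine Integrable.const_mul ?_ _
        refine (hφi.comp_sub_right p.1).norm.mono'
          (hec.mul (continuous_timeFreqFun_right hφ.fst.continuous _ _)).aestronglyMeasurable
          (Filter.Eventually.of_forall fun t => ?_)
        rw [norm_mul, he, one_mul, norm_timeFreqFun_ofReal]
      · simp only [integral_const_mul, integral_sub_right_eq_self fun t => ‖φ t‖]
        exact (integrable_gaborCoeff hρ hσ hφ hχ).norm.mul_const _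
    · exact Continuous.aestronglyMeasurable ((hGc.comp continuous_fst).mul
        ((hec.comp continuous_snd).mul (continuous_timeFreqFun_uncurry hφ.fst.continuous)))
  have h1 := integral_integral_swap hI
  simp only [Real.fourier_eq' _ τ, smul_eq_mul, ← integral_const_mul]
  refine h1.trans ?_
  congr 1
  ext t
  calc _ = e t * ∫ p, gaborCoeff φ χ p * timeFreqFun φ p.1 (fun j => (p.2 j : ℂ)) t := by
        rw [← integral_const_mul]
        congr 1
        ext p
        ring
    _ = _ := by
        rw [integral_gaborCoeff_mul_timeFreqFun hρ hσ hφ hχ]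
        ring

end pointwise

/-! ### Functionals and the vector-valued reproducing integral. -/

open scoped BoundedContinuousFunction Topology

/-- By Hahn–Banach, a functional controlled by a norm pulled back along `J` factors through the
normed space, where continuous functionals commute with Bochner integrals. -/
theorem exists_continuousLinearMap_of_norm_le {V E : Type*} [AddCommGroup V] [Module ℂ V]
    [NormedAddCommGroup E] [NormedSpace ℂ E] (J : V →ₗ[ℂ] E) (F : V →ₗ[ℂ] ℂ) (C : ℝ)
    (h : ∀ v, ‖F v‖ ≤ C * ‖J v‖) : ∃ L : E →L[ℂ] ℂ, ∀ v, L (J v) = F v := by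
  obtain ⟨g, hg⟩ := J.rangeRestrict.exists_rightInverse_of_surjective J.range_rangeRestrict
  have hg' : ∀ u : J.range, J (g u) = u := fun u =>
    congrArg Subtype.val (LinearMap.congr_fun hg u)
  let F' : StrongDual ℂ J.range := (F ∘ₗ g).mkContinuous C fun u => by
    have := h (g u)
    rwa [hg'] at this
  obtain ⟨L, hL, -⟩ := exists_extension_norm_eq J.range F'
  refine ⟨L, fun v => ?_⟩
  have h1 := hL ⟨J v, v, rfl⟩
  simp only at h1
  rw [h1]
  -- The chosen preimage of `J v` differs from `v` by an element of `ker J`, on which the bound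
  -- forces `F` to vanish.
  have h2 := h (g ⟨J v, v, rfl⟩ - v)
  rw [map_sub J, hg', sub_self, norm_zero, mul_zero, norm_le_zero_iff, map_sub, sub_eq_zero] at h2
  exact h2

/-- A jointly continuous family of functions that decay locally uniformly is continuous for the
supremum norm. -/
theorem continuous_boundedContinuousFunction_of_decay {Y : Type*} [TopologicalSpace Y]
    (Φ : Y → RSpace n →ᵇ ℂ) (hc : Continuous fun q : Y × RSpace n => Φ q.1 q.2)
    (hd : ∀ y₀, ∃ C : ℝ, ∀ᶠ y in 𝓝 y₀, ∀ t, (1 + ‖t‖) * ‖Φ y t‖ ≤ C) : Continuous Φ := by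
  rw [continuous_iff_continuousAt]
  intro y₀
  rw [ContinuousAt, Metric.tendsto_nhds]
  intro ε hε
  obtain ⟨C, hC⟩ := hd y₀
  -- Outside the ball of radius `R` both functions are at most `ε / 4` in absolute value; inside it,
  -- joint continuity and compactness give uniform closeness.
  obtain ⟨R, hR⟩ := exists_gt (4 * C / ε)
  have hK : IsCompact (Metric.closedBall (0 : RSpace n) R) := isCompact_closedBall _ _
  have h1 : ∀ᶠ y in 𝓝 y₀, ∀ t ∈ Metric.closedBall (0 : RSpace n) R,
      dist (Φ y t) (Φ y₀ t) < ε / 2 := by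
    refine hK.eventually_forall_of_forall_eventually fun t _ => ?_
    have h2 : Continuous fun q : Y × RSpace n => dist (Φ q.1 q.2) (Φ y₀ q.2) :=
      hc.dist (hc.comp (by fun_prop : Continuous fun q : Y × RSpace n => (y₀, q.2)))
    have h3 := h2.tendsto (y₀, t)
    simp only [dist_self] at h3
    exact h3.eventually (gt_mem_nhds (half_pos hε))
  filter_upwards [h1, hC] with y hy hy'
  refine lt_of_le_of_lt ((BoundedContinuousFunction.dist_le (half_pos hε).le).2 fun t => ?_)
    (half_lt_self hε)
  by_cases ht : ‖t‖ ≤ R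
  · exact (hy t (by simpa using ht)).le
  · push Not at ht
    have h4 : ∀ z : Y, (∀ t, (1 + ‖t‖) * ‖Φ z t‖ ≤ C) → ‖Φ z t‖ ≤ ε / 4 := by
      intro z hz
      by_contra! h5
      have h6 := hz t
      rw [div_lt_iff₀ hε] at hR
      nlinarith [norm_nonneg t]
    rw [dist_eq_norm]
    linarith [norm_sub_le (Φ y t) (Φ y₀ t), h4 y hy', h4 y₀ hC.self_of_nhds]

/-- Multiplication by a power of a weight, as a map to the bounded continuous functions. -/
def weightedBCF (hρ : IsBaseWeight ρ) (k : ℕ) (f : RSpace n → ℂ) (hf : Rapid ρ f) :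
    RSpace n →ᵇ ℂ :=
  BoundedContinuousFunction.ofNormedAddCommGroup (fun t => ((ρ t ^ k : ℝ) : ℂ) * f t)
    ((Complex.continuous_ofReal.comp (hρ.continuous.pow k)).mul hf.continuous)
    (hf.decay k).choose fun t => by
      rw [norm_mul, Complex.norm_real, Real.norm_of_nonneg (pow_pos (hρ.pos t) k).le]
      exact (hf.decay k).choose_spec t

theorem weightedBCF_apply (hρ : IsBaseWeight ρ) (k : ℕ) (f : RSpace n → ℂ) (hf : Rapid ρ f)
    (t : RSpace n) : weightedBCF hρ k f hf t = ((ρ t ^ k : ℝ) : ℂ) * f t := rfl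

theorem norm_weightedBCF_apply (hρ : IsBaseWeight ρ) (k : ℕ) (f : RSpace n → ℂ)
    (hf : Rapid ρ f) (t : RSpace n) : ‖weightedBCF hρ k f hf t‖ = ρ t ^ k * ‖f t‖ := by
  rw [weightedBCF_apply, norm_mul, Complex.norm_real,
    Real.norm_of_nonneg (pow_pos (hρ.pos t) k).le]

section weak

variable {V : Type*} [AddCommGroup V] [Module ℂ V]

/-- The embedding `v ↦ (ρ^k f, σ^k 𝓕 f)`, `f = T v`, into a product of spaces of bounded
continuous functions. -/
def weightedEmbedding (hρ : IsBaseWeight ρ) (hσ : IsBaseWeight σ) (k : ℕ)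
    (T : V →ₗ[ℂ] (RSpace n → ℂ)) (hT : ∀ v, BiRapid ρ σ (T v)) :
    V →ₗ[ℂ] (RSpace n →ᵇ ℂ) × (RSpace n →ᵇ ℂ) where
  toFun v := (weightedBCF hρ k (T v) (hT v).fst, weightedBCF hσ k (𝓕 (T v)) (hT v).snd)
  map_add' u v := by
    have h : 𝓕 (T u + T v) = 𝓕 (T u) + 𝓕 (T v) :=
      VectorFourier.fourierIntegral_add Real.continuous_fourierChar
        continuous_inner ((hT u).fst.integrable hρ) ((hT v).fst.integrable hρ)
    ext t
    · simp [weightedBCF_apply, mul_add]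
    · simp only [weightedBCF_apply, map_add, h, Prod.snd_add,
        BoundedContinuousFunction.add_apply, Pi.add_apply, mul_add]
  map_smul' c v := by
    have h : 𝓕 (c • T v) = c • 𝓕 (T v) := VectorFourier.fourierIntegral_const_smul _ _ _ _ _
    ext t
    · simp [weightedBCF_apply, mul_left_comm]
    · simp only [weightedBCF_apply, map_smul, h, Prod.smul_snd,
        BoundedContinuousFunction.smul_apply, Pi.smul_apply, smul_eq_mul, mul_left_comm,
        RingHom.id_apply]

theorem norm_weightedEmbedding_le (hρ : IsBaseWeight ρ) (hσ : IsBaseWeight σ) (k : ℕ)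
    (T : V →ₗ[ℂ] (RSpace n → ℂ)) (hT : ∀ v, BiRapid ρ σ (T v)) {v : V} {A : ℝ}
    (h1 : ∀ t, ρ t ^ k * ‖T v t‖ ≤ A) (h2 : ∀ ξ, σ ξ ^ k * ‖𝓕 (T v) ξ‖ ≤ A) :
    ‖weightedEmbedding hρ hσ k T hT v‖ ≤ A := by
  have hA : 0 ≤ A := (mul_nonneg (pow_pos (hρ.pos 0) k).le (norm_nonneg _)).trans (h1 0)
  refine max_le ?_ ?_
  · refine (BoundedContinuousFunction.norm_le hA).2 fun t => ?_
    exact (norm_weightedBCF_apply hρ k _ (hT v).fst t).trans_le (h1 t)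
  · refine (BoundedContinuousFunction.norm_le hA).2 fun t => ?_
    exact (norm_weightedBCF_apply hσ k _ (hT v).snd t).trans_le (h2 t)

theorem le_norm_weightedEmbedding (hρ : IsBaseWeight ρ) (hσ : IsBaseWeight σ) (k : ℕ)
    (T : V →ₗ[ℂ] (RSpace n → ℂ)) (hT : ∀ v, BiRapid ρ σ (T v)) (v : V) :
    (∀ t, ρ t ^ k * ‖T v t‖ ≤ ‖weightedEmbedding hρ hσ k T hT v‖) ∧
      ∀ ξ, σ ξ ^ k * ‖𝓕 (T v) ξ‖ ≤ ‖weightedEmbedding hρ hσ k T hT v‖ := by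
  refine ⟨fun t => ?_, fun t => ?_⟩
  · rw [← norm_weightedBCF_apply hρ k _ (hT v).fst]
    exact (BoundedContinuousFunction.norm_coe_le_norm _ t).trans (le_max_left _ _)
  · rw [← norm_weightedBCF_apply hσ k _ (hT v).snd]
    exact (BoundedContinuousFunction.norm_coe_le_norm _ t).trans (le_max_right _ _)

variable {φ : RSpace n → ℂ}

/-- A translation costs a power of `ρ` and a modulation a power of `σ`. This is the growth which the
decay of the Gabor coefficients has to beat. -/
theorem exists_norm_weightedEmbedding_timeFreq_le (hρ : IsBaseWeight ρ) (hσ : IsBaseWeight σ)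
    (k : ℕ) (T : V →ₗ[ℂ] (RSpace n → ℂ)) (hT : ∀ v, BiRapid ρ σ (T v)) (hφ : BiRapid ρ σ φ)
    (v : RSpace n × RSpace n → V)
    (hv : ∀ p, T (v p) = timeFreqFun φ p.1 (fun j => (p.2 j : ℂ))) :
    ∃ D : ℝ, 0 ≤ D ∧ ∀ p,
      ‖weightedEmbedding hρ hσ k T hT (v p)‖ ≤ D * (ρ p.1 ^ k * σ p.2 ^ k) := by
  obtain ⟨C₁, hC₁⟩ := hφ.fst.decay k
  obtain ⟨C₂, hC₂⟩ := hφ.snd.decay k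
  have hD1 : 0 ≤ C₁ := (mul_nonneg (pow_pos (hρ.pos 0) k).le (norm_nonneg _)).trans (hC₁ 0)
  have hD2 : 0 ≤ C₂ := (mul_nonneg (pow_pos (hσ.pos 0) k).le (norm_nonneg _)).trans (hC₂ 0)
  refine ⟨C₁ + C₂, by positivity, fun p => ?_⟩
  have h1 : 1 ≤ ρ p.1 ^ k := one_le_pow₀ (hρ.one_le _)
  have h2 : 1 ≤ σ p.2 ^ k := one_le_pow₀ (hσ.one_le _)
  refine norm_weightedEmbedding_le hρ hσ k T hT (fun t => ?_) (fun τ => ?_)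
  · rw [hv, norm_timeFreqFun_ofReal]
    calc _ ≤ ρ p.1 ^ k * ρ (t - p.1) ^ k * ‖φ (t - p.1)‖ := by
          gcongr
          exact hρ.pow_le_mul_sub k p.1 t
      _ = ρ p.1 ^ k * (ρ (t - p.1) ^ k * ‖φ (t - p.1)‖) := by ring
      _ ≤ ρ p.1 ^ k * C₁ := by gcongr; exact hC₁ _
      _ ≤ ρ p.1 ^ k * C₁ * σ p.2 ^ k := le_mul_of_one_le_right (by positivity) h2
      _ ≤ _ := by
        have : 0 ≤ C₂ * (ρ p.1 ^ k * σ p.2 ^ k) := by positivity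
        linarith
  · rw [hv, norm_fourier_timeFreqFun]
    have h3 : σ τ ^ k ≤ σ p.2 ^ k * σ (-(τ + p.2)) ^ k := by
      have := hσ.pow_add_le k (-p.2) (τ + p.2)
      rw [hσ.neg] at this ⊢
      simpa using this
    calc _ ≤ σ p.2 ^ k * σ (-(τ + p.2)) ^ k * ‖𝓕 φ (-(τ + p.2))‖ := by gcongr
      _ = σ p.2 ^ k * (σ (-(τ + p.2)) ^ k * ‖𝓕 φ (-(τ + p.2))‖) := by ring
      _ ≤ σ p.2 ^ k * C₂ := by gcongr; exact hC₂ _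
      _ ≤ σ p.2 ^ k * C₂ * ρ p.1 ^ k := le_mul_of_one_le_right (by positivity) h1
      _ ≤ _ := by
        have : 0 ≤ C₁ * (ρ p.1 ^ k * σ p.2 ^ k) := by positivity
        linarith

theorem continuous_weightedEmbedding_timeFreq (hρ : IsBaseWeight ρ) (hσ : IsBaseWeight σ)
    (k : ℕ) (T : V →ₗ[ℂ] (RSpace n → ℂ)) (hT : ∀ v, BiRapid ρ σ (T v)) (hφ : BiRapid ρ σ φ)
    (v : RSpace n × RSpace n → V)
    (hv : ∀ p, T (v p) = timeFreqFun φ p.1 (fun j => (p.2 j : ℂ))) :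
    Continuous fun p => weightedEmbedding hρ hσ k T hT (v p) := by
  -- One power more than the norm uses: the spare factor dominates `1 + |t|` and supplies the decay
  -- required by `continuous_boundedContinuousFunction_of_decay`.
  obtain ⟨D, hD0, hD⟩ := exists_norm_weightedEmbedding_timeFreq_le hρ hσ (k + 1) T hT hφ v hv
  have hw : Continuous fun p : RSpace n × RSpace n => D * (ρ p.1 ^ (k + 1) * σ p.2 ^ (k + 1)) :=
    continuous_const.mul (((hρ.continuous.comp continuous_fst).pow _).mul
      ((hσ.continuous.comp continuous_snd).pow _))
  have hloc : ∀ p₀ : RSpace n × RSpace n, ∃ C : ℝ, ∀ᶠ p in 𝓝 p₀,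
      ‖weightedEmbedding hρ hσ (k + 1) T hT (v p)‖ ≤ C := fun p₀ =>
    ⟨_, ((hw.tendsto p₀).eventually (gt_mem_nhds (lt_add_one _))).mono
      fun p hp => (hD p).trans hp.le⟩
  refine Continuous.prodMk ?_ ?_
  · refine continuous_boundedContinuousFunction_of_decay _ ?_ fun p₀ => ?_
    · simp only [weightedBCF_apply, hv]
      exact (Complex.continuous_ofReal.comp ((hρ.continuous.comp continuous_snd).pow k)).mul
        (continuous_timeFreqFun_uncurry hφ.fst.continuous)
    · obtain ⟨C, hC⟩ := hloc p₀
      refine ⟨C, hC.mono fun p hp t => le_trans ?_ hp⟩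
      refine le_trans ?_ ((le_norm_weightedEmbedding hρ hσ (k + 1) T hT (v p)).1 t)
      rw [norm_weightedBCF_apply, ← mul_assoc, pow_succ']
      have := hρ.one_add_norm_le t
      have := pow_pos (hρ.pos t) k
      gcongr
  · refine continuous_boundedContinuousFunction_of_decay _ ?_ fun p₀ => ?_
    · simp only [weightedBCF_apply, hv, fourier_timeFreqFun]
      refine (Complex.continuous_ofReal.comp ((hσ.continuous.comp continuous_snd).pow k)).mul ?_
      exact Continuous.mul (by fun_prop)
        (Complex.continuous_conj.comp (hφ.snd.continuous.comp (by fun_prop)))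
    · obtain ⟨C, hC⟩ := hloc p₀
      refine ⟨C, hC.mono fun p hp t => le_trans ?_ hp⟩
      refine le_trans ?_ ((le_norm_weightedEmbedding hρ hσ (k + 1) T hT (v p)).2 t)
      rw [norm_weightedBCF_apply, ← mul_assoc, pow_succ']
      have := hσ.one_add_norm_le t
      have := pow_pos (hσ.pos t) k
      gcongr

/-- A linear functional that is bounded by weighted suprema of a function and of its Fourier
transform commutes with the integral in the reproducing formula. -/
theorem weak_reproducing (hρ : IsBaseWeight ρ) (hσ : IsBaseWeight σ)
    (k : ℕ) (T : V →ₗ[ℂ] (RSpace n → ℂ)) (hT : ∀ v, BiRapid ρ σ (T v)) (hφ : BiRapid ρ σ φ)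
    (v : RSpace n × RSpace n → V)
    (hv : ∀ p, T (v p) = timeFreqFun φ p.1 (fun j => (p.2 j : ℂ)))
    (F : V →ₗ[ℂ] ℂ) (C : ℝ) (hF : ∀ (u : V) (A : ℝ), (∀ t, ρ t ^ k * ‖T u t‖ ≤ A) →
      (∀ ξ, σ ξ ^ k * ‖𝓕 (T u) ξ‖ ≤ A) → ‖F u‖ ≤ C * A) :
    Continuous (fun p => F (v p)) ∧
    ∀ χ : V, Integrable (fun p => gaborCoeff φ (T χ) p * F (v p)) ∧
      ∫ p, gaborCoeff φ (T χ) p * F (v p) = (∫ s, φ s * conj (φ s)) * F χ := by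
  set J := weightedEmbedding hρ hσ k T hT
  obtain ⟨L, hL⟩ := exists_continuousLinearMap_of_norm_le J F C fun u =>
    hF u _ (le_norm_weightedEmbedding hρ hσ k T hT u).1
      (le_norm_weightedEmbedding hρ hσ k T hT u).2
  have hJc : Continuous fun p => J (v p) :=
    continuous_weightedEmbedding_timeFreq hρ hσ k T hT hφ v hv
  refine ⟨?_, fun χ => ?_⟩
  · simp only [← hL]
    exact L.continuous.comp hJc
  obtain ⟨D, hD0, hD⟩ := exists_norm_weightedEmbedding_timeFreq_le hρ hσ k T hT hφ v hv
  have hGc : Continuous (gaborCoeff φ (T χ)) :=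
    continuous_gaborCoeff hφ.fst (hT χ).fst.continuous ((hT χ).fst.integrable hρ)
  -- The space of bounded continuous functions is in general not separable, so strong measurability
  -- of the continuous integrand is drawn from second countability of the domain.
  have hsc : SecondCountableTopology (RSpace n × RSpace n) := inferInstance
  have := secondCountableTopologyEither_of_left (RSpace n × RSpace n)
    ((RSpace n →ᵇ ℂ) × (RSpace n →ᵇ ℂ))
  have hI : Integrable fun p => gaborCoeff φ (T χ) p • J (v p) := by
    refine ((integrable_weight_mul_gaborCoeff hρ hσ hφ (hT χ) k).const_mul D).mono'
      (hGc.smul hJc).aestronglyMeasurable (Filter.Eventually.of_forall fun p => ?_)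
    rw [norm_smul]
    calc _ ≤ ‖gaborCoeff φ (T χ) p‖ * (D * (ρ p.1 ^ k * σ p.2 ^ k)) := by
          gcongr
          exact hD p
      _ = _ := by ring
  -- Point evaluations in the two components separate points, so the vector-valued identity reduces
  -- to the scalar formulas for `χ` and `𝓕 χ`.
  have hint : ∫ p, gaborCoeff φ (T χ) p • J (v p) = (∫ s, φ s * conj (φ s)) • J χ := by
    refine Prod.ext ?_ ?_
    · ext t
      let M := BoundedContinuousFunction.evalCLM ℂ t ∘L
        ContinuousLinearMap.fst ℂ (RSpace n →ᵇ ℂ) (RSpace n →ᵇ ℂ)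
      have h1 := M.integral_comp_comm hI
      refine h1.symm.trans ?_
      have h2 : ∀ p, M (gaborCoeff φ (T χ) p • J (v p)) = ((ρ t ^ k : ℝ) : ℂ) *
          (gaborCoeff φ (T χ) p * timeFreqFun φ p.1 (fun j => (p.2 j : ℂ)) t) := by
        intro p
        rw [map_smul, ← hv p, smul_eq_mul, mul_left_comm]
        rfl
      simp only [h2]
      rw [integral_const_mul, integral_gaborCoeff_mul_timeFreqFun hρ hσ hφ (hT χ), mul_left_comm]
      rfl
    · ext t
      let M := BoundedContinuousFunction.evalCLM ℂ t ∘L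
        ContinuousLinearMap.snd ℂ (RSpace n →ᵇ ℂ) (RSpace n →ᵇ ℂ)
      have h1 := M.integral_comp_comm hI
      refine h1.symm.trans ?_
      have h2 : ∀ p, M (gaborCoeff φ (T χ) p • J (v p)) = ((σ t ^ k : ℝ) : ℂ) *
          (gaborCoeff φ (T χ) p * 𝓕 (timeFreqFun φ p.1 (fun j => (p.2 j : ℂ))) t) := by
        intro p
        rw [map_smul, ← hv p, smul_eq_mul, mul_left_comm]
        rfl
      simp only [h2]
      rw [integral_const_mul, integral_gaborCoeff_mul_fourier_timeFreqFun hρ hσ hφ (hT χ),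
        mul_left_comm]
      rfl
  have h3 : ∀ p, L (gaborCoeff φ (T χ) p • J (v p)) = gaborCoeff φ (T χ) p * F (v p) := by
    intro p
    rw [map_smul, hL, smul_eq_mul]
  have h4 := L.integral_comp_comm hI
  simp only [h3, hint, map_smul, hL, smul_eq_mul] at h4
  have h5 := L.integrable_comp hI
  simp only [h3] at h5
  exact ⟨h5, h4⟩

end weak

end

noncomputable section

variable {n : ℕ}

/-! ### The space `𝒦₁` -/

/-- The exponential weight. -/
abbrev expWeight (n : ℕ) : RSpace n → ℝ := fun t => Real.exp ‖t‖

/-- The polynomial weight. -/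
abbrev polyWeight (n : ℕ) : RSpace n → ℝ := fun t => 1 + ‖t‖

theorem expWeight_pow (k : ℕ) (t : RSpace n) : expWeight n t ^ k = Real.exp (k * ‖t‖) :=
  (Real.exp_nat_mul _ _).symm

namespace K1

theorem contDiff (χ : K1 n) : ContDiff ℝ ∞ (χ : RSpace n → ℂ) := χ.2.1

theorem le_seminorm (χ : K1 n) (k j : ℕ) (t : RSpace n) :
    Real.exp (k * ‖t‖) * ‖iteratedFDeriv ℝ j χ t‖ ≤ K1.seminormFamily n (k, j) χ := by
  obtain ⟨C, hC⟩ := χ.2.2 k j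
  exact le_ciSup (f := fun t => Real.exp (k * ‖t‖) * ‖iteratedFDeriv ℝ j χ t‖)
    ⟨C, by rintro _ ⟨t, rfl⟩; exact hC t⟩ t

theorem seminorm_le (χ : K1 n) (k j : ℕ) {A : ℝ}
    (h : ∀ t, Real.exp (k * ‖t‖) * ‖iteratedFDeriv ℝ j χ t‖ ≤ A) :
    K1.seminormFamily n (k, j) χ ≤ A :=
  ciSup_le h

theorem seminorm_mono (χ : K1 n) {k k' : ℕ} (h : k ≤ k') (j : ℕ) :
    K1.seminormFamily n (k, j) χ ≤ K1.seminormFamily n (k', j) χ := by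
  refine seminorm_le χ k j fun t => le_trans ?_ (le_seminorm χ k' j t)
  gcongr

/-- The sum of the seminorms of `𝒦₁` of exponential order `k` and differential order at
most `N`. -/
def sumSeminorm (k N : ℕ) (χ : K1 n) : ℝ :=
  ∑ j ∈ Finset.range (N + 1), K1.seminormFamily n (k, j) χ

theorem sumSeminorm_nonneg (k N : ℕ) (χ : K1 n) : 0 ≤ sumSeminorm k N χ :=
  Finset.sum_nonneg fun _ _ => apply_nonneg _ _

theorem seminorm_le_sumSeminorm (k N : ℕ) (χ : K1 n) {j : ℕ} (hj : j ≤ N) :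
    K1.seminormFamily n (k, j) χ ≤ sumSeminorm k N χ :=
  Finset.single_le_sum (f := fun j => K1.seminormFamily n (k, j) χ)
    (fun _ _ => apply_nonneg _ _) (Finset.mem_range.2 (Nat.lt_succ_of_le hj))

theorem exists_norm_le_sumSeminorm (F : K1Dual n) :
    ∃ (k N : ℕ) (C : ℝ), 0 ≤ C ∧ ∀ χ, ‖F χ‖ ≤ C * sumSeminorm k N χ := by
  have hc : Continuous ((normSeminorm ℂ ℂ).comp F.toLinearMap) :=
    continuous_norm.comp F.continuous
  obtain ⟨s, C, -, hC⟩ := Seminorm.bound_of_continuous (K1.withSeminorms n) _ hc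
  refine ⟨s.sup Prod.fst, s.sup Prod.snd, C, C.2, fun χ => ?_⟩
  have h1 : ‖F χ‖ ≤ C * s.sup (K1.seminormFamily n) χ := hC χ
  refine h1.trans ?_
  gcongr
  refine Seminorm.finset_sup_apply_le (sumSeminorm_nonneg _ _ _) fun i hi => ?_
  exact (seminorm_mono χ (Finset.le_sup (f := Prod.fst) hi) i.2).trans
    (seminorm_le_sumSeminorm _ _ χ (Finset.le_sup (f := Prod.snd) hi))

theorem rapid (χ : K1 n) : Rapid (expWeight n) χ := by
  refine ⟨χ.contDiff.continuous, fun k => ⟨K1.seminormFamily n (k, 0) χ, fun t => ?_⟩⟩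
  rw [expWeight_pow]
  simpa using le_seminorm χ k 0 t

theorem integrable_iteratedFDeriv (χ : K1 n) (j : ℕ) :
    Integrable (fun t => ‖iteratedFDeriv ℝ j χ t‖) ∧
      ∫ t, ‖iteratedFDeriv ℝ j χ t‖ ≤ (∫ t : RSpace n, (expWeight n t ^ (n + 1))⁻¹) *
        K1.seminormFamily n (n + 1, j) χ := by
  have hi := (isBaseWeight_exp n).integrable_inv_pow.mul_const (K1.seminormFamily n (n + 1, j) χ)
  have hb : ∀ t, ‖iteratedFDeriv ℝ j χ t‖ ≤
      (expWeight n t ^ (n + 1))⁻¹ * K1.seminormFamily n (n + 1, j) χ := by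
    intro t
    rw [← div_eq_inv_mul, le_div_iff₀ (pow_pos (Real.exp_pos _) _), mul_comm, expWeight_pow]
    exact le_seminorm χ (n + 1) j t
  have hint : Integrable (fun t => ‖iteratedFDeriv ℝ j χ t‖) := by
    refine hi.mono' (Continuous.aestronglyMeasurable ?_)
      (Filter.Eventually.of_forall fun t => by simpa using hb t)
    exact (χ.contDiff.continuous_iteratedFDeriv (by exact_mod_cast le_top)).norm
  refine ⟨hint, ?_⟩
  rw [← integral_mul_const]
  exact integral_mono hint hi hb

/-- Each power of `ξ` is paid for by a derivative of `χ`; exponential order `n + 1` only serves to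
make the derivatives integrable. -/
theorem exists_fourier_decay (n N : ℕ) : ∃ C : ℝ, 0 ≤ C ∧ ∀ (χ : K1 n) (ξ : RSpace n),
    polyWeight n ξ ^ N * ‖𝓕 (χ : RSpace n → ℂ) ξ‖ ≤ C * sumSeminorm (n + 1) N χ := by
  set I := ∫ t : RSpace n, (expWeight n t ^ (n + 1))⁻¹
  have hI : 0 ≤ I := integral_nonneg fun t => by positivity
  refine ⟨2 ^ (N - 1) * (1 + 2 ^ N) * I, by positivity, fun χ ξ => ?_⟩
  have h0 : ∀ M : ℕ, M ≤ N → ‖ξ‖ ^ M * ‖𝓕 (χ : RSpace n → ℂ) ξ‖ ≤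
      2 ^ M * (I * sumSeminorm (n + 1) N χ) := by
    intro M hM
    have h1 := Real.pow_mul_norm_iteratedFDeriv_fourier_le (K := 0) (N := ⊤)
      (f := (χ : RSpace n → ℂ)) χ.contDiff
      (fun k j hk _ => by
        have : k = 0 := by simpa using hk
        subst this
        simpa using (χ.integrable_iteratedFDeriv j).1) (k := 0) (n := M) le_rfl
      (by simp) ξ
    simp only [norm_iteratedFDeriv_zero, pow_zero, one_mul, CharP.cast_eq_zero, mul_zero, zero_add,
      Finset.range_one, Finset.singleton_product, Finset.sum_map,
      Function.Embedding.coeFn_mk] at h1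
    refine h1.trans ?_
    gcongr
    rw [sumSeminorm, Finset.mul_sum]
    refine (Finset.sum_le_sum fun j _ => (χ.integrable_iteratedFDeriv j).2).trans ?_
    refine Finset.sum_le_sum_of_subset_of_nonneg (Finset.range_mono (by omega)) fun j _ _ => ?_
    exact mul_nonneg hI (apply_nonneg _ _)
  have h2 := add_pow_le zero_le_one (norm_nonneg ξ) N
  have h3 := h0 0 (Nat.zero_le _)
  have h4 := h0 N le_rfl
  simp only [pow_zero, one_mul] at h3
  calc _ ≤ 2 ^ (N - 1) * (1 ^ N + ‖ξ‖ ^ N) * ‖𝓕 (χ : RSpace n → ℂ) ξ‖ := by gcongr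
    _ = 2 ^ (N - 1) * (‖𝓕 (χ : RSpace n → ℂ) ξ‖ + ‖ξ‖ ^ N * ‖𝓕 (χ : RSpace n → ℂ) ξ‖) := by
      ring
    _ ≤ 2 ^ (N - 1) * (I * sumSeminorm (n + 1) N χ + 2 ^ N * (I * sumSeminorm (n + 1) N χ)) := by
      gcongr
    _ = _ := by ring

theorem biRapid (χ : K1 n) : BiRapid (expWeight n) (polyWeight n) χ := by
  refine ⟨χ.rapid, continuous_fourier (χ.rapid.integrable (isBaseWeight_exp n)), fun k => ?_⟩
  obtain ⟨C, -, hC⟩ := exists_fourier_decay n k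
  exact ⟨_, hC χ⟩

end K1

/-! ### Derivative estimates from decay of a function and its Fourier transform -/

section derivatives

variable {f : RSpace n → ℂ} {ρ : RSpace n → ℝ}

theorem eq_fourier_fourier_neg (hf : BiRapid ρ (polyWeight n) f) (hρ : IsBaseWeight ρ) :
    f = 𝓕 (fun x => 𝓕 f (-x)) := by
  rw [← Real.fourierInv_eq_fourier_comp_neg]
  exact (hf.fst.continuous.fourierInv_fourier_eq (hf.fst.integrable hρ)
    (hf.snd.integrable (isBaseWeight_one_add n))).symm

theorem integrable_norm_pow_mul_fourier_neg (hf : BiRapid ρ (polyWeight n) f) (k : ℕ) :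
    Integrable fun v => ‖v‖ ^ k * ‖𝓕 f (-v)‖ := by
  have h := (hf.snd.integrable_pow_mul (isBaseWeight_one_add n) k).comp_neg
  refine h.mono' ?_ (Filter.Eventually.of_forall fun v => ?_)
  · exact ((continuous_norm.pow k).mul
      (hf.snd.continuous.comp continuous_neg).norm).aestronglyMeasurable
  · rw [Real.norm_of_nonneg (by positivity)]
    simp only [polyWeight, norm_neg]
    gcongr
    linarith

theorem BiRapid.contDiff (hf : BiRapid ρ (polyWeight n) f) (hρ : IsBaseWeight ρ) :
    ContDiff ℝ ∞ f := by
  rw [eq_fourier_fourier_neg hf hρ]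
  exact Real.contDiff_fourier (N := ⊤) fun k _ => integrable_norm_pow_mul_fourier_neg hf k

/-- Inversion turns `D^j f` into the transform of `𝓕 f` times a `j`-fold power of the frequency: `j`
powers of the weight absorb it and `n + 1` give integrability. No decay in `t` is obtained here. -/
theorem exists_norm_iteratedFDeriv_le (n j : ℕ) : ∃ C : ℝ, 0 ≤ C ∧
    ∀ (ρ : RSpace n → ℝ) (f : RSpace n → ℂ), IsBaseWeight ρ → BiRapid ρ (polyWeight n) f →
      ∀ A, (∀ ξ, polyWeight n ξ ^ (n + 1 + j) * ‖𝓕 f ξ‖ ≤ A) →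
        ∀ t, ‖iteratedFDeriv ℝ j f t‖ ≤ C * A := by
  set I := ∫ t : RSpace n, (polyWeight n t ^ (n + 1))⁻¹
  have hI : 0 ≤ I := integral_nonneg fun t => by positivity
  refine ⟨(2 * Real.pi * ‖innerSL (E := RSpace n) ℝ‖) ^ j * I, by positivity,
    fun ρ f hρ hf A hA t => ?_⟩
  have hA0 : 0 ≤ A := (by positivity : (0 : ℝ) ≤ _).trans (hA 0)
  have hc : Continuous fun v => 𝓕 f (-v) := hf.snd.continuous.comp continuous_neg
  rw [eq_fourier_fourier_neg hf hρ, Real.iteratedFDeriv_fourier (N := ⊤)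
    (fun k _ => integrable_norm_pow_mul_fourier_neg hf k) hc.aestronglyMeasurable
    (by simp), mul_assoc, mul_comm I, ← integral_const_mul, ← integral_const_mul]
  refine norm_integral_le_of_norm_le
    (((isBaseWeight_one_add n).integrable_inv_pow.const_mul _).const_mul _)
    (Filter.Eventually.of_forall fun v => ?_)
  rw [Circle.norm_smul]
  refine (VectorFourier.norm_fourierPowSMulRight_le _ _ _ _).trans ?_
  rw [mul_assoc]
  refine mul_le_mul_of_nonneg_left ?_ (by positivity)
  have hp : 0 < 1 + ‖v‖ := by positivity
  rw [← div_eq_mul_inv, le_div_iff₀ (by positivity)]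
  have h1 := hA (-v)
  simp only [polyWeight, norm_neg] at h1
  refine le_trans ?_ h1
  have : ‖v‖ ^ j ≤ (1 + ‖v‖) ^ j := by gcongr; linarith
  calc _ ≤ (1 + ‖v‖) ^ j * ‖𝓕 f (-v)‖ * (1 + ‖v‖) ^ (n + 1) := by gcongr
    _ = _ := by ring

/-- An interpolation inequality: a derivative at `t` is controlled by the values of the function
near `t` and by a bound for the second derivative. -/
theorem mul_norm_iteratedFDeriv_succ_le (hf : ContDiff ℝ ∞ f) (j : ℕ) {M B h : ℝ} (hh : 0 < h)
    (t : RSpace n) (hM : ∀ s, ‖iteratedFDeriv ℝ (j + 2) f s‖ ≤ M)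
    (hB : ∀ s ∈ Metric.closedBall t h, ‖iteratedFDeriv ℝ j f s‖ ≤ B) :
    h * ‖iteratedFDeriv ℝ (j + 1) f t‖ ≤ 2 * B + M * h ^ 2 := by
  have hd : ∀ i, Differentiable ℝ (iteratedFDeriv ℝ i f) := fun i =>
    hf.differentiable_iteratedFDeriv (by exact_mod_cast WithTop.coe_lt_top i)
  have hM0 : 0 ≤ M := (norm_nonneg _).trans (hM t)
  have hB0 : 0 ≤ B := (norm_nonneg _).trans (hB t (Metric.mem_closedBall_self hh.le))
  have h1 : ∀ s ∈ Metric.closedBall t h,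
      ‖fderiv ℝ (iteratedFDeriv ℝ j f) s - fderiv ℝ (iteratedFDeriv ℝ j f) t‖ ≤ M * h := by
    intro s hs
    have h2 : ‖iteratedFDeriv ℝ (j + 1) f s - iteratedFDeriv ℝ (j + 1) f t‖ ≤ M * ‖s - t‖ :=
      Convex.norm_image_sub_le_of_norm_fderiv_le (fun x _ => (hd (j + 1)) x)
        (fun x _ => by rw [norm_fderiv_iteratedFDeriv]; exact hM x) convex_univ
        (Set.mem_univ _) (Set.mem_univ _)
    rw [fderiv_iteratedFDeriv]
    simp only [Function.comp_apply]
    refine (((dist_eq_norm _ _).symm.trans (LinearIsometryEquiv.dist_map _ _ _)).trans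
      (dist_eq_norm _ _)).trans_le (h2.trans ?_)
    gcongr
    exact mem_closedBall_iff_norm.1 hs
  rw [← norm_fderiv_iteratedFDeriv, mul_comm, ← le_div_iff₀ hh]
  refine ContinuousLinearMap.opNorm_le_of_unit_norm (by positivity) fun v hv => ?_
  rw [le_div_iff₀ hh]
  have hmem : t + h • v ∈ Metric.closedBall t h := by
    rw [mem_closedBall_iff_norm, add_sub_cancel_left, norm_smul, hv, mul_one,
      Real.norm_of_nonneg hh.le]
  -- First-order Taylor expansion along the increment `h • v`. The derivative varies by at most `M *
  -- h` on the ball, so the remainder is at most `M * h ^ 2`.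
  have h3 := Convex.norm_image_sub_le_of_norm_fderiv_le' (fun x _ => (hd j) x) h1
    (convex_closedBall t h) (Metric.mem_closedBall_self hh.le) hmem
  rw [add_sub_cancel_left, map_smul, norm_smul, hv, mul_one, Real.norm_of_nonneg hh.le] at h3
  have h4 := hB _ hmem
  have h5 := hB t (Metric.mem_closedBall_self hh.le)
  set a := iteratedFDeriv ℝ j f (t + h • v)
  set b := iteratedFDeriv ℝ j f t
  set c := h • (fderiv ℝ (iteratedFDeriv ℝ j f) t) v with hc
  have h6 : ‖c‖ ≤ ‖a‖ + ‖b‖ + ‖a - b - c‖ := by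
    calc ‖c‖ = ‖a - b - (a - b - c)‖ := by congr 1; abel
      _ ≤ ‖a - b‖ + ‖a - b - c‖ := norm_sub_le _ _
      _ ≤ _ := by gcongr; exact norm_sub_le _ _
  have h7 : ‖c‖ = ‖(fderiv ℝ (iteratedFDeriv ℝ j f) t) v‖ * h := by
    rw [hc, norm_smul, Real.norm_of_nonneg hh.le, mul_comm]
  rw [← h7]
  nlinarith

/-- Exponential decay passes from order `j` to `j + 1` by interpolating between order `j`, decaying
at rate `2k`, and order `j + 2`, merely bounded. The rate is halved at each step, which is harmless
because all rates are available. -/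
theorem exists_exp_mul_norm_iteratedFDeriv_le (n j : ℕ) : ∀ k : ℕ, ∃ (N : ℕ) (C : ℝ), 0 ≤ C ∧
    ∀ f : RSpace n → ℂ, BiRapid (expWeight n) (polyWeight n) f →
      ∀ A, (∀ t, expWeight n t ^ N * ‖f t‖ ≤ A) → (∀ ξ, polyWeight n ξ ^ N * ‖𝓕 f ξ‖ ≤ A) →
        ∀ t, Real.exp (k * ‖t‖) * ‖iteratedFDeriv ℝ j f t‖ ≤ C * A := by
  induction j with
  | zero =>
    intro k
    refine ⟨k, 1, zero_le_one, fun f _ A hA _ t => ?_⟩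
    rw [norm_iteratedFDeriv_zero, ← expWeight_pow, one_mul]
    exact hA t
  | succ j ih =>
    intro k
    obtain ⟨N, C, hC0, hC⟩ := ih (2 * k)
    obtain ⟨D, hD0, hD⟩ := exists_norm_iteratedFDeriv_le n (j + 2)
    refine ⟨max N (n + 1 + (j + 2)), 2 * (Real.exp (2 * k) * C) + D, by positivity,
      fun f hf A hA hA' t => ?_⟩
    have hM := hD (expWeight n) f (isBaseWeight_exp n) hf A fun ξ => le_trans
      (mul_le_mul_of_nonneg_right (pow_le_pow_right₀ ((isBaseWeight_one_add n).one_le ξ)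
        (le_max_right _ _)) (norm_nonneg _)) (hA' ξ)
    have hB := hC f hf A (fun t => le_trans
      (mul_le_mul_of_nonneg_right (pow_le_pow_right₀ ((isBaseWeight_exp n).one_le t)
        (le_max_left _ _)) (norm_nonneg _)) (hA t)) (fun ξ => le_trans
      (mul_le_mul_of_nonneg_right (pow_le_pow_right₀ ((isBaseWeight_one_add n).one_le ξ)
        (le_max_left _ _)) (norm_nonneg _)) (hA' ξ))
    have hA0 : 0 ≤ A := (by positivity : (0 : ℝ) ≤ _).trans (hA 0)
    -- With this step length both `2 * B` and `M * h ^ 2` are of size `e^{-2k|t|}`, and dividing by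
    -- `h` leaves `e^{-k|t|}`. As `h ≤ 1`, points of the ball satisfy `|s| ≥ |t| - 1`, whence the
    -- factor `e^{2k}` in `B`.
    set h := Real.exp (-(k * ‖t‖)) with hh
    have hh0 : 0 < h := Real.exp_pos _
    have hh1 : h ≤ 1 := by
      rw [hh, Real.exp_le_one_iff]
      have : 0 ≤ (k : ℝ) * ‖t‖ := by positivity
      linarith
    have h1 := mul_norm_iteratedFDeriv_succ_le (hf.contDiff (isBaseWeight_exp n)) j hh0 t hM
      (B := h ^ 2 * (Real.exp (2 * k) * (C * A))) (fun s hs => by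
        have h2 := hB s
        have h3 : ‖t‖ ≤ ‖s‖ + 1 := by
          rw [mem_closedBall_iff_norm'] at hs
          have := norm_add_le s (t - s)
          rw [add_sub_cancel] at this
          linarith
        have h4 : 1 ≤ h ^ 2 * Real.exp (2 * k) * Real.exp ((2 * k : ℕ) * ‖s‖) := by
          rw [hh, ← Real.exp_nat_mul, ← Real.exp_add, ← Real.exp_add, Real.one_le_exp_iff]
          push_cast
          have : (0 : ℝ) ≤ k := Nat.cast_nonneg k
          nlinarith
        calc _ ≤ h ^ 2 * Real.exp (2 * k) * Real.exp ((2 * k : ℕ) * ‖s‖) *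
                ‖iteratedFDeriv ℝ j f s‖ := le_mul_of_one_le_left (norm_nonneg _) h4
          _ = h ^ 2 * (Real.exp (2 * k) * (Real.exp ((2 * k : ℕ) * ‖s‖) *
                ‖iteratedFDeriv ℝ j f s‖)) := by ring
          _ ≤ _ := by gcongr)
    have h3 : Real.exp (k * ‖t‖) = h⁻¹ := by
      rw [hh, Real.exp_neg, inv_inv]
    rw [h3, inv_mul_le_iff₀ hh0, ← mul_le_mul_iff_right₀ hh0]
    exact h1.trans (le_of_eq (by ring))

end derivatives

end

noncomputable section

/-! ### Minkowski's integral inequality and Young's inequality -/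

open scoped NNReal

section minkowski

variable {α β : Type*} [MeasurableSpace α] [MeasurableSpace β] {μ : Measure α} {ν : Measure β}

theorem eLpNorm_ennreal_eq_lintegral {p : ℝ≥0∞} (hp : 1 ≤ p) (hp' : p ≠ ⊤) (f : α → ℝ≥0∞) :
    eLpNorm f p μ = (∫⁻ x, f x ^ p.toReal ∂μ) ^ (1 / p.toReal) := by
  rw [eLpNorm_eq_lintegral_rpow_enorm_toReal (zero_lt_one.trans_le hp).ne' hp']
  simp only [enorm_eq_self]

theorem eLpNorm_top_le_iff {f : α → ℝ≥0∞} {c : ℝ≥0∞} :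
    eLpNorm f ⊤ μ ≤ c ↔ ∀ᵐ x ∂μ, f x ≤ c := by
  rw [eLpNorm_exponent_top]
  constructor
  · intro h
    filter_upwards [enorm_ae_le_eLpNormEssSup f μ] with x hx
    exact hx.trans h
  · exact fun h => eLpNormEssSup_le_of_ae_enorm_bound h

theorem measurable_eLpNorm_prod [SFinite μ] {g : α → β → ℝ≥0∞}
    (hg : Measurable (Function.uncurry g)) {p : ℝ≥0∞} (hp : 1 ≤ p) :
    Measurable fun y => eLpNorm (fun x => g x y) p μ := by
  by_cases hp' : p = ⊤
  · subst hp'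
    -- The essential supremum is at most `c` exactly when the section of `{g > c}` is null, and the
    -- measure of sections is a measurable function.
    refine measurable_of_Iic fun c => ?_
    have h1 : (fun y => eLpNorm (fun x => g x y) ⊤ μ) ⁻¹' Set.Iic c =
        (fun y => μ ((fun x => (x, y)) ⁻¹' {q : α × β | ¬ g q.1 q.2 ≤ c})) ⁻¹' {0} := by
      ext y
      simp only [Set.mem_preimage, Set.mem_Iic, eLpNorm_top_le_iff, ae_iff,
        Set.mem_singleton_iff]
      rfl
    rw [h1]
    exact measurable_measure_prodMk_right (measurableSet_le hg measurable_const).compl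
      (measurableSet_singleton 0)
  · simp only [eLpNorm_ennreal_eq_lintegral hp hp']
    exact (Measurable.lintegral_prod_left' (hg.pow_const _)).pow_const _

/-- The usual duality proof: write `J^r = J^{r-1} J`, apply Tonelli and Hölder to get `S ≤ S^{1/q}
R`, and cancel. Passing to a minorant `J` with finite `r`-norm is what makes the cancellation
legitimate. -/
theorem lintegral_rpow_le_of_le_lintegral [SFinite μ] [SFinite ν] {g : α → β → ℝ≥0∞}
    (hg : Measurable (Function.uncurry g)) {r : ℝ} (hr : 1 < r) {J : α → ℝ≥0∞}
    (hJ : Measurable J) (hJI : ∀ x, J x ≤ ∫⁻ y, g x y ∂ν) (hfin : ∫⁻ x, J x ^ r ∂μ ≠ ⊤) :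
    ∫⁻ x, J x ^ r ∂μ ≤ (∫⁻ y, (∫⁻ x, g x y ^ r ∂μ) ^ (1 / r) ∂ν) ^ r := by
  have hc := Real.HolderConjugate.conjExponent hr
  set q := r.conjExponent
  have hq : (r - 1) * q = r := by
    rw [hc.sub_one_mul_conj]
  have hr0 : 0 < r := by linarith
  set S := ∫⁻ x, J x ^ r ∂μ
  set R := ∫⁻ y, (∫⁻ x, g x y ^ r ∂μ) ^ (1 / r) ∂ν
  have hgx : ∀ x, Measurable (g x) := fun x => hg.comp measurable_prodMk_left
  have hgy : ∀ y, Measurable fun x => g x y := fun y => hg.comp measurable_prodMk_right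
  have h1 : S ≤ S ^ (1 / q) * R := by
    calc S ≤ ∫⁻ x, J x ^ (r - 1) * ∫⁻ y, g x y ∂ν ∂μ := by
          refine lintegral_mono fun x => ?_
          calc J x ^ r = J x ^ (r - 1) * J x ^ (1 : ℝ) := by
                rw [← ENNReal.rpow_add_of_nonneg _ _ (by linarith) zero_le_one]
                congr 1
                ring
            _ ≤ _ := by
                rw [ENNReal.rpow_one]
                gcongr
                exact hJI x
      _ = ∫⁻ x, ∫⁻ y, J x ^ (r - 1) * g x y ∂ν ∂μ := by
          refine lintegral_congr fun x => ?_
          rw [lintegral_const_mul _ (hgx x)]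
      _ = ∫⁻ y, ∫⁻ x, J x ^ (r - 1) * g x y ∂μ ∂ν :=
          lintegral_lintegral_swap
            (((hJ.comp measurable_fst).pow_const _).mul hg).aemeasurable
      _ ≤ ∫⁻ y, S ^ (1 / q) * (∫⁻ x, g x y ^ r ∂μ) ^ (1 / r) ∂ν := by
          refine lintegral_mono fun y => ?_
          have h2 := ENNReal.lintegral_mul_le_Lp_mul_Lq μ hc.symm
            (hJ.pow_const (r - 1)).aemeasurable (hgy y).aemeasurable
          simp only [← ENNReal.rpow_mul, hq] at h2
          exact h2
      _ = S ^ (1 / q) * R := by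
          rw [lintegral_const_mul]
          exact (Measurable.lintegral_prod_left' (hg.pow_const _)).pow_const _
  by_cases hS0 : S = 0
  · rw [hS0]
    exact zero_le
  have h3 : S ^ (1 / r) ≤ R := by
    have h4 : S = S ^ (1 / q) * S ^ (1 / r) := by
      rw [← ENNReal.rpow_add _ _ hS0 hfin, one_div, one_div, add_comm, hc.inv_add_inv_eq_one,
        ENNReal.rpow_one]
    have h5 : S ^ (1 / q) ≠ 0 := by
      rw [Ne, ENNReal.rpow_eq_zero_iff]
      tauto
    have h6 : S ^ (1 / q) ≠ ⊤ :=
      ENNReal.rpow_ne_top_of_nonneg (one_div_nonneg.2 hc.symm.nonneg) hfin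
    exact (ENNReal.mul_le_mul_iff_right h5 h6).1 (h4.symm.le.trans h1)
  calc S = (S ^ (1 / r)) ^ r := by
        rw [← ENNReal.rpow_mul, one_div_mul_cancel hr0.ne', ENNReal.rpow_one]
    _ ≤ R ^ r := by gcongr

/-- **Minkowski's integral inequality**. -/
theorem eLpNorm_lintegral_le [SigmaFinite μ] [SFinite ν] {g : α → β → ℝ≥0∞}
    (hg : Measurable (Function.uncurry g)) {p : ℝ≥0∞} (hp : 1 ≤ p) :
    eLpNorm (fun x => ∫⁻ y, g x y ∂ν) p μ ≤ ∫⁻ y, eLpNorm (fun x => g x y) p μ ∂ν := by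
  by_cases hp' : p = ⊤
  · subst hp'
    rw [eLpNorm_top_le_iff]
    have hm := measurable_eLpNorm_prod (μ := μ) hg hp
    have h1 : ∀ᵐ y ∂ν, ∀ᵐ x ∂μ, g x y ≤ eLpNorm (fun x => g x y) ⊤ μ :=
      Filter.Eventually.of_forall fun y => eLpNorm_top_le_iff.1 le_rfl
    -- For `p = ∞` the exceptional null sets depend on `y`; joint measurability allows the two
    -- almost-everywhere quantifiers to be exchanged.
    have h2 := (Measure.ae_ae_comm (μ := μ) (ν := ν)
      (p := fun x y => g x y ≤ eLpNorm (fun x => g x y) ⊤ μ)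
      (measurableSet_le hg (hm.comp measurable_snd))).2 h1
    filter_upwards [h2] with x hx
    exact lintegral_mono_ae hx
  rcases hp.eq_or_lt with rfl | hp1
  · simp only [eLpNorm_one_eq_lintegral_enorm, enorm_eq_self]
    exact (lintegral_lintegral_swap hg.aemeasurable).le
  simp only [eLpNorm_ennreal_eq_lintegral hp hp']
  set r := p.toReal
  have hr : 1 < r := by
    have := (ENNReal.toReal_lt_toReal ENNReal.one_ne_top hp').2 hp1
    simpa using this
  have hr0 : 0 < r := by linarith
  have hI : Measurable fun x => ∫⁻ y, g x y ∂ν := Measurable.lintegral_prod_right' hg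
  rw [one_div, ENNReal.rpow_inv_le_iff hr0, ← one_div]
  -- Restriction to sets of finite measure and truncation at level `k` produce minorants with finite
  -- `r`-norm; monotone convergence removes the truncation.
  refine lintegral_le_of_forall_fin_meas_le _ fun s _ hs => ?_
  have hmono : (∫⁻ y, (∫⁻ x, g x y ^ r ∂(μ.restrict s)) ^ (1 / r) ∂ν) ^ r ≤
      (∫⁻ y, (∫⁻ x, g x y ^ r ∂μ) ^ (1 / r) ∂ν) ^ r := by
    gcongr
    exact Measure.restrict_le_self
  refine le_trans ?_ hmono
  have hJ : ∀ k : ℕ, Measurable fun x => min (∫⁻ y, g x y ∂ν) (k : ℝ≥0∞) :=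
    fun k => hI.min measurable_const
  have hsup : ∀ x, (∫⁻ y, g x y ∂ν) ^ r = ⨆ k : ℕ, (min (∫⁻ y, g x y ∂ν) (k : ℝ≥0∞)) ^ r := by
    intro x
    refine (iSup_eq_of_tendsto (fun i j hij => ?_) ?_).symm
    · gcongr
    · have h1 : Filter.Tendsto (fun k : ℕ => min (∫⁻ y, g x y ∂ν) (k : ℝ≥0∞)) Filter.atTop
          (nhds (min (∫⁻ y, g x y ∂ν) ⊤)) :=
        tendsto_const_nhds.min ENNReal.tendsto_nat_nhds_top
      rw [min_top_right] at h1
      exact (ENNReal.continuous_rpow_const.tendsto _).comp h1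
  simp only [hsup]
  rw [lintegral_iSup (fun k => (hJ k).pow_const r) (fun i j hij x => by dsimp only; gcongr)]
  refine iSup_le fun k => ?_
  refine lintegral_rpow_le_of_le_lintegral hg hr (hJ k) (fun x => min_le_left _ _) ?_
  refine ne_top_of_le_ne_top (b := (k : ℝ≥0∞) ^ r * μ s) ?_ ?_
  · exact ENNReal.mul_ne_top (ENNReal.rpow_ne_top_of_nonneg hr0.le (ENNReal.natCast_ne_top k)) hs
  · refine (lintegral_mono (g := fun _ => (k : ℝ≥0∞) ^ r) fun x => ?_).trans ?_
    · dsimp only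
      gcongr
      exact min_le_right _ _
    · simp

/-- The pairing with a bounded integrable weight is controlled by the `L^p` norm. -/
theorem lintegral_mul_le_eLpNorm_mul {h : α → ℝ≥0∞} (hh : Measurable h) (h1 : ∀ x, h x ≤ 1)
    {f : α → ℝ≥0∞} (hf : Measurable f) {p : ℝ≥0∞} (hp : 1 ≤ p) :
    ∫⁻ x, h x * f x ∂μ ≤ eLpNorm f p μ * (∫⁻ x, h x ∂μ) ^ (1 - 1 / p.toReal) := by
  -- Hölder for the measure `h μ`; since `h ≤ 1`, its `L^p` norm is at most that of `μ`. For `p = ∞`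
  -- the value `⊤.toReal = 0` makes the exponent `1`, as it should be.
  have h2 := eLpNorm_le_eLpNorm_mul_rpow_measure_univ (μ := μ.withDensity h) hp
    hf.aestronglyMeasurable
  rw [eLpNorm_one_eq_lintegral_enorm] at h2
  simp only [enorm_eq_self, ENNReal.toReal_one, div_one, withDensity_apply _ MeasurableSet.univ,
    Measure.restrict_univ] at h2
  rw [lintegral_withDensity_eq_lintegral_mul _ hh hf] at h2
  refine h2.trans ?_
  gcongr
  conv_rhs => rw [← withDensity_one (μ := μ)]
  exact withDensity_mono (Filter.Eventually.of_forall h1)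

end minkowski

section young

variable {n : ℕ}

theorem eLpNorm_convolution_le (h : RSpace n → ℝ≥0) (hh : Measurable h) {f : RSpace n → ℝ≥0∞}
    (hf : Measurable f) {p : ℝ≥0∞} (hp : 1 ≤ p) :
    eLpNorm (fun x => ∫⁻ y, (h y : ℝ≥0∞) * f (x - y)) p volume ≤
      (∫⁻ y, (h y : ℝ≥0∞)) * eLpNorm f p volume := by
  refine (eLpNorm_lintegral_le (g := fun x y => (h y : ℝ≥0∞) * f (x - y)) ?_ hp).trans ?_
  · exact (hh.coe_nnreal_ennreal.comp measurable_snd).mul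
      (hf.comp (measurable_fst.sub measurable_snd))
  rw [← lintegral_mul_const _ hh.coe_nnreal_ennreal]
  refine lintegral_mono fun y => ?_
  refine (eLpNorm_le_nnreal_smul_eLpNorm_of_ae_le_mul' (g := fun x => f (x - y)) (c := h y)
    (Filter.Eventually.of_forall fun x => le_rfl) p).trans ?_
  rw [ENNReal.smul_def, smul_eq_mul]
  gcongr
  exact (eLpNorm_comp_measurePreserving hf.aestronglyMeasurable
    (measurePreserving_sub_right volume y)).le

/-- **Young's inequality** for mixed norms, with a product kernel. -/
theorem eLpNorm_eLpNorm_convolution_le (h₁ h₂ : RSpace n → ℝ≥0) (hh₁ : Measurable h₁)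
    (hh₂ : Measurable h₂) {u : RSpace n → RSpace n → ℝ≥0∞}
    (hu : Measurable (Function.uncurry u)) (hI₁ : ∫⁻ y, (h₁ y : ℝ≥0∞) ≠ ⊤)
    {p q : ℝ≥0∞} (hp : 1 ≤ p) (hq : 1 ≤ q) :
    eLpNorm (fun ξ => eLpNorm
      (fun x => ∫⁻ w, (h₂ w : ℝ≥0∞) * ∫⁻ y, (h₁ y : ℝ≥0∞) * u (x - y) (ξ - w)) p volume)
        q volume ≤
      (∫⁻ y, (h₁ y : ℝ≥0∞)) * (∫⁻ w, (h₂ w : ℝ≥0∞)) *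
        eLpNorm (fun ξ => eLpNorm (fun x => u x ξ) p volume) q volume := by
  set I₁ := ∫⁻ y, (h₁ y : ℝ≥0∞)
  have hU : Measurable fun ξ => eLpNorm (fun x => u x ξ) p volume :=
    measurable_eLpNorm_prod hu hp
  have hI : ∀ ξ, eLpNorm
      (fun x => ∫⁻ w, (h₂ w : ℝ≥0∞) * ∫⁻ y, (h₁ y : ℝ≥0∞) * u (x - y) (ξ - w)) p volume ≤
      ∫⁻ w, (h₂ w : ℝ≥0∞) * (I₁ * eLpNorm (fun x => u x (ξ - w)) p volume) := by
    intro ξ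
    refine (eLpNorm_lintegral_le (g := fun x w =>
      (h₂ w : ℝ≥0∞) * ∫⁻ y, (h₁ y : ℝ≥0∞) * u (x - y) (ξ - w)) ?_ hp).trans ?_
    · refine (hh₂.coe_nnreal_ennreal.comp measurable_snd).mul ?_
      refine Measurable.lintegral_prod_right' (f := fun q : (RSpace n × RSpace n) × RSpace n =>
        (h₁ q.2 : ℝ≥0∞) * u (q.1.1 - q.2) (ξ - q.1.2)) ?_
      refine (hh₁.coe_nnreal_ennreal.comp measurable_snd).mul ?_
      exact hu.comp (f := fun q : (RSpace n × RSpace n) × RSpace n => (q.1.1 - q.2, ξ - q.1.2))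
        (by fun_prop)
    · refine lintegral_mono fun w => ?_
      refine (eLpNorm_le_nnreal_smul_eLpNorm_of_ae_le_mul'
        (g := fun x => ∫⁻ y, (h₁ y : ℝ≥0∞) * u (x - y) (ξ - w)) (c := h₂ w)
        (Filter.Eventually.of_forall fun x => le_rfl) p).trans ?_
      rw [ENNReal.smul_def, smul_eq_mul]
      gcongr
      exact eLpNorm_convolution_le h₁ hh₁ (f := fun x => u x (ξ - w))
        (hu.comp measurable_prodMk_right) hp
  refine (eLpNorm_mono_enorm (g := fun ξ => ∫⁻ w, (h₂ w : ℝ≥0∞) *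
    (I₁ * eLpNorm (fun x => u x (ξ - w)) p volume)) fun ξ => hI ξ).trans ?_
  refine (eLpNorm_convolution_le h₂ hh₂ (measurable_const.mul hU) hq).trans ?_
  rw [mul_comm I₁, mul_assoc]
  gcongr
  refine (eLpNorm_le_nnreal_smul_eLpNorm_of_ae_le_mul'
    (g := fun ξ => eLpNorm (fun x => u x ξ) p volume) (c := I₁.toNNReal)
    (Filter.Eventually.of_forall fun ξ => ?_) q).trans_eq ?_
  · rw [ENNReal.coe_toNNReal hI₁]
    exact le_rfl
  · rw [ENNReal.smul_def, smul_eq_mul, ENNReal.coe_toNNReal hI₁]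

end young
end

noncomputable section

variable {n : ℕ}

/-! ### Multiplication operators on `𝒦₁` and holomorphy of the short-time Fourier transform -/

section exponentials

variable {M : RSpace n →L[ℝ] ℂ}

theorem norm_iteratedFDeriv_succ_le_of_fderiv_eq {g u : RSpace n → ℂ} (hu : ContDiff ℝ ∞ u)
    (h : fderiv ℝ g = fun t => u t • M) (j : ℕ) (t : RSpace n) :
    ‖iteratedFDeriv ℝ (j + 1) g t‖ ≤ ‖M‖ * ‖iteratedFDeriv ℝ j u t‖ := by
  let A : ℂ →L[ℝ] (RSpace n →L[ℝ] ℂ) := (ContinuousLinearMap.lsmul ℝ ℂ).flip M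
  have hA : ‖A‖ ≤ ‖M‖ := ContinuousLinearMap.opNorm_le_bound _ (norm_nonneg _) fun c => by
    simp [A, norm_smul, mul_comm]
  have h' : fderiv ℝ g = A ∘ u := h
  rw [← norm_iteratedFDeriv_fderiv, h']
  refine (A.norm_iteratedFDeriv_comp_left (N := ∞) hu.contDiffAt
    (by exact_mod_cast le_top)).trans ?_
  gcongr

theorem contDiff_exp_clm (M : RSpace n →L[ℝ] ℂ) : ContDiff ℝ ∞ fun t => Complex.exp (M t) :=
  Complex.contDiff_exp.comp M.contDiff

theorem norm_iteratedFDeriv_exp_clm_le (j : ℕ) (t : RSpace n) :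
    ‖iteratedFDeriv ℝ j (fun t => Complex.exp (M t)) t‖ ≤ ‖M‖ ^ j * Real.exp (‖M‖ * ‖t‖) := by
  induction j with
  | zero =>
    rw [norm_iteratedFDeriv_zero, Complex.norm_exp, pow_zero, one_mul, Real.exp_le_exp]
    exact (Complex.re_le_norm _).trans (M.le_opNorm t)
  | succ j ih =>
    have h1 : fderiv ℝ (fun t => Complex.exp (M t)) = fun t => Complex.exp (M t) • M :=
      funext fun t => M.hasFDerivAt.cexp.fderiv
    refine (norm_iteratedFDeriv_succ_le_of_fderiv_eq (contDiff_exp_clm M) h1 j t).trans ?_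
    rw [pow_succ', mul_assoc]
    gcongr

/-- All derivatives are quadratic in `M`: the orders `0` and `1` by Taylor's formula for `exp`, the
higher ones because each derivative brings out a factor `M`. Of the three exponentials two dominate
`|t|²` and one dominates `e^{|M t|}`. -/
theorem norm_iteratedFDeriv_exp_sub_one_sub_le (hM : ‖M‖ ≤ 1) (j : ℕ) (t : RSpace n) :
    ‖iteratedFDeriv ℝ j (fun t => Complex.exp (M t) - 1 - M t) t‖ ≤
      ‖M‖ ^ 2 * Real.exp ((3 : ℕ) * ‖t‖) := by
  have hs := contDiff_exp_clm M
  have h1 : fderiv ℝ (fun t => Complex.exp (M t) - 1 - M t) =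
      fun t => (Complex.exp (M t) - 1) • M := funext fun t => by
    have := ((M.hasFDerivAt (x := t)).cexp.sub_const 1).sub M.hasFDerivAt
    refine this.fderiv.trans ?_
    ext v
    simp [sub_mul]
  have h2 : fderiv ℝ (fun t => Complex.exp (M t) - 1) = fun t => Complex.exp (M t) • M :=
    funext fun t => (M.hasFDerivAt.cexp.sub_const 1).fderiv
  have hMt : ‖M t‖ ≤ ‖M‖ * ‖t‖ := M.le_opNorm t
  have hMt' : ‖M t‖ ≤ ‖t‖ := hMt.trans (mul_le_of_le_one_left (norm_nonneg _) hM)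
  have ht : ‖t‖ ≤ Real.exp ‖t‖ := by linarith [Real.add_one_le_exp ‖t‖]
  have he : Real.exp ((3 : ℕ) * ‖t‖) = Real.exp ‖t‖ * Real.exp ‖t‖ * Real.exp ‖t‖ := by
    rw [← Real.exp_add, ← Real.exp_add]
    congr 1
    push_cast
    ring
  have he1 : 1 ≤ Real.exp ‖t‖ := Real.one_le_exp (norm_nonneg t)
  rw [he]
  match j with
  | 0 =>
    rw [norm_iteratedFDeriv_zero]
    have h3 := Complex.norm_exp_sub_sum_le_norm_mul_exp (M t) 2
    simp only [Finset.sum_range_succ, Finset.sum_range_zero] at h3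
    norm_num at h3
    rw [← sub_sub] at h3
    calc _ ≤ ‖M t‖ ^ 2 * Real.exp ‖M t‖ := h3
      _ ≤ (‖M‖ * Real.exp ‖t‖) ^ 2 * Real.exp ‖t‖ := by
        gcongr
        exact hMt.trans (by gcongr)
      _ = _ := by ring
  | 1 =>
    refine (norm_iteratedFDeriv_succ_le_of_fderiv_eq (hs.sub contDiff_const) h1 0 t).trans ?_
    rw [norm_iteratedFDeriv_zero]
    have h3 := Complex.norm_exp_sub_sum_le_norm_mul_exp (M t) 1
    simp only [Finset.sum_range_succ, Finset.sum_range_zero] at h3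
    norm_num at h3
    calc _ ≤ ‖M‖ * (‖M t‖ * Real.exp ‖M t‖) := by gcongr
      _ ≤ ‖M‖ * ((‖M‖ * Real.exp ‖t‖) * Real.exp ‖t‖) := by
        gcongr
        exact hMt.trans (by gcongr)
      _ = ‖M‖ ^ 2 * (1 * Real.exp ‖t‖ * Real.exp ‖t‖) := by ring
      _ ≤ _ := by gcongr
  | i + 2 =>
    refine (norm_iteratedFDeriv_succ_le_of_fderiv_eq (hs.sub contDiff_const) h1 (i + 1) t).trans ?_
    calc _ ≤ ‖M‖ * (‖M‖ * ‖iteratedFDeriv ℝ i (fun t => Complex.exp (M t)) t‖) := by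
          gcongr
          exact norm_iteratedFDeriv_succ_le_of_fderiv_eq hs h2 i t
      _ ≤ ‖M‖ * (‖M‖ * (‖M‖ ^ i * Real.exp (‖M‖ * ‖t‖))) := by
          gcongr
          exact norm_iteratedFDeriv_exp_clm_le i t
      _ ≤ ‖M‖ * (‖M‖ * (1 * Real.exp ‖t‖)) := by
          gcongr
          · exact pow_le_one₀ (norm_nonneg _) hM
          · exact mul_le_of_le_one_left (norm_nonneg _) hM
      _ = ‖M‖ ^ 2 * (1 * 1 * Real.exp ‖t‖) := by ring
      _ ≤ _ := by gcongr

theorem norm_iteratedFDeriv_clm_le (M : RSpace n →L[ℝ] ℂ) (j : ℕ) (t : RSpace n) :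
    ‖iteratedFDeriv ℝ j (fun t => M t) t‖ ≤ ‖M‖ * Real.exp ((1 : ℕ) * ‖t‖) := by
  have ht : ‖t‖ ≤ Real.exp ‖t‖ := by linarith [Real.add_one_le_exp ‖t‖]
  have he1 : 1 ≤ Real.exp ‖t‖ := Real.one_le_exp (norm_nonneg t)
  rw [Nat.cast_one, one_mul]
  have h1 : fderiv ℝ (fun t => M t) = fun t => (1 : ℂ) • M := funext fun t => by
    rw [one_smul]
    exact M.fderiv
  match j with
  | 0 =>
    rw [norm_iteratedFDeriv_zero]
    exact (M.le_opNorm t).trans (by gcongr)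
  | j + 1 =>
    refine (norm_iteratedFDeriv_succ_le_of_fderiv_eq contDiff_const h1 j t).trans ?_
    gcongr
    refine le_trans ?_ he1
    rcases Nat.eq_zero_or_pos j with rfl | hj
    · simp
    · rw [iteratedFDeriv_const_of_ne hj.ne']
      simp

end exponentials

namespace K1

/-- Leibniz' rule: the growth rate `κ` of the multiplier is shifted onto the exponential order of
the seminorm, and `2 ^ j` is the sum of the binomial coefficients. -/
theorem exp_mul_norm_iteratedFDeriv_mul_le (χ : K1 n) {g : RSpace n → ℂ} (hg : ContDiff ℝ ∞ g)
    {κ j : ℕ} {B : ℝ} (hB : ∀ i ≤ j, ∀ t, ‖iteratedFDeriv ℝ i g t‖ ≤ B * Real.exp (κ * ‖t‖))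
    (k : ℕ) (t : RSpace n) :
    Real.exp (k * ‖t‖) * ‖iteratedFDeriv ℝ j (fun s => g s * χ s) t‖ ≤
      B * 2 ^ j * sumSeminorm (k + κ) j χ := by
  have h1 := norm_iteratedFDeriv_mul_le hg χ.contDiff t (n := j) (by exact_mod_cast le_top)
  have hB0 : 0 ≤ B := by
    have := (norm_nonneg _).trans (hB 0 (Nat.zero_le _) t)
    exact nonneg_of_mul_nonneg_left this (Real.exp_pos _)
  refine (mul_le_mul_of_nonneg_left h1 (Real.exp_pos _).le).trans ?_
  have h2 : (2 : ℝ) ^ j = ∑ i ∈ Finset.range (j + 1), (j.choose i : ℝ) := by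
    exact_mod_cast (Nat.sum_range_choose j).symm
  rw [Finset.mul_sum, h2, Finset.mul_sum, Finset.sum_mul]
  refine Finset.sum_le_sum fun i hi => ?_
  have hi' : i ≤ j := Nat.lt_succ_iff.1 (Finset.mem_range.1 hi)
  have h3 := (le_seminorm χ (k + κ) (j - i) t).trans
    (seminorm_le_sumSeminorm _ j χ (Nat.sub_le _ _))
  have he : Real.exp ((k + κ : ℕ) * ‖t‖) = Real.exp (k * ‖t‖) * Real.exp (κ * ‖t‖) := by
    rw [← Real.exp_add]
    push_cast
    ring_nf
  rw [he] at h3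
  calc _ ≤ Real.exp (k * ‖t‖) * ((j.choose i : ℝ) * (B * Real.exp (κ * ‖t‖)) *
          ‖iteratedFDeriv ℝ (j - i) χ t‖) := by
        gcongr
        exact hB i hi' t
    _ = B * (j.choose i : ℝ) * (Real.exp (k * ‖t‖) * Real.exp (κ * ‖t‖) *
          ‖iteratedFDeriv ℝ (j - i) χ t‖) := by ring
    _ ≤ _ := by gcongr

/-- Multiplication of an element of `𝒦₁` by a smooth function whose derivatives are bounded by
`B e^{κ|t|}`. -/
def mulFun (g : RSpace n → ℂ) (hg : ContDiff ℝ ∞ g) (κ : ℕ) (B : ℝ)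
    (hB : ∀ i t, ‖iteratedFDeriv ℝ i g t‖ ≤ B * Real.exp (κ * ‖t‖)) (χ : K1 n) : K1 n :=
  ⟨fun t => g t * χ t, hg.mul χ.contDiff, fun k _ =>
    ⟨_, exp_mul_norm_iteratedFDeriv_mul_le χ hg (fun i _ => hB i) k⟩⟩

/-- The multiplier is bounded only up to order `N`, so that `B` may depend on `N`, as it does for
exponentials. -/
theorem sumSeminorm_le_of_mul (χ χ' : K1 n) {g : RSpace n → ℂ} (hg : ContDiff ℝ ∞ g)
    (h : ∀ t, χ' t = g t * χ t) {κ N : ℕ} {B : ℝ}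
    (hB : ∀ i ≤ N, ∀ t, ‖iteratedFDeriv ℝ i g t‖ ≤ B * Real.exp (κ * ‖t‖)) (k : ℕ) :
    sumSeminorm k N χ' ≤ B * ∑ j ∈ Finset.range (N + 1), 2 ^ j * sumSeminorm (k + κ) j χ := by
  rw [sumSeminorm, Finset.mul_sum]
  refine Finset.sum_le_sum fun j hj => seminorm_le _ _ _ fun t => ?_
  have h1 : (χ' : RSpace n → ℂ) = fun t => g t * χ t := funext h
  rw [h1, ← mul_assoc]
  exact exp_mul_norm_iteratedFDeriv_mul_le χ hg
    (fun i hi => hB i (hi.trans (Nat.lt_succ_iff.1 (Finset.mem_range.1 hj)))) k t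

/-- Multiplication by a real-linear form. -/
def mulForm (M : RSpace n →L[ℝ] ℂ) (χ : K1 n) : K1 n :=
  mulFun (fun t => M t) M.contDiff 1 ‖M‖ (norm_iteratedFDeriv_clm_le M) χ

/-- The time-frequency shift `t ↦ e^{-2π i z·t} conj (ψ (t - x))` as an element of `𝒦₁`. -/
def timeFreq (ψ : K1 n) (x : RSpace n) (z : Fin n → ℂ) : K1 n :=
  ⟨timeFreqFun ψ x z, timeFreqFun_mem_k1 ψ.2 x z⟩

end K1

theorem expForm_apply (z : Fin n → ℂ) (t : RSpace n) :
    expForm z t = -2 * Real.pi * Complex.I * cdot z t := rfl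

theorem timeFreqFun_add (ψ : RSpace n → ℂ) (x : RSpace n) (z h : Fin n → ℂ) (t : RSpace n) :
    timeFreqFun ψ x (z + h) t = Complex.exp (expForm h t) * timeFreqFun ψ x z t := by
  rw [timeFreqFun, timeFreqFun, expForm_apply, ← mul_assoc, ← Complex.exp_add]
  congr 2
  simp only [cdot, Pi.add_apply, add_mul, Finset.sum_add_distrib]
  ring

theorem norm_expForm_le (z : Fin n → ℂ) : ‖expForm z‖ ≤ 2 * Real.pi * n * ‖z‖ := by
  refine ContinuousLinearMap.opNorm_le_bound _ (by positivity) fun t => ?_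
  have h1 : ‖cdot z t‖ ≤ n * (‖z‖ * ‖t‖) := by
    refine (norm_sum_le _ _).trans ((Finset.sum_le_sum (g := fun _ => ‖z‖ * ‖t‖)
      fun j _ => ?_).trans (by simp))
    rw [norm_mul, Complex.norm_real]
    exact mul_le_mul (norm_le_pi_norm z j) (PiLp.norm_apply_le t j) (norm_nonneg _)
      (norm_nonneg _)
  rw [expForm_apply, norm_mul]
  have h2 : ‖-2 * (Real.pi : ℂ) * Complex.I‖ = 2 * Real.pi := by
    simp [abs_of_pos Real.pi_pos]
  rw [h2]
  calc _ ≤ 2 * Real.pi * (n * (‖z‖ * ‖t‖)) := by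
        have := Real.pi_pos
        gcongr
    _ = _ := by ring

/-- The derivative of the short-time Fourier transform in the frequency variable. -/
def stftDeriv (ψ : K1 n) (F : K1Dual n) (x : RSpace n) (z : Fin n → ℂ) :
    (Fin n → ℂ) →L[ℂ] ℂ :=
  LinearMap.toContinuousLinearMap
    { toFun := fun h => F (K1.mulForm (expForm h) (K1.timeFreq ψ x z))
      map_add' := fun h h' => by
        rw [← map_add]
        congr 1
        refine Subtype.ext (funext fun t => ?_)
        change expForm (h + h') t * _ = expForm h t * _ + expForm h' t * _
        simp only [expForm_apply, cdot, Pi.add_apply, add_mul, Finset.sum_add_distrib, mul_add]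
      map_smul' := fun c h => by
        rw [RingHom.id_apply, ← map_smul]
        congr 1
        refine Subtype.ext (funext fun t => ?_)
        change expForm (c • h) t * _ = c * (expForm h t * _)
        simp only [expForm_apply, cdot, Pi.smul_apply, smul_eq_mul, mul_assoc, Finset.mul_sum,
          Finset.sum_mul]
        refine Finset.sum_congr rfl fun j _ => ?_
        ring }

open Filter Topology in
-- The remainder is `F` applied to the base test function multiplied by `e^L - 1 - L` with `L =
-- expForm h`. By continuity of `F` on `𝒦₁` it is `O(‖h‖²)`.
theorem hasFDerivAt_stft (ψ : K1 n) (F : K1Dual n) (x : RSpace n) (z : Fin n → ℂ) :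
    HasFDerivAt (stft ψ F x) (stftDeriv ψ F x z) z := by
  obtain ⟨k, N, C, hC0, hC⟩ := K1.exists_norm_le_sumSeminorm F
  set b := K1.timeFreq ψ x z with hb
  set S := ∑ j ∈ Finset.range (N + 1), 2 ^ j * K1.sumSeminorm (k + 3) j b
  have hS : 0 ≤ S := Finset.sum_nonneg fun j _ =>
    mul_nonneg (by positivity) (K1.sumSeminorm_nonneg _ _ _)
  rw [hasFDerivAt_iff_isLittleO_nhds_zero]
  have hsmall : ∀ᶠ h : Fin n → ℂ in 𝓝 0, ‖expForm h‖ ≤ 1 := by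
    have h1 : Tendsto (fun h : Fin n → ℂ => 2 * Real.pi * n * ‖h‖) (𝓝 0) (𝓝 0) := by
      have : Continuous fun h : Fin n → ℂ => 2 * Real.pi * n * ‖h‖ := by fun_prop
      simpa using this.tendsto 0
    filter_upwards [h1.eventually (gt_mem_nhds zero_lt_one)] with h hh
    exact (norm_expForm_le h).trans hh.le
  have hO : (fun h => stft ψ F x (z + h) - stft ψ F x z - stftDeriv ψ F x z h) =O[𝓝 0]
      fun h : Fin n → ℂ => ‖h‖ ^ 2 := by
    refine Asymptotics.IsBigO.of_bound (C * ((2 * Real.pi * n) ^ 2 * S)) ?_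
    filter_upwards [hsmall] with h hh
    have h2 : stft ψ F x (z + h) - stft ψ F x z - stftDeriv ψ F x z h =
        F (K1.timeFreq ψ x (z + h) - b - K1.mulForm (expForm h) b) := by
      rw [map_sub, map_sub]
      rfl
    rw [h2, Real.norm_of_nonneg (by positivity)]
    refine (hC _).trans ?_
    rw [mul_assoc]
    gcongr
    have h3 := K1.sumSeminorm_le_of_mul b (K1.timeFreq ψ x (z + h) - b - K1.mulForm (expForm h) b)
      (g := fun t => Complex.exp (expForm h t) - 1 - expForm h t)
      (((contDiff_exp_clm _).sub contDiff_const).sub (expForm h).contDiff) (fun t => by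
        change timeFreqFun ψ x (z + h) t - timeFreqFun ψ x z t - expForm h t * timeFreqFun ψ x z t =
          (Complex.exp (expForm h t) - 1 - expForm h t) * timeFreqFun ψ x z t
        rw [timeFreqFun_add]
        ring) (κ := 3) (N := N) (fun i _ => norm_iteratedFDeriv_exp_sub_one_sub_le hh i) k
    refine h3.trans ?_
    calc _ ≤ (2 * Real.pi * n * ‖h‖) ^ 2 * S := by
          gcongr
          exact norm_expForm_le h
      _ = _ := by ring
  exact hO.trans_isLittleO (Asymptotics.isLittleO_norm_pow_id one_lt_two)

theorem differentiable_stft (ψ : K1 n) (F : K1Dual n) (x : RSpace n) :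
    Differentiable ℂ (stft ψ F x) := fun z => (hasFDerivAt_stft ψ F x z).differentiableAt

end

noncomputable section

variable {n : ℕ}

/-! ### The reproducing formula in the two dual spaces -/

namespace K1

theorem sumSeminorm_mono (χ : K1 n) {k k' N N' : ℕ} (hk : k ≤ k') (hN : N ≤ N') :
    sumSeminorm k N χ ≤ sumSeminorm k' N' χ :=
  (Finset.sum_le_sum fun j _ => seminorm_mono χ hk j).trans
    (Finset.sum_le_sum_of_subset_of_nonneg (Finset.range_mono (by omega))
      fun _ _ _ => apply_nonneg _ _)

/-- Together with `exists_fourier_decay` this describes the topology of `𝒦₁` by the decay of `χ` and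
`𝓕 χ` alone, the form in which `weak_reproducing` can be used. -/
theorem exists_sumSeminorm_le (n k N : ℕ) : ∃ (k' : ℕ) (C : ℝ), ∀ (χ : K1 n) (A : ℝ),
    (∀ t, expWeight n t ^ k' * ‖χ t‖ ≤ A) →
      (∀ ξ, polyWeight n ξ ^ k' * ‖𝓕 (χ : RSpace n → ℂ) ξ‖ ≤ A) →
        sumSeminorm k N χ ≤ C * A := by
  choose K C _ hC using fun j => exists_exp_mul_norm_iteratedFDeriv_le n j k
  refine ⟨(Finset.range (N + 1)).sup K, ∑ j ∈ Finset.range (N + 1), C j, fun χ A h1 h2 => ?_⟩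
  rw [sumSeminorm, Finset.sum_mul]
  refine Finset.sum_le_sum fun j hj => seminorm_le χ k j (hC j χ χ.biRapid A ?_ ?_)
  · exact fun t => le_trans (mul_le_mul_of_nonneg_right
      (pow_le_pow_right₀ ((isBaseWeight_exp n).one_le t) (Finset.le_sup hj)) (norm_nonneg _)) (h1 t)
  · exact fun t => le_trans (mul_le_mul_of_nonneg_right
      (pow_le_pow_right₀ ((isBaseWeight_one_add n).one_le t) (Finset.le_sup hj))
      (norm_nonneg _)) (h2 t)

theorem reproducing (φ : K1 n) (F : K1Dual n) :
    Continuous (fun p : RSpace n × RSpace n => stft φ F p.1 (fun j => (p.2 j : ℂ))) ∧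
    ∀ χ : K1 n,
      Integrable (fun p => gaborCoeff φ χ p * stft φ F p.1 (fun j => (p.2 j : ℂ))) ∧
      ∫ p, gaborCoeff φ χ p * stft φ F p.1 (fun j => (p.2 j : ℂ)) =
        (∫ s, φ s * conj (φ s)) * F χ := by
  obtain ⟨k, N, C, hC0, hC⟩ := exists_norm_le_sumSeminorm F
  obtain ⟨k', C', hC'⟩ := exists_sumSeminorm_le n k N
  exact weak_reproducing (isBaseWeight_exp n) (isBaseWeight_one_add n) k'
    (k1Submodule n).subtype (fun χ => K1.biRapid χ) φ.biRapid
    (fun p => K1.timeFreq φ p.1 (fun j => (p.2 j : ℂ))) (fun p => rfl) F.toLinearMap (C * C')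
    fun χ A h1 h2 => (hC χ).trans (by
      rw [mul_assoc]
      exact mul_le_mul_of_nonneg_left (hC' χ A h1 h2) hC0)

end K1

namespace GelfandShilov

theorem biRapid (φ : GelfandShilov n) : BiRapid (expWeight n) (expWeight n) φ := by
  obtain ⟨Φ, hΦ, hΦ'⟩ := φ.2.1
  refine ⟨⟨continuous_of_entire_ext hΦ hΦ', fun k => ?_⟩,
    ⟨continuous_fourier φ.integrable, fun k => ?_⟩⟩
  · obtain ⟨C, hC⟩ := φ.2.2.1 k
    exact ⟨C, fun t => by rw [expWeight_pow]; exact hC t⟩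
  · obtain ⟨C, hC⟩ := φ.2.2.2 k
    exact ⟨C, fun t => by rw [expWeight_pow]; exact hC t⟩

theorem biRapid_poly (φ : GelfandShilov n) : BiRapid (expWeight n) (polyWeight n) φ := by
  refine ⟨φ.biRapid.fst, φ.biRapid.snd.continuous, fun k => ?_⟩
  obtain ⟨C, hC⟩ := φ.biRapid.snd.decay k
  refine ⟨C, fun t => le_trans ?_ (hC t)⟩
  have := (isBaseWeight_exp n).one_add_norm_le t
  have h0 : 0 ≤ polyWeight n t := ((isBaseWeight_one_add n).pos t).le
  gcongr

/-- The inclusion `Σ₁¹ ⊆ 𝒦₁`. -/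
def toK1 (φ : GelfandShilov n) : K1 n :=
  ⟨φ, φ.biRapid_poly.contDiff (isBaseWeight_exp n), fun k j => by
    obtain ⟨N, C, -, hC⟩ := exists_exp_mul_norm_iteratedFDeriv_le n j k
    obtain ⟨A, hA⟩ := φ.biRapid_poly.fst.decay N
    obtain ⟨B, hB⟩ := φ.biRapid_poly.snd.decay N
    exact ⟨_, hC φ φ.biRapid_poly (max A B) (fun t => (hA t).trans (le_max_left _ _))
      fun t => (hB t).trans (le_max_right _ _)⟩⟩

theorem exists_norm_le (f : GelfandShilovDual n) : ∃ (k : ℕ) (C : ℝ),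
    ∀ (χ : GelfandShilov n) (A : ℝ), (∀ t, expWeight n t ^ k * ‖χ t‖ ≤ A) →
      (∀ ξ, expWeight n ξ ^ k * ‖𝓕 (χ : RSpace n → ℂ) ξ‖ ≤ A) → ‖f χ‖ ≤ C * A := by
  have hc : Continuous ((normSeminorm ℂ ℂ).comp f.toLinearMap) :=
    continuous_norm.comp f.continuous
  obtain ⟨s, C, -, hC⟩ := Seminorm.bound_of_continuous (GelfandShilov.withSeminorms n) _ hc
  -- The factor `2` arises because each seminorm of `Σ₁¹` is the sum of two suprema.
  refine ⟨s.sup id, C * 2, fun χ A h1 h2 => ?_⟩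
  have hA : 0 ≤ A := (by positivity : (0 : ℝ) ≤ _).trans (h1 0)
  have h3 : ‖f χ‖ ≤ C * s.sup (GelfandShilov.seminormFamily n) χ := hC χ
  refine h3.trans ?_
  rw [mul_assoc]
  gcongr
  refine Seminorm.finset_sup_apply_le (by positivity) fun k hk => ?_
  have hk' : k ≤ s.sup id := Finset.le_sup (f := id) hk
  rw [two_mul]
  refine add_le_add (ciSup_le fun t => le_trans ?_ (h1 t)) (ciSup_le fun t => le_trans ?_ (h2 t))
  · rw [expWeight_pow]
    change Real.exp (k * ‖t‖) * ‖χ t‖ ≤ _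
    gcongr
  · rw [expWeight_pow]
    change Real.exp (k * ‖t‖) * ‖𝓕 (χ : RSpace n → ℂ) t‖ ≤ _
    gcongr

theorem reproducing (φ : GelfandShilov n) (f : GelfandShilovDual n) :
    Continuous (fun p : RSpace n × RSpace n => stftGS φ f p.1 p.2) ∧
    ∀ χ : GelfandShilov n, ∫ p, gaborCoeff φ χ p * stftGS φ f p.1 p.2 =
        (∫ s, φ s * conj (φ s)) * f χ := by
  obtain ⟨k, C, hC⟩ := exists_norm_le f
  have h := weak_reproducing (isBaseWeight_exp n) (isBaseWeight_exp n) k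
    (GelfandShilov.coeₗ n) (fun χ => χ.biRapid) φ.biRapid
    (fun p : RSpace n × RSpace n => ⟨timeFreqFun φ p.1 (fun j => (p.2 j : ℂ)),
      timeFreqFun_mem_gelfandShilov φ.2 p.1 p.2⟩) (fun p => rfl) f.toLinearMap C hC
  exact ⟨h.1, fun χ => (h.2 χ).2⟩

end GelfandShilov

/-- Real time-frequency shifts of a window in `Σ₁¹` stay in `Σ₁¹`, where `F` and `f` agree. -/
theorem stft_toK1_of_extends {F : K1Dual n} {f : GelfandShilovDual n} (h : Extends F f)
    (φ : GelfandShilov n) (x ξ : RSpace n) :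
    stft φ.toK1 F x (fun j => (ξ j : ℂ)) = stftGS φ f x ξ :=
  h _ ⟨timeFreqFun φ x (fun j => (ξ j : ℂ)), timeFreqFun_mem_gelfandShilov φ.2 x ξ⟩
    fun _ => rfl

theorem integral_mul_conj_self_ne_zero {φ : RSpace n → ℂ} {ρ : RSpace n → ℝ}
    (hρ : IsBaseWeight ρ) (hφ : Rapid ρ φ) (h0 : φ ≠ 0) : ∫ s, φ s * conj (φ s) ≠ 0 := by
  obtain ⟨C, hC⟩ := hφ.decay 0
  have h1 : ∀ s, φ s * conj (φ s) = ((‖φ s‖ ^ 2 : ℝ) : ℂ) := fun s => by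
    rw [Complex.mul_conj, Complex.normSq_eq_norm_sq]
  have hi : Integrable fun s => ‖φ s‖ ^ 2 := by
    have := (hφ.integrable hρ).norm.mul_bdd (c := C)
      hφ.continuous.norm.aestronglyMeasurable
      (Filter.Eventually.of_forall fun s => by simpa using hC s)
    simpa only [sq] using this
  simp only [h1]
  rw [integral_complex_ofReal, Ne, Complex.ofReal_eq_zero,
    integral_eq_zero_iff_of_nonneg (fun s => by positivity) hi]
  intro h2
  have h3 := (Continuous.ae_eq_iff_eq volume (hφ.continuous.norm.pow 2) continuous_const).1 h2
  refine h0 (funext fun s => ?_)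
  have h4 : ‖φ s‖ ^ 2 = 0 := congrFun h3 s
  simpa using h4

/-- The reproducing formula in `𝒦₁'` with a window from `Σ₁¹` expresses an extension through `V_φ f`
only; this takes the place of a density argument. -/
theorem eq_of_extends {φ : GelfandShilov n} (hφ : φ ≠ 0) {f : GelfandShilovDual n}
    {F₁ F₂ : K1Dual n} (h₁ : Extends F₁ f) (h₂ : Extends F₂ f) : F₁ = F₂ := by
  have hκ : ∫ s, φ s * conj (φ s) ≠ 0 :=
    integral_mul_conj_self_ne_zero (isBaseWeight_exp n) φ.biRapid.fst
      fun h => hφ (Subtype.ext h)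
  ext χ
  have e₁ := ((K1.reproducing φ.toK1 F₁).2 χ).2
  have e₂ := ((K1.reproducing φ.toK1 F₂).2 χ).2
  simp only [stft_toK1_of_extends h₁] at e₁
  simp only [stft_toK1_of_extends h₂] at e₂
  exact mul_left_cancel₀ hκ (e₁.symm.trans e₂)

/-! ### Bounds for Gabor coefficients of elements of `𝒦₁` -/

/-- The joint decay estimate made linear in a seminorm of `χ`, so that it yields both continuity of
the extension and bounds uniform in the strip. The exponent `2 * N` comes from `ab ≤ a² + b²`, and
`n + 1` from bounding `𝓕 χ`. -/
theorem K1.exists_gaborCoeff_bound (φ : K1 n) (N : ℕ) : ∃ (k M : ℕ) (D : ℝ), 0 ≤ D ∧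
    ∀ (χ : K1 n) (p : RSpace n × RSpace n),
      expWeight n p.1 ^ N * polyWeight n p.2 ^ N * ‖gaborCoeff φ χ p‖ ≤
        D * K1.sumSeminorm k M χ := by
  obtain ⟨C, hC0, hC⟩ := K1.exists_fourier_decay n (2 * N)
  set I := ∫ s, expWeight n s ^ (2 * N) * ‖φ s‖
  set J := ∫ s, polyWeight n s ^ (2 * N) * ‖𝓕 (φ : RSpace n → ℂ) s‖
  have hI : 0 ≤ I := integral_nonneg fun s => by positivity
  have hJ : 0 ≤ J := integral_nonneg fun s => by positivity
  refine ⟨max (2 * N) (n + 1), 2 * N, I + C * J, by positivity, fun χ p => ?_⟩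
  have h1 : ∀ t, expWeight n t ^ (2 * N) * ‖χ t‖ ≤
      K1.sumSeminorm (max (2 * N) (n + 1)) (2 * N) χ := by
    intro t
    rw [expWeight_pow]
    have h2 := K1.le_seminorm χ (2 * N) 0 t
    rw [norm_iteratedFDeriv_zero] at h2
    exact h2.trans ((K1.seminorm_mono χ (le_max_left _ _) 0).trans
      (K1.seminorm_le_sumSeminorm _ _ χ (Nat.zero_le _)))
  have h2 : ∀ ξ, polyWeight n ξ ^ (2 * N) * ‖𝓕 (χ : RSpace n → ℂ) ξ‖ ≤
      C * K1.sumSeminorm (max (2 * N) (n + 1)) (2 * N) χ := fun ξ =>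
    (hC χ ξ).trans (mul_le_mul_of_nonneg_left
      (K1.sumSeminorm_mono χ (le_max_right _ _) le_rfl) hC0)
  refine (pow_mul_norm_gaborCoeff_le (isBaseWeight_exp n) (isBaseWeight_one_add n) φ.biRapid
    (χ.rapid.integrable (isBaseWeight_exp n)) h1 h2 p).trans_eq ?_
  ring

theorem cdot_complexPoint (ξ η t : RSpace n) : cdot (complexPoint ξ η) t =
    ((inner ℝ t ξ : ℝ) : ℂ) + ((inner ℝ t η : ℝ) : ℂ) * Complex.I := by
  rw [← cdot_ofReal, ← cdot_ofReal, cdot, cdot, cdot, Finset.sum_mul, ← Finset.sum_add_distrib]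
  refine Finset.sum_congr rfl fun j _ => ?_
  rw [complexPoint]
  ring

/-- Covariance: substituting `s = u + x` produces a unimodular phase and, from the imaginary part of
the frequency, the factor `e^{2π x·η}`. -/
theorem norm_gaborCoeff_timeFreqFun (φ ψ : RSpace n → ℂ) (x ξ η : RSpace n)
    (p : RSpace n × RSpace n) :
    ‖gaborCoeff φ (timeFreqFun ψ x (complexPoint ξ η)) p‖ =
      Real.exp (2 * Real.pi * inner ℝ x η) *
        ‖gaborCoeff φ (timeFreqFun ψ 0 (complexPoint 0 η)) (p.1 - x, p.2 - ξ)‖ := by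
  have h1 : gaborCoeff φ (timeFreqFun ψ x (complexPoint ξ η)) p =
      (Real.exp (2 * Real.pi * inner ℝ x η) : ℂ) *
        (Complex.exp (((2 * Real.pi * inner ℝ x (p.2 - ξ) : ℝ) : ℂ) * Complex.I) *
          gaborCoeff φ (timeFreqFun ψ 0 (complexPoint 0 η)) (p.1 - x, p.2 - ξ)) := by
    rw [gaborCoeff, gaborCoeff, ← integral_const_mul, ← integral_const_mul,
      ← integral_add_right_eq_self _ x]
    congr 1
    ext u
    dsimp only
    have h2 : u + x - p.1 = u - (p.1 - x) := by abel
    rw [timeFreqFun_ofReal, timeFreqFun_ofReal, timeFreqFun, timeFreqFun, cdot_complexPoint,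
      cdot_complexPoint, add_sub_cancel_right, sub_zero, h2]
    simp only [map_mul, ← Complex.exp_conj, Complex.conj_ofReal, Complex.conj_I,
      Complex.conj_conj]
    -- Separates the exponentials from the window factors, leaving one identity between exponents
    -- that holds by `I² = -1`.
    have h3 : ∀ a b c d e g h i : ℂ, a * c = e * (g * (h * i)) →
        a * b * (c * d) = e * (g * (h * b * (i * d))) := by
      intro a b c d e g h i H
      calc _ = (a * c) * (b * d) := by ring
        _ = _ := by rw [H]; ring
    refine h3 _ _ _ _ _ _ _ _ ?_
    rw [Complex.ofReal_exp]
    simp only [← Complex.exp_add]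
    congr 1
    simp only [inner_add_left, inner_sub_right, inner_zero_right]
    push_cast
    linear_combination (2 * (Real.pi : ℂ) * (-(inner ℝ x η : ℝ) : ℂ)) * Complex.I_sq
  rw [h1, norm_mul, norm_mul, Complex.norm_exp_ofReal_mul_I, one_mul, Complex.norm_real,
    Real.norm_of_nonneg (Real.exp_pos _).le]

/-- The unshifted test functions with frequency `iη` form a bounded set in `𝒦₁`: the multiplier is
the exponential of a form of norm at most `R`, so it grows at rate `R` and its derivatives up to
order `N` cost at most `(1 + R)^N`. -/
theorem K1.exists_sumSeminorm_timeFreq_le (ψ : K1 n) (lam : ℝ) (k N : ℕ) : ∃ D : ℝ,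
    ∀ η : RSpace n, ‖η‖ ≤ lam →
      K1.sumSeminorm k N (K1.timeFreq ψ 0 (complexPoint 0 η)) ≤ D := by
  set R := 2 * Real.pi * n * lam
  obtain ⟨κ, hκ⟩ := exists_nat_ge R
  refine ⟨_, fun η hη => K1.sumSeminorm_le_of_mul (K1.timeFreq ψ 0 0) _
    (contDiff_exp_clm (expForm (complexPoint 0 η))) (fun t => ?_) (κ := κ)
    (B := (1 + R) ^ N) (fun i hi t => ?_) k⟩
  · have := timeFreqFun_add ψ 0 0 (complexPoint 0 η) t
    rw [zero_add] at this
    exact this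
  · have h0 : ‖complexPoint 0 η‖ ≤ lam := by
      refine le_trans ((pi_norm_le_iff_of_nonneg (norm_nonneg η)).2 fun j => ?_) hη
      simpa [complexPoint] using PiLp.norm_apply_le η j
    have hlam : 0 ≤ lam := (norm_nonneg η).trans hη
    have h1 : ‖expForm (complexPoint 0 η)‖ ≤ R := by
      exact (norm_expForm_le _).trans (mul_le_mul_of_nonneg_left h0 (by positivity))
    have hR : 0 ≤ R := (norm_nonneg _).trans h1
    refine (norm_iteratedFDeriv_exp_clm_le i t).trans ?_
    have h2 : ‖expForm (complexPoint 0 η)‖ ^ i ≤ (1 + R) ^ N := calc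
      _ ≤ (1 + R) ^ i := by gcongr; linarith
      _ ≤ _ := pow_le_pow_right₀ (by linarith) hi
    gcongr
    exact h1.trans hκ

end

noncomputable section

variable {n : ℕ}

/-! ### Norm estimates and existence of the extension -/

theorem IsWeightM1.exists_le {m : RSpace n × RSpace n → ℝ} (hm : IsWeightM1 m) :
    ∃ (A : ℝ) (r : ℕ), 0 < A ∧ ∀ p p' : RSpace n × RSpace n,
      m p ≤ A * (expWeight n (p.1 - p'.1) ^ r * polyWeight n (p.2 - p'.2) ^ r) * m p' := by
  obtain ⟨A, a, s, hA, ha, hs, h⟩ := hm.moderate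
  obtain ⟨r, hr⟩ := exists_nat_ge (max a s)
  refine ⟨A, r, hA, fun p p' => ?_⟩
  have h1 := h p'.1 p'.2 (p.1 - p'.1) (p.2 - p'.2)
  rw [add_sub_cancel, add_sub_cancel, div_le_iff₀ (hm.pos _)] at h1
  refine h1.trans (mul_le_mul_of_nonneg_right ?_ (hm.pos _).le)
  rw [mul_assoc, expWeight_pow]
  have har : a ≤ r := (le_max_left _ _).trans hr
  have hsr : s ≤ r := (le_max_right _ _).trans hr
  have h2 : (1 + ‖p.2 - p'.2‖) ^ s ≤ polyWeight n (p.2 - p'.2) ^ r := by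
    rw [← Real.rpow_natCast]
    exact Real.rpow_le_rpow_of_exponent_le (by linarith [norm_nonneg (p.2 - p'.2)]) hsr
  gcongr

/-- The integrable kernel `e^{-(n+1)|y|}`. -/
def expKernel (n : ℕ) (y : RSpace n) : NNReal := Real.toNNReal (expWeight n y ^ (n + 1))⁻¹

/-- The integrable kernel `(1 + |w|)^{-(n+1)}`. -/
def polyKernel (n : ℕ) (w : RSpace n) : NNReal := Real.toNNReal (polyWeight n w ^ (n + 1))⁻¹

theorem measurable_expKernel : Measurable (expKernel n) :=
  (((isBaseWeight_exp n).continuous.measurable.pow_const _).inv).real_toNNReal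

theorem measurable_polyKernel : Measurable (polyKernel n) :=
  (((isBaseWeight_one_add n).continuous.measurable.pow_const _).inv).real_toNNReal

theorem coe_expKernel (y : RSpace n) :
    (expKernel n y : ℝ≥0∞) = ENNReal.ofReal (expWeight n y ^ (n + 1))⁻¹ := rfl

theorem coe_polyKernel (w : RSpace n) :
    (polyKernel n w : ℝ≥0∞) = ENNReal.ofReal (polyWeight n w ^ (n + 1))⁻¹ := rfl

theorem lintegral_expKernel_ne_top : ∫⁻ y, (expKernel n y : ℝ≥0∞) ≠ ⊤ := by
  simp only [coe_expKernel]
  exact (isBaseWeight_exp n).integrable_inv_pow.lintegral_lt_top.ne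

theorem lintegral_polyKernel_ne_top : ∫⁻ y, (polyKernel n y : ℝ≥0∞) ≠ ⊤ := by
  simp only [coe_polyKernel]
  exact (isBaseWeight_one_add n).integrable_inv_pow.lintegral_lt_top.ne

theorem le_inv_mul_inv_of_pow_mul_le {N r : ℕ} {E P g D : ℝ} (hE : 0 < E) (hP : 0 < P)
    (h : E ^ (N + r) * P ^ (N + r) * g ≤ D) :
    g * (E ^ r * P ^ r) ≤ D * ((E ^ N)⁻¹ * (P ^ N)⁻¹) := by
  rw [← mul_inv, ← div_eq_mul_inv, le_div_iff₀ (by positivity)]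
  refine le_trans (le_of_eq ?_) h
  ring

theorem eLpNorm_enorm_mixed (F : RSpace n → RSpace n → ℂ) (m : RSpace n × RSpace n → ℝ)
    (p q : ℝ≥0∞) : mixedNorm p q m F =
      eLpNorm (fun ξ => eLpNorm (fun x => ‖F x ξ * (m (x, ξ) : ℂ)‖ₑ) p volume) q volume := by
  simp only [mixedNorm, eLpNorm_enorm]

/-- The main estimate: the analytically continued short-time Fourier transform is controlled on
strips by the short-time Fourier transform with respect to another window. -/
theorem exists_mixedNorm_stft_le {m : RSpace n × RSpace n → ℝ} (hm : IsWeightM1 m) {p q : ℝ≥0∞}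
    (hp : 1 ≤ p) (hq : 1 ≤ q) (g ψ : K1 n) (hg : ∫ s, g s * conj (g s) ≠ 0) (lam : ℝ) :
    ∃ C : ℝ, 0 < C ∧ ∀ (F : K1Dual n) (η : RSpace n), ‖η‖ ≤ lam →
      mixedNorm p q m (fun x ξ =>
        (Real.exp (-2 * Real.pi * inner ℝ x η) : ℂ) * stft ψ F x (complexPoint ξ η)) ≤
      ENNReal.ofReal C * modulationNormK1 g p q m F := by
  obtain ⟨A, r, hA, hmA⟩ := hm.exists_le
  -- Here `r` powers pay for moving the weight from `(x, ξ)` to `y`, and the remaining `n + 1` form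
  -- the integrable kernel.
  obtain ⟨k, M, D, hD0, hD⟩ := K1.exists_gaborCoeff_bound g (n + 1 + r)
  obtain ⟨S, hS⟩ := K1.exists_sumSeminorm_timeFreq_le ψ lam k M
  set κ := ∫ s, g s * conj (g s) with hκ
  set c : ℝ := ‖κ⁻¹‖ * (A * (D * S)) with hc
  set I₁ := ∫⁻ y, (expKernel n y : ℝ≥0∞)
  set I₂ := ∫⁻ y, (polyKernel n y : ℝ≥0∞)
  have hI₁ : I₁ ≠ ⊤ := lintegral_expKernel_ne_top
  have hI₂ : I₂ ≠ ⊤ := lintegral_polyKernel_ne_top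
  -- The sign of `S` is not known, hence the absolute value of `c`; the summand `1` makes the
  -- constant strictly positive.
  refine ⟨|c| * (I₁ * I₂).toReal + 1, by positivity, fun F η hη => ?_⟩
  have hcont := (K1.reproducing g F).1
  let u : RSpace n → RSpace n → ℝ≥0∞ := fun x ξ =>
    ‖stft g F x (fun j => (ξ j : ℂ)) * (m (x, ξ) : ℂ)‖ₑ
  have hu : Measurable (Function.uncurry u) :=
    (hcont.measurable.mul (Complex.measurable_ofReal.comp hm.measurable)).enorm
  have hpt : ∀ x ξ : RSpace n,
      ‖((Real.exp (-2 * Real.pi * inner ℝ x η) : ℂ) * stft ψ F x (complexPoint ξ η)) *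
        (m (x, ξ) : ℂ)‖ₑ ≤ ENNReal.ofReal |c| *
          ∫⁻ w, (polyKernel n w : ℝ≥0∞) * ∫⁻ y, (expKernel n y : ℝ≥0∞) * u (x - y) (ξ - w) := by
    intro x ξ
    have h1 := ((K1.reproducing g F).2 (K1.timeFreq ψ x (complexPoint ξ η))).2
    have h2 : stft ψ F x (complexPoint ξ η) = κ⁻¹ * ∫ p : RSpace n × RSpace n,
        gaborCoeff g (timeFreqFun ψ x (complexPoint ξ η)) p *
          stft g F p.1 (fun j => (p.2 j : ℂ)) := by
      rw [eq_inv_mul_iff_mul_eq₀ hg]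
      exact h1.symm
    rw [h2, mul_assoc, mul_assoc κ⁻¹, ← integral_mul_const, ← integral_const_mul,
      ← integral_const_mul]
    refine (enorm_integral_le_lintegral_enorm _).trans ?_
    have hmeas : Measurable fun y : RSpace n × RSpace n =>
        (polyKernel n (ξ - y.2) : ℝ≥0∞) * ((expKernel n (x - y.1) : ℝ≥0∞) * u y.1 y.2) :=
      (measurable_polyKernel.coe_nnreal_ennreal.comp (by fun_prop)).mul
        ((measurable_expKernel.coe_nnreal_ennreal.comp (by fun_prop)).mul hu)
    have h3 : ∀ y : RSpace n × RSpace n,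
        ‖(Real.exp (-2 * Real.pi * inner ℝ x η) : ℂ) * (κ⁻¹ *
          (gaborCoeff g (timeFreqFun ψ x (complexPoint ξ η)) y *
            stft g F y.1 (fun j => (y.2 j : ℂ)) * (m (x, ξ) : ℂ)))‖ₑ ≤
        ENNReal.ofReal |c| * ((polyKernel n (ξ - y.2) : ℝ≥0∞) *
          ((expKernel n (x - y.1) : ℝ≥0∞) * u y.1 y.2)) := by
      intro y
      have hmy := hm.pos y
      rw [coe_expKernel, coe_polyKernel]
      simp only [u]
      rw [← ofReal_norm, ← ofReal_norm, ← ENNReal.ofReal_mul (by positivity),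
        ← ENNReal.ofReal_mul (by positivity), ← ENNReal.ofReal_mul (abs_nonneg c)]
      refine ENNReal.ofReal_le_ofReal ?_
      simp only [norm_mul, Complex.norm_real, Real.norm_of_nonneg (hm.pos _).le,
        Real.norm_of_nonneg (Real.exp_pos _).le]
      rw [norm_gaborCoeff_timeFreqFun]
      set V := ‖stft g F y.1 (fun j => (y.2 j : ℂ))‖
      set G := ‖gaborCoeff g (timeFreqFun ψ 0 (complexPoint 0 η)) (y.1 - x, y.2 - ξ)‖
      have h4 := (hD (K1.timeFreq ψ 0 (complexPoint 0 η)) (y.1 - x, y.2 - ξ)).trans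
        (mul_le_mul_of_nonneg_left (hS η hη) hD0)
      have h5 := le_inv_mul_inv_of_pow_mul_le ((isBaseWeight_exp n).pos _)
        ((isBaseWeight_one_add n).pos _) h4
      have h6 := hmA (x, ξ) y
      simp only [expWeight, polyWeight, norm_sub_rev y.1 x, norm_sub_rev y.2 ξ] at h5 h6 ⊢
      set E := Real.exp ‖x - y.1‖
      set P := 1 + ‖ξ - y.2‖
      have hE : 0 < E := Real.exp_pos _
      have hP : 0 < P := by positivity
      -- The damping factor in the theorem exactly compensates the growth produced by covariance.
      have h7 : Real.exp (-2 * Real.pi * inner ℝ x η) *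
          Real.exp (2 * Real.pi * inner ℝ x η) = 1 := by
        rw [← Real.exp_add, ← Real.exp_zero]
        congr 1
        ring
      have hV : 0 ≤ V := norm_nonneg _
      have hG : 0 ≤ G := norm_nonneg _
      calc _ = (Real.exp (-2 * Real.pi * inner ℝ x η) *
            Real.exp (2 * Real.pi * inner ℝ x η)) * (‖κ⁻¹‖ * (G * V * m (x, ξ))) := by ring
        _ = ‖κ⁻¹‖ * (G * V * m (x, ξ)) := by rw [h7, one_mul]
        _ ≤ ‖κ⁻¹‖ * (G * V * (A * (E ^ r * P ^ r) * m y)) := by gcongr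
        _ = ‖κ⁻¹‖ * (A * (V * m y)) * (G * (E ^ r * P ^ r)) := by ring
        _ ≤ ‖κ⁻¹‖ * (A * (V * m y)) * (D * S * ((E ^ (n + 1))⁻¹ * (P ^ (n + 1))⁻¹)) := by
          exact mul_le_mul_of_nonneg_left h5 (by positivity)
        _ = c * ((P ^ (n + 1))⁻¹ * ((E ^ (n + 1))⁻¹ * (V * m y))) := by
          rw [hc]
          ring
        _ ≤ _ := by
          gcongr
          exact le_abs_self c
    refine (lintegral_mono h3).trans ?_
    -- Tonelli and reflections about `ξ` and `x` bring the bound to convolution form, with the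
    -- frequency integral outside as in the mixed norm.
    rw [lintegral_const_mul _ hmeas, Measure.volume_eq_prod, lintegral_prod_symm _
      hmeas.aemeasurable, ← lintegral_sub_left_eq_self _ ξ]
    gcongr with w
    dsimp only
    rw [sub_sub_cancel, ← lintegral_sub_left_eq_self _ x]
    simp only [sub_sub_cancel]
    rw [lintegral_const_mul]
    exact (measurable_expKernel.coe_nnreal_ennreal).mul
      (hu.comp (f := fun y => (x - y, ξ - w)) (by fun_prop))
  rw [eLpNorm_enorm_mixed, modulationNormK1, eLpNorm_enorm_mixed]
  have hK : ∀ ξ, eLpNorm (fun x => ‖((Real.exp (-2 * Real.pi * inner ℝ x η) : ℂ) *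
      stft ψ F x (complexPoint ξ η)) * (m (x, ξ) : ℂ)‖ₑ) p volume ≤ ENNReal.ofReal |c| *
      eLpNorm (fun x => ∫⁻ w, (polyKernel n w : ℝ≥0∞) *
        ∫⁻ y, (expKernel n y : ℝ≥0∞) * u (x - y) (ξ - w)) p volume := by
    intro ξ
    exact eLpNorm_le_nnreal_smul_eLpNorm_of_ae_le_mul' (c := Real.toNNReal |c|)
      (g := fun x => ∫⁻ w, (polyKernel n w : ℝ≥0∞) *
        ∫⁻ y, (expKernel n y : ℝ≥0∞) * u (x - y) (ξ - w))
      (Filter.Eventually.of_forall fun x => hpt x ξ) p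
  refine (eLpNorm_le_nnreal_smul_eLpNorm_of_ae_le_mul' (c := Real.toNNReal |c|)
      (g := fun ξ => eLpNorm (fun x => ∫⁻ w, (polyKernel n w : ℝ≥0∞) *
        ∫⁻ y, (expKernel n y : ℝ≥0∞) * u (x - y) (ξ - w)) p volume)
      (Filter.Eventually.of_forall fun ξ => hK ξ) q).trans ?_
  rw [ENNReal.smul_def, smul_eq_mul]
  refine (mul_le_mul_right (eLpNorm_eLpNorm_convolution_le (expKernel n) (polyKernel n)
    measurable_expKernel measurable_polyKernel hu hI₁ hp hq) _).trans ?_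
  rw [← mul_assoc]
  gcongr
  rw [ENNReal.ofReal_add (by positivity) zero_le_one, ENNReal.ofReal_mul (abs_nonneg c),
    ENNReal.ofReal_toReal (ENNReal.mul_ne_top hI₁ hI₂)]
  exact le_self_add

theorem gaborCoeff_add {ρ : RSpace n → ℝ} {φ χ χ' : RSpace n → ℂ}
    (hφ : Rapid ρ φ) (hχ : Integrable χ) (hχ' : Integrable χ') (p : RSpace n × RSpace n) :
    gaborCoeff φ (χ + χ') p = gaborCoeff φ χ p + gaborCoeff φ χ' p := by
  have hi : ∀ χ : RSpace n → ℂ, Integrable χ →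
      Integrable fun s => χ s * conj (timeFreqFun φ p.1 (fun j => (p.2 j : ℂ)) s) := by
    intro χ hχ
    obtain ⟨C, hC⟩ := hφ.decay 0
    refine hχ.mul_bdd (c := C) ?_ (Filter.Eventually.of_forall fun s => ?_)
    · exact (Complex.continuous_conj.comp
        (continuous_timeFreqFun_right hφ.continuous p.1 p.2)).aestronglyMeasurable
    · rw [RCLike.norm_conj, norm_timeFreqFun_ofReal]
      simpa using hC (s - p.1)
  rw [gaborCoeff, gaborCoeff, gaborCoeff, ← integral_add (hi χ hχ) (hi χ' hχ')]
  simp only [Pi.add_apply, add_mul]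

theorem gaborCoeff_smul (φ χ : RSpace n → ℂ) (c : ℂ) (p : RSpace n × RSpace n) :
    gaborCoeff φ (c • χ) p = c * gaborCoeff φ χ p := by
  simp only [gaborCoeff, Pi.smul_apply, smul_eq_mul, mul_assoc, integral_const_mul]

/-- A function on phase space with finite mixed norm pairs with the Gabor coefficients of
elements of `𝒦₁`. -/
theorem exists_lintegral_gaborCoeff_le {m : RSpace n × RSpace n → ℝ} (hm : IsWeightM1 m)
    {p q : ℝ≥0∞} (hp : 1 ≤ p) (hq : 1 ≤ q) (φ : K1 n) {V : RSpace n → RSpace n → ℂ}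
    (hV : Continuous (Function.uncurry V)) (hfin : mixedNorm p q m V < ⊤) :
    ∃ (k M : ℕ) (C : ℝ), 0 ≤ C ∧ ∀ χ : K1 n,
      ∫⁻ y : RSpace n × RSpace n, ‖gaborCoeff φ χ y * V y.1 y.2‖ₑ ≤
        ENNReal.ofReal (C * K1.sumSeminorm k M χ) := by
  obtain ⟨A, r, hA, hmA⟩ := hm.exists_le
  obtain ⟨k, M, D, hD0, hD⟩ := K1.exists_gaborCoeff_bound φ (n + 1 + r)
  let u : RSpace n → RSpace n → ℝ≥0∞ := fun x ξ => ‖V x ξ * (m (x, ξ) : ℂ)‖ₑ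
  have hu : Measurable (Function.uncurry u) :=
    (hV.measurable.mul (Complex.measurable_ofReal.comp hm.measurable)).enorm
  -- Moderateness also bounds `m` from below: comparing the origin with `y` gives `m 0 ≤ A E^r P^r m
  -- y`, so a factor `m y` can be inserted at the cost of `r` powers of each weight.
  set c := A / m 0 with hc
  have hm0 := hm.pos 0
  have hc0 : 0 < c := div_pos hA hm0
  have hmeas : Measurable fun y : RSpace n × RSpace n =>
      (polyKernel n y.2 : ℝ≥0∞) * ((expKernel n y.1 : ℝ≥0∞) * u y.1 y.2) :=
    (measurable_polyKernel.coe_nnreal_ennreal.comp measurable_snd).mul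
      ((measurable_expKernel.coe_nnreal_ennreal.comp measurable_fst).mul hu)
  set R := ∫⁻ y : RSpace n × RSpace n,
    (polyKernel n y.2 : ℝ≥0∞) * ((expKernel n y.1 : ℝ≥0∞) * u y.1 y.2) with hRdef
  have hpow : ∀ {I : ℝ≥0∞} {p : ℝ≥0∞}, 1 ≤ p → I ≠ ⊤ → I ^ (1 - 1 / p.toReal) ≠ ⊤ := by
    intro I p hp hI
    refine ENNReal.rpow_ne_top_of_nonneg ?_ hI
    rcases eq_or_ne p ⊤ with rfl | hp'
    · simp
    · have : 1 ≤ p.toReal := by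
        simpa using (ENNReal.toReal_le_toReal ENNReal.one_ne_top hp').2 hp
      rw [sub_nonneg]
      exact div_le_one_of_le₀ this (by linarith)
  have hexp1 : ∀ y, (expKernel n y : ℝ≥0∞) ≤ 1 := fun y => by
    rw [coe_expKernel, ENNReal.ofReal_le_one]
    exact inv_le_one_of_one_le₀ (one_le_pow₀ ((isBaseWeight_exp n).one_le y))
  have hpoly1 : ∀ y, (polyKernel n y : ℝ≥0∞) ≤ 1 := fun y => by
    rw [coe_polyKernel, ENNReal.ofReal_le_one]
    exact inv_le_one_of_one_le₀ (one_le_pow₀ ((isBaseWeight_one_add n).one_le y))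
  -- Hölder against the bounded integrable kernels, first in `x` and then in `ξ`, reduces finiteness
  -- to that of the mixed norm.
  have hR : R ≠ ⊤ := by
    set I₁ := ∫⁻ y, (expKernel n y : ℝ≥0∞)
    set I₂ := ∫⁻ y, (polyKernel n y : ℝ≥0∞)
    have hU : Measurable fun ξ => eLpNorm (fun x => u x ξ) p volume :=
      measurable_eLpNorm_prod hu hp
    refine ne_top_of_le_ne_top (b := eLpNorm (fun ξ => eLpNorm (fun x => u x ξ) p volume) q volume *
      I₂ ^ (1 - 1 / q.toReal) * I₁ ^ (1 - 1 / p.toReal)) ?_ ?_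
    · refine ENNReal.mul_ne_top (ENNReal.mul_ne_top ?_
        (hpow hq lintegral_polyKernel_ne_top)) (hpow hp lintegral_expKernel_ne_top)
      rw [eLpNorm_enorm_mixed] at hfin
      exact hfin.ne
    · rw [hRdef, Measure.volume_eq_prod, lintegral_prod_symm _ hmeas.aemeasurable]
      calc _ ≤ ∫⁻ ξ, (polyKernel n ξ : ℝ≥0∞) * eLpNorm (fun x => u x ξ) p volume *
            I₁ ^ (1 - 1 / p.toReal) := by
            refine lintegral_mono fun ξ => ?_
            dsimp only
            have hux : Measurable fun x => u x ξ := hu.comp measurable_prodMk_right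
            have hm2 : Measurable fun x => (expKernel n x : ℝ≥0∞) * u x ξ :=
              measurable_expKernel.coe_nnreal_ennreal.mul hux
            rw [lintegral_const_mul _ hm2, mul_assoc]
            gcongr
            exact lintegral_mul_le_eLpNorm_mul measurable_expKernel.coe_nnreal_ennreal hexp1
              hux hp
        _ = (∫⁻ ξ, (polyKernel n ξ : ℝ≥0∞) * eLpNorm (fun x => u x ξ) p volume) *
            I₁ ^ (1 - 1 / p.toReal) :=
            lintegral_mul_const _ (measurable_polyKernel.coe_nnreal_ennreal.mul hU)
        _ ≤ _ := by
            gcongr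
            exact lintegral_mul_le_eLpNorm_mul measurable_polyKernel.coe_nnreal_ennreal hpoly1
              hU hq
  refine ⟨k, M, c * D * R.toReal, by positivity, fun χ => ?_⟩
  have hS := K1.sumSeminorm_nonneg k M χ
  have h3 : ∀ y : RSpace n × RSpace n, ‖gaborCoeff φ χ y * V y.1 y.2‖ₑ ≤
      ENNReal.ofReal (c * (D * K1.sumSeminorm k M χ)) *
        ((polyKernel n y.2 : ℝ≥0∞) * ((expKernel n y.1 : ℝ≥0∞) * u y.1 y.2)) := by
    intro y
    have hmy := hm.pos y
    rw [coe_expKernel, coe_polyKernel]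
    simp only [u]
    rw [← ofReal_norm, ← ofReal_norm, ← ENNReal.ofReal_mul (by positivity),
      ← ENNReal.ofReal_mul (by positivity), ← ENNReal.ofReal_mul (by positivity)]
    refine ENNReal.ofReal_le_ofReal ?_
    rw [norm_mul, norm_mul, Complex.norm_real, Real.norm_of_nonneg hmy.le]
    have h5 := le_inv_mul_inv_of_pow_mul_le ((isBaseWeight_exp n).pos _)
      ((isBaseWeight_one_add n).pos _) (hD χ y)
    have h6 := hmA 0 y
    simp only [Prod.fst_zero, Prod.snd_zero, zero_sub, expWeight, polyWeight, norm_neg]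
      at h5 h6 ⊢
    set E := Real.exp ‖y.1‖
    set P := 1 + ‖y.2‖
    have hE : 0 < E := Real.exp_pos _
    have hP : 0 < P := by positivity
    have h7 : 1 ≤ c * (E ^ r * P ^ r) * m y := by
      rw [hc, div_mul_eq_mul_div, div_mul_eq_mul_div, le_div_iff₀ hm0, one_mul]
      exact h6
    calc _ ≤ ‖gaborCoeff φ χ y‖ * ‖V y.1 y.2‖ * (c * (E ^ r * P ^ r) * m y) :=
          le_mul_of_one_le_right (by positivity) h7
      _ = c * (‖V y.1 y.2‖ * m y) * (‖gaborCoeff φ χ y‖ * (E ^ r * P ^ r)) := by ring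
      _ ≤ c * (‖V y.1 y.2‖ * m y) *
          (D * K1.sumSeminorm k M χ * ((E ^ (n + 1))⁻¹ * (P ^ (n + 1))⁻¹)) := by gcongr
      _ = _ := by ring
  refine (lintegral_mono h3).trans_eq ?_
  rw [lintegral_const_mul _ hmeas, ← hRdef]
  conv_lhs => rw [← ENNReal.ofReal_toReal hR, ← ENNReal.ofReal_mul (by positivity)]
  congr 1
  ring

/-- The right-hand side of the reproducing formula makes sense for every `χ ∈ 𝒦₁` and is taken as
the definition of the extension; on `Σ₁¹` the formula itself shows that it returns `f`. -/
theorem exists_extends {m : RSpace n × RSpace n → ℝ} (hm : IsWeightM1 m)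
    {p q : ℝ≥0∞} (hp : 1 ≤ p) (hq : 1 ≤ q) {φ : GelfandShilov n} (hφ : φ ≠ 0)
    {f : GelfandShilovDual n} (hf : f ∈ modulationSpace φ p q m) :
    ∃ F : K1Dual n, Extends F f := by
  have hκ : ∫ s, φ s * conj (φ s) ≠ 0 :=
    integral_mul_conj_self_ne_zero (isBaseWeight_exp n) φ.biRapid.fst
      fun h => hφ (Subtype.ext h)
  obtain ⟨hcont, hrep⟩ := GelfandShilov.reproducing φ f
  obtain ⟨k, M, C, hC0, hC⟩ := exists_lintegral_gaborCoeff_le hm hp hq φ.toK1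
    (V := stftGS φ f) hcont hf
  set κ := ∫ s, φ s * conj (φ s)
  have hint : ∀ χ : K1 n, Integrable fun y : RSpace n × RSpace n =>
      gaborCoeff φ χ y * stftGS φ f y.1 y.2 := fun χ =>
    ⟨((continuous_gaborCoeff φ.biRapid.fst χ.rapid.continuous
      (χ.rapid.integrable (isBaseWeight_exp n))).mul hcont).aestronglyMeasurable,
      (hC χ).trans_lt ENNReal.ofReal_lt_top⟩
  let L : K1 n →ₗ[ℂ] ℂ :=
    { toFun := fun χ => κ⁻¹ * ∫ y : RSpace n × RSpace n, gaborCoeff φ χ y * stftGS φ f y.1 y.2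
      map_add' := fun χ χ' => by
        rw [← mul_add, ← integral_add (hint χ) (hint χ')]
        refine congrArg (κ⁻¹ * ·) (integral_congr_ae (Filter.Eventually.of_forall fun y => ?_))
        dsimp only
        rw [← add_mul, ← gaborCoeff_add φ.biRapid.fst
          (χ.rapid.integrable (isBaseWeight_exp n)) (χ'.rapid.integrable (isBaseWeight_exp n))]
        rfl
      map_smul' := fun c χ => by
        rw [RingHom.id_apply, smul_eq_mul, mul_left_comm, ← integral_const_mul c]
        refine congrArg (κ⁻¹ * ·) (integral_congr_ae (Filter.Eventually.of_forall fun y => ?_))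
        dsimp only
        rw [← mul_assoc, ← gaborCoeff_smul]
        rfl }
  have hL : ∀ χ, ‖L χ‖ ≤ ‖κ⁻¹‖ * (C * K1.sumSeminorm k M χ) := by
    intro χ
    have hS := K1.sumSeminorm_nonneg k M χ
    refine (norm_mul_le _ _).trans ?_
    gcongr
    refine (norm_integral_le_lintegral_norm _).trans ?_
    refine ENNReal.toReal_le_of_le_ofReal (by positivity) ?_
    simp only [ofReal_norm]
    exact hC χ
  have hLc : Continuous L := by
    have := (K1.withSeminorms n).topologicalAddGroup
    refine continuous_of_continuousAt_zero L ?_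
    rw [ContinuousAt, map_zero]
    refine squeeze_zero_norm hL ?_
    have h1 : Continuous fun χ : K1 n => ‖κ⁻¹‖ * (C * K1.sumSeminorm k M χ) :=
      continuous_const.mul (continuous_const.mul
        (continuous_finsetSum _ fun j _ => (K1.withSeminorms n).continuous_seminorm (k, j)))
    have h2 := h1.tendsto 0
    simpa [K1.sumSeminorm] using h2
  refine ⟨⟨L, hLc⟩, fun χ φ' h => ?_⟩
  have h1 : (χ : RSpace n → ℂ) = φ' := funext h
  change κ⁻¹ * ∫ y : RSpace n × RSpace n, gaborCoeff φ χ y * stftGS φ f y.1 y.2 = f φ'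
  rw [h1, hrep φ', inv_mul_cancel_left₀ hκ]

theorem mainTheorem11 {n : ℕ} (m : RSpace n × RSpace n → ℝ) (hm : IsWeightM1 m)
    (p q : ℝ≥0∞) (hp : 1 ≤ p) (hq : 1 ≤ q)
    (φ : GelfandShilov n) (hφ : φ ≠ 0) (γ : K1 n) (hγ : γ ≠ 0) (ψ : K1 n) (hψ : ψ ≠ 0) :
    (∀ f ∈ modulationSpace φ p q m, ∃! F : K1Dual n, Extends F f) ∧
    ∀ lam : ℝ, 0 ≤ lam → ∃ C : ℝ, 0 < C ∧
      ∀ f ∈ modulationSpace φ p q m, ∀ F : K1Dual n, Extends F f →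
        (∀ x : RSpace n, Differentiable ℂ (stft ψ F x)) ∧
        ∀ η : RSpace n, ‖η‖ ≤ lam →
          mixedNorm p q m (fun x ξ =>
              (Real.exp (-2 * Real.pi * inner ℝ x η) : ℂ) * stft ψ F x (complexPoint ξ η))
            ≤ ENNReal.ofReal C * modulationNorm φ p q m f ∧
          mixedNorm p q m (fun x ξ =>
              (Real.exp (-2 * Real.pi * inner ℝ x η) : ℂ) * stft ψ F x (complexPoint ξ η))
            ≤ ENNReal.ofReal C * modulationNormK1 γ p q m F := by
  refine ⟨fun f hf => ?_, fun lam _ => ?_⟩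
  · obtain ⟨F, hF⟩ := exists_extends hm hp hq hφ hf
    exact ⟨F, hF, fun F' hF' => eq_of_extends hφ hF' hF⟩
  obtain ⟨C₁, hC₁, h₁⟩ := exists_mixedNorm_stft_le hm hp hq φ.toK1 ψ
    (integral_mul_conj_self_ne_zero (isBaseWeight_exp n) φ.biRapid.fst
      fun h => hφ (Subtype.ext h)) lam
  obtain ⟨C₂, hC₂, h₂⟩ := exists_mixedNorm_stft_le hm hp hq γ ψ
    (integral_mul_conj_self_ne_zero (isBaseWeight_exp n) γ.rapid
      fun h => hγ (Subtype.ext h)) lam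
  refine ⟨max C₁ C₂, lt_max_of_lt_left hC₁, fun f _ F hF =>
    ⟨fun x => differentiable_stft ψ F x, fun η hη => ⟨?_, ?_⟩⟩⟩
  · refine (h₁ F η hη).trans ?_
    -- Viewed in `𝒦₁`, the window `φ` gives the original norm of `f`, so the first bound is the main
    -- estimate with `g = φ.toK1`.
    have h3 : modulationNormK1 φ.toK1 p q m F = modulationNorm φ p q m f := by
      simp only [modulationNormK1, modulationNorm, stft_toK1_of_extends hF]
    rw [h3]
    gcongr
    exact le_max_left _ _
  · refine (h₂ F η hη).trans ?_
    gcongr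
    exact le_max_right _ _

end
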